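/- **Theorem (Euler–Lagrange equation for variational problems on time scales with higher-order delta derivatives).** Let $n,r\in\mathbb N$, $r\ge 1$, let $\mathbb T_0\subseteq\mathbb R$ be closed, $a,b\in\mathbb T_0$, $a<b$, and let $\mathbb T=[a,b]\cap\mathbb T_0$ have at least $2r+1$ points. Let $\sigma(t)=\inf\{s\in\mathbb T: s>t\}$, $\rho(t)=\sup\{s\in\mathbb T:s<t\}$ (with $\sigma(b)=b$, $\rho(a)=a$), let $\mathbb T^{\kappa}=\mathbb T\setminus(\rho(b),b]$, $\mathbb T^{\kappa^{m+1}}=(\mathbb T^{\kappa^m})^\kappa$. A function $f:\mathbb T\to\mathbb R^d$ has delta derivative $f^\Delta(t)$ at $t\in\mathbb T^\kappa$ if for every $\varepsilon>0$ one has $|f(\sigma(t))-f(s)-f^\Delta(t)(\sigma(t)-s)|\le\varepsilon|\sigma(t)-s|$ for all $s\in\mathbb T$ close enough to $t$; $f^{\Delta^m}:\mathbb T^{\kappa^m}\to\mathbb R^d$ is the $m$-th iterate, and $f^{\sigma^i\Delta^j}=(f\circ\sigma^i)^{\Delta^j}$. The delta integral is $\int_c^d f(t)\,\Delta t=F(d)-F(c)$,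 where $F^\Delta=f$. Assume (H) there are $a_1>0$ and $a_0\in\mathbb R$ with $\sigma(t)=a_1t+a_0$ for all $t\in\mathbb T$, $t<b$. Let $L(t,u_0,\dots,u_r)$, $t\in\mathbb T$, $u_i\in\mathbb R^n$, be real-valued, and let $L$ and its first-order partial derivatives with respect to $u_0,\dots,u_r$ be continuous in $(t,u_0,\dots,u_r)$; if $\mathbb T$ is infinite, assume moreover that $L$ has jointly continuous mixed partial derivatives (delta derivatives in $t$, ordinary derivatives in the $u_i$, taken in any order) up to the total order $r+1$. Let $C^{2r}$ be the set of $y:\mathbb T\to\mathbb R^n$ such that $y^{\Delta^{2r}}$ exists and is continuous on $\mathbb T^{\kappa^{2r}}$. Given $\alpha_j,\beta_j\in\mathbb R^n$, consider the problem $$\mathcal L[y]=\int_a^{\rho^{r-1}(b)}L\bigl(t,y^{\sigma^r}(t),y^{\sigma^{r-1}\Delta}(t),\dots,y^{\sigma\Delta^{r-1}}(t),y^{\Delta^r}(t)\bigr)\,\Delta t\longrightarrow\min,$$ $$y^{\Delta^j}(a)=\alpha_j,\qquad y^{\Delta^j}(\rho^{r-1}(b))=\beta_j,\qquad j=0,\dots,r-1,$$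 over $y\in C^{2r}$. Let $y_*$ be a weak local minimum, i.e. $y_*\in C^{2r}$ satisfies the boundary conditions and there is $\delta>0$ such that $\mathcal L[y_*]\le\mathcal L[y]$ for all $y\in C^{2r}$ that satisfy the boundary conditions and $\sum_{i=0}^r\sup_{t\in\mathbb T^{\kappa^r}}|(y-y_*)^{\sigma^i\Delta^{r-i}}(t)|<\delta$. Let $L_{u_i}$ denote the gradient of $L$ in the variable $u_i\in\mathbb R^n$, and let $L_{u_i}^{\Delta^i}(\cdot)$ be the $i$-th delta derivative of the composite function $t\mapsto L_{u_i}\bigl(t,y_*^{\sigma^r}(t),y_*^{\sigma^{r-1}\Delta}(t),\dots,y_*^{\Delta^r}(t)\bigr)$, $t\in\mathbb T^{\kappa^r}$. Then, for $i=0,\dots,r$, these composite functions are $i$ times delta differentiable, and $$\sum_{i=0}^r(-1)^i\Bigl(\frac1{a_1}\Bigr)^{\frac{i(i-1)}2}L_{u_i}^{\Delta^i}\bigl(t,y_*^{\sigma^r}(t),y_*^{\sigma^{r-1}\Delta}(t),\dots,y_*^{\sigma\Delta^{r-1}}(t),y_*^{\Delta^r}(t)\bigr)=0$$ for all $t\in\mathbb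 T$ with $a\le t\le\rho^{2r}(b)$. -/

import Mathlib

namespace TimeScale

/-- Forward jump operator of the time scale `T`, with the convention `inf ∅ = sup T`. -/
noncomputable def sigma (T : Set ℝ) (t : ℝ) : ℝ :=
  open Classical in if (T ∩ Set.Ioi t).Nonempty then sInf (T ∩ Set.Ioi t) else sSup T

/-- Backward jump operator of the time scale `T`, with the convention `sup ∅ = inf T`. -/
noncomputable def rho (T : Set ℝ) (t : ℝ) : ℝ :=
  open Classical in if (T ∩ Set.Iio t).Nonempty then sSup (T ∩ Set.Iio t) else sInf T

/-- `T^κ = T \ (ρ(b), b]` for a time scale `T` with maximum `b`. The iterate `kappa^[m] T`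
is `T^{κ^m}`. -/
noncomputable def kappa (T : Set ℝ) : Set ℝ :=
  T \ Set.Ioc (rho T (sSup T)) (sSup T)

section DeltaDerivative

variable {F : Type} [NormedAddCommGroup F] [NormedSpace ℝ F]

/-- `f'` is a delta derivative at `t` of the function `f` on the time scale `T`
(used for `t ∈ T^κ`; only the values of `f` on `T` matter). -/
def HasDeltaDerivAt (T : Set ℝ) (f : ℝ → F) (f' : F) (t : ℝ) : Prop :=
  ∀ ε : ℝ, 0 < ε → ∃ δ : ℝ, 0 < δ ∧ ∀ s ∈ T, |s - t| < δ →
    ‖f (sigma T t) - f s - (sigma T t - s) • f'‖ ≤ ε * |sigma T t - s|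

/-- The delta derivative of `f` on the time scale `T` at `t` (`0` if there is none). -/
noncomputable def deltaDeriv (T : Set ℝ) (f : ℝ → F) (t : ℝ) : F :=
  open Classical in if h : ∃ f' : F, HasDeltaDerivAt T f f' t then h.choose else 0

/-- The `m`-th delta derivative `f^{Δ^m}`, a function on `T^{κ^m}`: `f^{Δ^{m+1}}` is the delta
derivative of the function `f^{Δ^m}` on `T^{κ^m}`. -/
noncomputable def deltaIter (T : Set ℝ) (f : ℝ → F) : ℕ → ℝ → F
  | 0 => f
  | m + 1 => deltaDeriv (kappa^[m] T) (deltaIter T f m)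

/-- `f` is `m` times delta differentiable: for every `j < m` the function `f^{Δ^j}` is delta
differentiable at all points of `T^{κ^{j+1}}`. -/
def DeltaDifferentiable (T : Set ℝ) (m : ℕ) (f : ℝ → F) : Prop :=
  ∀ j < m, ∀ t ∈ kappa^[j + 1] T,
    ∃ f' : F, HasDeltaDerivAt (kappa^[j] T) (deltaIter T f j) f' t

/-- The class `C^m`: `f^{Δ^m}` exists and is continuous on `T^{κ^m}`. -/
def IsC (T : Set ℝ) (m : ℕ) (f : ℝ → F) : Prop :=
  DeltaDifferentiable T m f ∧ ContinuousOn (deltaIter T f m) (kappa^[m] T)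

/-- The delta integral `∫_c^d f(t) Δt` over points `c`, `d` of the time scale `T`: it is
`F(d) - F(c)` for an antiderivative `F` of `f` on `T` (`0` if there is none). -/
noncomputable def deltaIntegral (T : Set ℝ) (f : ℝ → F) (c d : ℝ) : F :=
  open Classical in
  if h : ∃ G : ℝ → F, ∀ t ∈ kappa T, HasDeltaDerivAt T G (f t) t then
    h.choose d - h.choose c
  else 0

end DeltaDerivative

/-- Joint class `C^k` on `T × V` in a time scale variable `t` and an ordinary variable `u`:
all mixed partial derivatives of total order at most `k`, delta derivatives with respect to `t`
and ordinary derivatives with respect to `u`, in any order, exist and are jointly continuous. -/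
def JointC {V : Type} [NormedAddCommGroup V] [NormedSpace ℝ V] :
    (k : ℕ) → {F : Type} → [NormedAddCommGroup F] → [NormedSpace ℝ F] →
      (T : Set ℝ) → (f : ℝ → V → F) → Prop
  | 0, _, _, _, T, f => ContinuousOn (fun p : ℝ × V => f p.1 p.2) (T ×ˢ Set.univ)
  | k + 1, _, _, _, T, f =>
      ContinuousOn (fun p : ℝ × V => f p.1 p.2) (T ×ˢ Set.univ) ∧
      (∀ t ∈ T, Differentiable ℝ (f t)) ∧
      JointC k T (fun t u => fderiv ℝ (f t) u) ∧
      (∀ u : V, ∀ t ∈ kappa T, ∃ f', HasDeltaDerivAt T (fun s => f s u) f' t) ∧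
      JointC k (kappa T) (fun t u => deltaDeriv T (fun s => f s u) t)

section Problem

variable {n r : ℕ}

/-- The conditions on the Lagrangian `L(t, u_0, …, u_r)`: `L` and its first partial derivatives
with respect to `u_0, …, u_r` are continuous on `T × (ℝⁿ)^{r+1}`; and `L` has continuous partial
derivatives (delta in `t`, ordinary in `u`) up to the total order `r + 1`. The second condition
is only imposed when `T` is infinite: on a finite time scale there are no dense points, and
continuity and delta differentiability in `t` are automatic. -/
def IsLagrangian (T : Set ℝ) (L : ℝ → (Fin (r + 1) → EuclideanSpace ℝ (Fin n)) → ℝ) : Prop :=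
  JointC 0 T L ∧ (∀ t ∈ T, Differentiable ℝ (L t)) ∧
    JointC 0 T (fun t u => fderiv ℝ (L t) u) ∧
    (T.Infinite → JointC (r + 1) T L)

/-- The vector `(y^{σ^r}(t), y^{σ^{r-1}Δ}(t), …, y^{σΔ^{r-1}}(t), y^{Δ^r}(t))`; its `i`-th entry
is `y^{σ^{r-i}Δ^i}(t)`, the `i`-th delta derivative of `y ∘ σ^{r-i}`. -/
noncomputable def jet (T : Set ℝ) (r : ℕ) (y : ℝ → EuclideanSpace ℝ (Fin n)) (t : ℝ) :
    Fin (r + 1) → EuclideanSpace ℝ (Fin n) :=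
  fun i => deltaIter T (fun s => y ((sigma T)^[r - (i : ℕ)] s)) (i : ℕ) t

/-- The functional `∫_a^{ρ^{r-1}(b)} L(t, y^{σ^r}(t), …, y^{Δ^r}(t)) Δt`. The integrand is a
function on `T^{κ^r}`, and the integral is taken over the time scale
`T^{κ^{r-1}} = T ∩ [a, ρ^{r-1}(b)]`. -/
noncomputable def action (T : Set ℝ) (a b : ℝ)
    (L : ℝ → (Fin (r + 1) → EuclideanSpace ℝ (Fin n)) → ℝ)
    (y : ℝ → EuclideanSpace ℝ (Fin n)) : ℝ :=
  deltaIntegral (kappa^[r - 1] T) (fun t => L t (jet T r y t)) a ((rho T)^[r - 1] b)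

/-- `y ∈ C^{2r}` satisfies the boundary conditions of the problem. -/
def IsAdmissible (T : Set ℝ) (a b : ℝ) (α β : Fin r → EuclideanSpace ℝ (Fin n))
    (y : ℝ → EuclideanSpace ℝ (Fin n)) : Prop :=
  IsC T (2 * r) y ∧ ∀ j : Fin r,
    deltaIter T y j a = α j ∧ deltaIter T y j ((rho T)^[r - 1] b) = β j

/-- The norm `‖y‖_{r,∞} = ∑_{i=0}^r sup_{t ∈ T^{κ^r}} |y^{σ^iΔ^{r-i}}(t)|`. -/
noncomputable def normR (T : Set ℝ) (r : ℕ) (y : ℝ → EuclideanSpace ℝ (Fin n)) : ENNReal :=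
  ∑ i : Fin (r + 1), ⨆ t ∈ kappa^[r] T, ‖jet T r y t i‖ₑ

/-- `y₀` is a weak local minimum of the problem with Lagrangian `L` and boundary data `α`, `β`. -/
def IsWeakLocalMin (T : Set ℝ) (a b : ℝ)
    (L : ℝ → (Fin (r + 1) → EuclideanSpace ℝ (Fin n)) → ℝ)
    (α β : Fin r → EuclideanSpace ℝ (Fin n)) (y₀ : ℝ → EuclideanSpace ℝ (Fin n)) : Prop :=
  IsAdmissible T a b α β y₀ ∧ ∃ δ : ℝ, 0 < δ ∧
    ∀ y : ℝ → EuclideanSpace ℝ (Fin n), IsAdmissible T a b α β y →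
      normR T r (fun t => y t - y₀ t) < ENNReal.ofReal δ → action T a b L y₀ ≤ action T a b L y

/-- The partial derivative `L_{u_i}(t, u)`, a vector of `ℝⁿ` (the gradient in the variable
`u_i ∈ ℝⁿ`). -/
noncomputable def partialU (L : ℝ → (Fin (r + 1) → EuclideanSpace ℝ (Fin n)) → ℝ)
    (i : Fin (r + 1)) (t : ℝ) (u : Fin (r + 1) → EuclideanSpace ℝ (Fin n)) :
    EuclideanSpace ℝ (Fin n) :=
  gradient (fun v => L t (Function.update u i v)) (u i)

end Problem

end TimeScale

/-! Hypothesis (H) is rigid. If t < σ(t) and t < b, then t is isolated, because a point s < t of T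
must satisfy a₁s + a₀ ≤ t. If σ(t) = t < b, then t is fixed by the affine map. Hence
(`eq_Icc_or_exists_disc`) either a₁ = 1 and T = [a,b], or all points of T are isolated except
possibly one end e, a fixed point of the affine map at which T accumulates geometrically.

On an interval every notion becomes classical (`euler_lagrange_Icc`): vary by smooth functions with
compact support, differentiate under the integral, integrate by parts and apply the fundamental
lemma.

In the other case take t₀ ≠ e in T^{κ^{2r}} and change y only at the single point σ^r(t₀), in a
direction v. The boundary data are untouched and the integrand changes only at t₀, …, σ^r(t₀), so
minimality says that a finite sum is stationary. Summing by parts i times moves Δ^i onto L_{u_i}.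
The graininess μ(t) = σ(t) - t satisfies μ(σ(t)) = a₁μ(t), so Δ(f∘σ) = a₁(Δf)∘σ; interchanging Δ and
σ at each step produces (1/a₁)^{0+1+⋯+(i-1)}. Boundary terms vanish and one summand survives
(`sum_mul_affDiff_spike`), leaving μ(t₀)⟨E,v⟩ = 0, where E is the Euler–Lagrange expression at t₀.
The choice v = E gives E = 0.

The equation extends to e by continuity, which rests on Taylor expansions. The difference quotient
along σ sends (t-e)^{j+1} to a nonzero multiple of (t-e)^j, so taking and undoing a delta derivative
lowers and raises the order of an expansion by one (`Disc.taylorAt_deltaDeriv`,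
`Disc.taylorAt_succ`). Thus C^m means an expansion of order m at e (`Disc.isC_iff`), and joint
smoothness of L gives one for the composites L_{u_i} (`JointC.jointTaylorAt`,
`JointTaylorAt.taylorAt_comp`). -/

namespace TimeScale

open Filter Topology Set

/-! ### Jump operators, the truncations T^{κ^m}, and induction on compact time scales. -/

section Jumps

variable {S T : Set ℝ} {a b c t x : ℝ}

theorem rho_mem (hS : IsCompact S) (hne : S.Nonempty) (t : ℝ) : rho S t ∈ S := by
  unfold rho
  split_ifs with h
  · have h1 : sSup (S ∩ Iio t) ∈ closure (S ∩ Iio t) :=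
      csSup_mem_closure h (hS.bddAbove.mono inter_subset_left)
    exact (closure_minimal inter_subset_left hS.isClosed) h1
  · exact hS.sInf_mem hne

theorem le_rho (hS : IsCompact S) (hx : x ∈ S) (h : x < t) : x ≤ rho S t := by
  have hne : (S ∩ Iio t).Nonempty := ⟨x, hx, h⟩
  unfold rho
  rw [if_pos hne]
  exact le_csSup (hS.bddAbove.mono inter_subset_left) ⟨hx, h⟩

theorem rho_le (hS : IsCompact S) (ht : t ∈ S) : rho S t ≤ t := by
  unfold rho
  split_ifs with h
  · exact csSup_le h fun y hy => hy.2.le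
  · exact csInf_le hS.bddBelow ht

theorem kappa_subset : kappa S ⊆ S := sdiff_subset

theorem kappa_eq (hb : IsGreatest S b) : kappa S = S ∩ Iic (rho S b) := by
  have h : sSup S = b := hb.csSup_eq
  unfold kappa
  rw [h]
  ext x
  simp only [Set.mem_sdiff, mem_Ioc, not_and, not_le, mem_inter_iff, mem_Iic]
  refine and_congr_right fun hx => ⟨fun h1 => ?_, fun h1 h2 => absurd h1 (not_le.2 h2)⟩
  by_contra! h2
  exact absurd (hb.2 hx) (not_le.2 (h1 h2))

theorem rho_inter_Iic (hc : c ∈ T) : rho (T ∩ Iic c) c = rho T c := by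
  have h : T ∩ Iic c ∩ Iio c = T ∩ Iio c := by
    ext x
    simp only [mem_inter_iff, mem_Iic, mem_Iio]
    exact ⟨fun h => ⟨h.1.1, h.2⟩, fun h => ⟨⟨h.1, h.2.le⟩, h.2⟩⟩
  unfold rho
  rw [h]
  split_ifs with h1
  · rfl
  · have h2 : IsLeast T c := ⟨hc, fun x hx => by
      by_contra! h3
      exact h1 ⟨x, hx, h3⟩⟩
    have h3 : IsLeast (T ∩ Iic c) c := ⟨⟨hc, le_refl c⟩, fun x hx => h2.2 hx.1⟩
    rw [h2.csInf_eq, h3.csInf_eq]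

/-- The backward jump at the top of a truncated scale is the one computed in T, so iterating κ
amounts to cutting T at ρ^m(b). -/
theorem kappa_iterate (hT : IsCompact T) (hb : IsGreatest T b) (m : ℕ) :
    kappa^[m] T = T ∩ Iic ((rho T)^[m] b) ∧ (rho T)^[m] b ∈ T := by
  induction m with
  | zero =>
    refine ⟨?_, hb.1⟩
    ext x
    simpa using fun hx => hb.2 hx
  | succ m ih =>
    obtain ⟨ih1, ih2⟩ := ih
    rw [Function.iterate_succ_apply', Function.iterate_succ_apply', ih1]
    have hc : IsCompact (T ∩ Iic ((rho T)^[m] b)) := hT.inter_right isClosed_Iic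
    have hg : IsGreatest (T ∩ Iic ((rho T)^[m] b)) ((rho T)^[m] b) :=
      ⟨⟨ih2, le_refl ((rho T)^[m] b)⟩, fun x hx => hx.2⟩
    rw [kappa_eq hg, rho_inter_Iic ih2]
    refine ⟨?_, rho_mem hT ⟨b, hb.1⟩ _⟩
    ext x
    simp only [mem_inter_iff, mem_Iic]
    have := rho_le hT ih2
    exact ⟨fun h => ⟨h.1.1, h.2⟩, fun h => ⟨⟨h.1, h.2.trans this⟩, h.2⟩⟩

theorem isGreatest_kappa_iterate (hT : IsCompact T) (hb : IsGreatest T b) (m : ℕ) :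
    IsGreatest (kappa^[m] T) ((rho T)^[m] b) := by
  obtain ⟨h1, h2⟩ := kappa_iterate hT hb m
  rw [h1]
  exact ⟨⟨h2, le_refl ((rho T)^[m] b)⟩, fun x hx => hx.2⟩

theorem isCompact_kappa_iterate (hT : IsCompact T) (hb : IsGreatest T b) (m : ℕ) :
    IsCompact (kappa^[m] T) := by
  rw [(kappa_iterate hT hb m).1]
  exact hT.inter_right isClosed_Iic

theorem kappa_iterate_anti {m k : ℕ} (h : m ≤ k) : kappa^[k] T ⊆ kappa^[m] T := by
  induction k, h using Nat.le_induction with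
  | base => exact subset_rfl
  | succ k _ ih =>
    rw [Function.iterate_succ_apply']
    exact kappa_subset.trans ih

theorem isLeast_kappa_iterate (hT : IsCompact T) (ha : IsLeast T a) (hb : IsGreatest T b) (m : ℕ) :
    IsLeast (kappa^[m] T) a := by
  obtain ⟨h1, h2⟩ := kappa_iterate hT hb m
  rw [h1]
  exact ⟨⟨ha.1, ha.2 h2⟩, fun x hx => ha.2 hx.1⟩

theorem sigma_le (hS : IsCompact S) (hx : x ∈ S) (h : t < x) : sigma S t ≤ x := by
  have hne : (S ∩ Ioi t).Nonempty := ⟨x, hx, h⟩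
  unfold sigma
  rw [if_pos hne]
  exact csInf_le (hS.bddBelow.mono inter_subset_left) ⟨hx, h⟩

theorem sigma_mem (hS : IsCompact S) (hne : S.Nonempty) (t : ℝ) : sigma S t ∈ S := by
  unfold sigma
  split_ifs with h
  · have h1 : sInf (S ∩ Ioi t) ∈ closure (S ∩ Ioi t) :=
      csInf_mem_closure h (hS.bddBelow.mono inter_subset_left)
    exact (closure_minimal inter_subset_left hS.isClosed) h1
  · exact hS.sSup_mem hne

theorem le_sigma (hS : IsCompact S) (ht : t ∈ S) : t ≤ sigma S t := by
  unfold sigma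
  split_ifs with h
  · exact le_csInf h fun y hy => le_of_lt hy.2
  · exact le_csSup hS.bddAbove ht

theorem sigma_of_isGreatest (hb : IsGreatest S b) : sigma S b = b := by
  have hne : ¬ (S ∩ Ioi b).Nonempty := fun ⟨x, hx, h⟩ => absurd (hb.2 hx) (not_le.2 h)
  unfold sigma
  rw [if_neg hne, hb.csSup_eq]

theorem sigma_inter_Iic (hT : IsCompact T) (hc : c ∈ T) (h : t < c) :
    sigma (T ∩ Iic c) t = sigma T t := by
  have hne : (T ∩ Iic c ∩ Ioi t).Nonempty := ⟨c, ⟨hc, le_refl c⟩, h⟩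
  have hne' : (T ∩ Ioi t).Nonempty := ⟨c, hc, h⟩
  have hC : IsCompact (T ∩ Iic c) := hT.inter_right isClosed_Iic
  refine le_antisymm ?_ ?_
  · conv_rhs => unfold sigma
    rw [if_pos hne']
    refine le_csInf hne' fun x hx => ?_
    rcases le_total x c with h1 | h1
    · exact sigma_le hC ⟨hx.1, h1⟩ hx.2
    · exact (sigma_le hC ⟨hc, le_refl c⟩ h).trans h1
  · conv_rhs => unfold sigma
    rw [if_pos hne]
    exact le_csInf hne fun x hx => sigma_le hT hx.1.1 hx.2

theorem sigma_rho (hT : IsCompact T) (hc : c ∈ T) (h : rho T c < c) : sigma T (rho T c) = c := by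
  refine le_antisymm (sigma_le hT hc h) ?_
  have hne' : (T ∩ Ioi (rho T c)).Nonempty := ⟨c, hc, h⟩
  unfold sigma
  rw [if_pos hne']
  refine le_csInf hne' fun y hy => ?_
  by_contra! h2
  exact absurd (le_rho hT hy.1 h2) (not_le.2 hy.2)

theorem exists_mem_of_rho_eq (h : rho T t = t) (hne : (T ∩ Iio t).Nonempty) {δ : ℝ} (hδ : 0 < δ) :
    ∃ s ∈ T, t - δ < s ∧ s < t := by
  have h1 : t - δ < sSup (T ∩ Iio t) := by
    have : rho T t = sSup (T ∩ Iio t) := by unfold rho; rw [if_pos hne]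
    rw [← this, h]; linarith
  obtain ⟨s, hs1, hs2⟩ := exists_lt_of_lt_csSup hne h1
  exact ⟨s, hs1.1, hs2, hs1.2⟩

theorem rho_lt_of_isolated (hT : IsCompact T) (ht : t ∈ T)
    (hiso : ∃ δ > 0, ∀ s ∈ T, |s - t| < δ → s = t) (hne : (T ∩ Iio t).Nonempty) :
    rho T t < t := by
  refine (rho_le hT ht).lt_of_ne fun h => ?_
  obtain ⟨δ, hδ, H⟩ := hiso
  obtain ⟨s, hs, h1, h2⟩ := exists_mem_of_rho_eq h hne hδ
  exact h2.ne (H s hs (by rw [abs_lt]; constructor <;> linarith))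

theorem diff_singleton_subset_kappa (hS : IsCompact S) (hb : IsGreatest S b) :
    S \ {b} ⊆ kappa S := by
  rw [kappa_eq hb]
  exact fun x hx => ⟨hx.1, le_rho hS hx.1 ((hb.2 hx.1).lt_of_ne hx.2)⟩

/-- Each truncation removes at most the top point. This turns the assumption on the number of points
into room for the jumps needed later. -/
theorem encard_le_encard_kappa_iterate (hT : IsCompact T) (hb : IsGreatest T b) (m : ℕ) :
    T.encard ≤ (kappa^[m] T).encard + m := by
  induction m with
  | zero => simp
  | succ m ih =>
    have hg := isGreatest_kappa_iterate hT hb m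
    have hc := isCompact_kappa_iterate hT hb m
    rw [Function.iterate_succ_apply']
    refine ih.trans ?_
    rw [← encard_sdiff_singleton_add_one hg.1]
    push_cast
    rw [add_assoc, add_comm (1 : ℕ∞)]
    gcongr
    exact diff_singleton_subset_kappa hc hg

/-- Induction along a compact time scale. -/
theorem induction_on_compact (hT : IsCompact T) (ha : IsLeast T a) {P : ℝ → Prop} (h0 : P a)
    (hs : ∀ t ∈ T, P t → t < sigma T t → P (sigma T t))
    (hr : ∀ t ∈ T, P t → sigma T t = t → ∃ δ > 0, ∀ s ∈ T, t < s → s < t + δ → P s)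
    (hl : ∀ t ∈ T, (∀ s ∈ T, s < t → P s) → (∀ δ > 0, ∃ s ∈ T, t - δ < s ∧ s < t) → P t) :
    ∀ t ∈ T, P t := by
  by_contra! hB
  set B : Set ℝ := {t | t ∈ T ∧ ¬ P t} with hBdef
  have hBne : B.Nonempty := hB
  have hBb : BddBelow B := hT.bddBelow.mono fun x hx => hx.1
  set c := sInf B with hc
  have hcT : c ∈ T := by
    have h1 : c ∈ closure B := csInf_mem_closure hBne hBb
    exact (closure_minimal (fun x hx => hx.1) hT.isClosed) h1
  have hlow : ∀ s ∈ T, s < c → P s := fun s hs hsc => by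
    by_contra h
    exact absurd (csInf_le hBb (show s ∈ B from ⟨hs, h⟩)) (not_le.2 hsc)
  -- The infimum c of the failures is not a failure: it is either the jump of ρ(c) or left-dense.
  -- Failures would then have to accumulate at c from the right, which the jump or the right-dense
  -- hypothesis excludes.
  have hPc : P c := by
    by_contra hPc
    have hca : a < c := lt_of_le_of_ne (ha.2 hcT) fun h => hPc (h ▸ h0)
    have hne : (T ∩ Iio c).Nonempty := ⟨a, ha.1, hca⟩
    have hd : rho T c ∈ T := rho_mem hT ⟨a, ha.1⟩ c
    rcases (rho_le hT hcT).lt_or_eq with h | h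
    · have h1 : sigma T (rho T c) = c := sigma_rho hT hcT h
      exact hPc (h1 ▸ hs _ hd (hlow _ hd h) (by rwa [h1]))
    · exact hPc (hl c hcT hlow fun δ hδ => exists_mem_of_rho_eq h hne hδ)
  have hcB : ∀ x ∈ B, c < x := fun x hx =>
    lt_of_le_of_ne (csInf_le hBb hx) fun h => hx.2 (h ▸ hPc)
  rcases (le_sigma hT hcT).lt_or_eq with h | h
  · obtain ⟨x, hx, hx2⟩ := exists_lt_of_csInf_lt hBne h
    have h2 := sigma_le hT hx.1 (hcB x hx)
    exact absurd hx2 (not_lt.2 h2)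
  · obtain ⟨δ, hδ, hδ'⟩ := hr c hcT hPc h.symm
    obtain ⟨x, hx, hx2⟩ := exists_lt_of_csInf_lt hBne (show c < c + δ by linarith)
    exact hx.2 (hδ' x hx.1 (hcB x hx) hx2)

end Jumps

/-! ### The delta derivative at scattered and at dense points. -/

section Derivative

variable {F : Type} [NormedAddCommGroup F] [NormedSpace ℝ F]
  {S : Set ℝ} {f g : ℝ → F} {f' g' : F} {t : ℝ}

theorem HasDeltaDerivAt.sub (hf : HasDeltaDerivAt S f f' t) (hg : HasDeltaDerivAt S g g' t) :
    HasDeltaDerivAt S (fun s => f s - g s) (f' - g') t := by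
  intro ε hε
  obtain ⟨δ₁, h₁, H₁⟩ := hf (ε / 2) (by positivity)
  obtain ⟨δ₂, h₂, H₂⟩ := hg (ε / 2) (by positivity)
  refine ⟨min δ₁ δ₂, lt_min h₁ h₂, fun s hs hst => ?_⟩
  have e1 := H₁ s hs (hst.trans_le (min_le_left _ _))
  have e2 := H₂ s hs (hst.trans_le (min_le_right _ _))
  have e : f (sigma S t) - g (sigma S t) - (f s - g s) - (sigma S t - s) • (f' - g')
      = (f (sigma S t) - f s - (sigma S t - s) • f')
        - (g (sigma S t) - g s - (sigma S t - s) • g') := by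
    rw [smul_sub]; abel
  rw [e]
  refine (norm_sub_le _ _).trans ?_
  linarith

theorem HasDeltaDerivAt.congr (h : f =ᶠ[𝓝[S] t] g) (hσ : f (sigma S t) = g (sigma S t)) :
    HasDeltaDerivAt S f f' t ↔ HasDeltaDerivAt S g f' t := by
  have key : ∀ {f g : ℝ → F}, f =ᶠ[𝓝[S] t] g → f (sigma S t) = g (sigma S t) →
      HasDeltaDerivAt S f f' t → HasDeltaDerivAt S g f' t := by
    intro f g h hσ hf ε hε
    obtain ⟨δ₁, h₁, H₁⟩ := hf ε hε
    obtain ⟨δ₂, h₂, H₂⟩ := Metric.mem_nhdsWithin_iff.1 h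
    refine ⟨min δ₁ δ₂, lt_min h₁ h₂, fun s hs hst => ?_⟩
    have e1 := H₁ s hs (hst.trans_le (min_le_left _ _))
    have e2 : f s = g s := H₂ ⟨by
      rw [Metric.mem_ball, Real.dist_eq]; exact hst.trans_le (min_le_right _ _), hs⟩
    rwa [hσ, e2] at e1
  exact ⟨key h hσ, key h.symm hσ.symm⟩

theorem deltaDeriv_congr (h : f =ᶠ[𝓝[S] t] g) (hσ : f (sigma S t) = g (sigma S t)) :
    deltaDeriv S f t = deltaDeriv S g t := by
  have e : (fun f' => HasDeltaDerivAt S f f' t) = fun f' => HasDeltaDerivAt S g f' t :=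
    funext fun f' => propext (HasDeltaDerivAt.congr h hσ)
  have key : ∀ p q : F → Prop, p = q → (open Classical in if h : ∃ x, p x then h.choose else 0) =
      (open Classical in if h : ∃ x, q x then h.choose else 0) := by
    rintro p _ rfl
    rfl
  exact key _ _ e

theorem deltaDeriv_eq (h : HasDeltaDerivAt S f f' t)
    (hu : ∀ f'', HasDeltaDerivAt S f f'' t → f'' = f') : deltaDeriv S f t = f' := by
  have hex : ∃ f', HasDeltaDerivAt S f f' t := ⟨f', h⟩
  unfold deltaDeriv
  rw [dif_pos hex]
  exact hu _ hex.choose_spec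

/-- Test the definition at s = t: the factor |σ(t) - t| is fixed while ε is arbitrary, which forces
equality. -/
theorem HasDeltaDerivAt.eq_of_lt_sigma (ht : t ∈ S) (hσ : t < sigma S t)
    (h : HasDeltaDerivAt S f f' t) :
    f' = (sigma S t - t)⁻¹ • (f (sigma S t) - f t) := by
  have hμ : 0 < sigma S t - t := sub_pos.2 hσ
  have h0 : f (sigma S t) - f t - (sigma S t - t) • f' = 0 := by
    rw [← norm_le_zero_iff]
    refine le_of_forall_pos_le_add fun ε hε => ?_
    obtain ⟨δ, hδ, H⟩ := h (ε / (sigma S t - t)) (by positivity)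
    have := H t ht (by simpa using hδ)
    rw [abs_of_pos hμ, div_mul_cancel₀ _ hμ.ne'] at this
    simpa using this
  rw [sub_eq_zero] at h0
  rw [h0, inv_smul_smul₀ hμ.ne']

theorem hasDeltaDerivAt_of_isolated (hiso : ∃ δ > 0, ∀ s ∈ S, |s - t| < δ → s = t)
    (hσ : t < sigma S t) :
    HasDeltaDerivAt S f ((sigma S t - t)⁻¹ • (f (sigma S t) - f t)) t := by
  obtain ⟨δ, hδ, H⟩ := hiso
  intro ε hε
  refine ⟨δ, hδ, fun s hs hst => ?_⟩
  obtain rfl := H s hs hst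
  have hμ : sigma S s - s ≠ 0 := (sub_pos.2 hσ).ne'
  rw [smul_inv_smul₀ hμ, sub_self, norm_zero]
  positivity

theorem hasDeltaDerivAt_iff_of_sigma_eq (hσ : sigma S t = t) :
    HasDeltaDerivAt S f f' t ↔ HasDerivWithinAt f f' S t := by
  rw [hasDerivWithinAt_iff_isLittleO, Asymptotics.isLittleO_iff]
  unfold HasDeltaDerivAt
  rw [hσ]
  refine forall_congr' fun ε => forall_congr' fun hε => ?_
  have e : ∀ s, ‖f t - f s - (t - s) • f'‖ = ‖f s - f t - (s - t) • f'‖ := fun s => by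
    rw [← norm_neg]; congr 1
    rw [← neg_sub s t, neg_smul]; abel
  have e2 : ∀ s, |t - s| = ‖s - t‖ := fun s => by rw [Real.norm_eq_abs, abs_sub_comm]
  constructor
  · rintro ⟨δ, hδ, H⟩
    refine Metric.mem_nhdsWithin_iff.2 ⟨δ, hδ, fun s hs => ?_⟩
    have := H s hs.2 (by simpa [Real.dist_eq] using hs.1)
    rwa [e, e2] at this
  · intro h
    obtain ⟨δ, hδ, H⟩ := Metric.mem_nhdsWithin_iff.1 h
    refine ⟨δ, hδ, fun s hs hst => ?_⟩
    rw [e, e2]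
    exact H ⟨by simpa [Real.dist_eq] using hst, hs⟩

theorem HasDeltaDerivAt.continuousWithinAt (hσ : sigma S t = t) (h : HasDeltaDerivAt S f f' t) :
    ContinuousWithinAt f S t :=
  ((hasDeltaDerivAt_iff_of_sigma_eq hσ).1 h).continuousWithinAt

theorem HasDeltaDerivAt.continuousWithinAt' (h : HasDeltaDerivAt S f f' t) (ht : t ∈ S) 
    (hS : t ≤ sigma S t) : ContinuousWithinAt f S t := by
  rcases hS.lt_or_eq with hσ | hσ
  · have hf' := h.eq_of_lt_sigma ht hσ
    have hμ : 0 < sigma S t - t := sub_pos.2 hσ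
    have e : f (sigma S t) = f t + (sigma S t - t) • f' := by
      rw [hf', smul_inv_smul₀ hμ.ne']; abel
    rw [Metric.continuousWithinAt_iff]
    intro ε hε
    -- M exceeds the sum of the two factors that multiply ε / (2M) in the final estimate: ‖f'‖, and
    -- the bound 2(σ(t) - t) for |σ(t) - s|.
    set M := 2 * (sigma S t - t) + ‖f'‖ + 1 with hM
    have hMpos : 0 < M := by positivity
    obtain ⟨δ, hδ, H⟩ := h (ε / (2 * M)) (by positivity)
    refine ⟨min δ (min (sigma S t - t) (ε / (2 * M))), by positivity, fun {s} hs hst => ?_⟩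
    rw [Real.dist_eq] at hst
    have h1 := H s hs (hst.trans_le (min_le_left _ _))
    have h2 := hst.trans_le ((min_le_right _ _).trans (min_le_left _ _))
    have h3 := hst.trans_le ((min_le_right _ _).trans (min_le_right _ _))
    have e2 : f s - f t = (s - t) • f' - (f (sigma S t) - f s - (sigma S t - s) • f') := by
      have : (sigma S t - s) • f' = (sigma S t - t) • f' - (s - t) • f' := by
        rw [← sub_smul]; congr 1; ring
      rw [e, this]; abel
    have h4 : |sigma S t - s| ≤ 2 * (sigma S t - t) := by
      rw [abs_le]; rw [abs_lt] at h2; constructor <;> linarith [h2.1, h2.2]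
    rw [dist_eq_norm, e2]
    calc _ ≤ ‖(s - t) • f'‖ + ‖f (sigma S t) - f s - (sigma S t - s) • f'‖ := norm_sub_le _ _
      _ ≤ ε / (2 * M) * ‖f'‖ + ε / (2 * M) * (2 * (sigma S t - t)) := by
          rw [norm_smul, Real.norm_eq_abs]
          refine add_le_add (by gcongr) (h1.trans (by gcongr))
      _ < ε / (2 * M) * M := by
          rw [← mul_add]
          refine mul_lt_mul_of_pos_left ?_ (by positivity)
          rw [hM]; linarith
      _ ≤ ε := by rw [div_mul_eq_mul_div, div_le_iff₀ (by positivity)]; nlinarith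
  · exact h.continuousWithinAt hσ.symm

end Derivative

/-! ### Uniqueness of delta antiderivatives up to a constant. -/

section Integral

variable {F : Type} [NormedAddCommGroup F] [NormedSpace ℝ F] {S : Set ℝ} {a b : ℝ}

/-- For every ε the bound ‖K t - K a‖ ≤ ε(t - a) propagates by induction along S: K is constant
across a gap, grows at rate at most ε to the right of a right-dense point, and is continuous at a
left-dense one. -/
theorem sub_eq_zero_of_deriv_zero (hS : IsCompact S) (ha : IsLeast S a) (hb : IsGreatest S b)
    {K : ℝ → F} (hK : ∀ t ∈ kappa S, HasDeltaDerivAt S K 0 t) : K b - K a = 0 := by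
  rw [← norm_le_zero_iff]
  have key : ∀ ε > 0, ∀ t ∈ S, ‖K t - K a‖ ≤ ε * (t - a) := by
    intro ε hε
    -- The top b may be missing from `kappa S`, but the derivative there is used only if b is
    -- left-dense, and then it belongs.
    have hmem : ∀ t ∈ S, (∀ δ > 0, ∃ s ∈ S, t - δ < s ∧ s < t) ∨ t < b → t ∈ kappa S := by
      intro t ht h
      rw [kappa_eq hb]
      refine ⟨ht, ?_⟩
      rcases h with h | h
      · rw [mem_Iic]
        refine le_of_forall_pos_le_add fun δ hδ => ?_
        obtain ⟨s, hs, h1, h2⟩ := h δ hδ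
        have := le_rho hS hs (h2.trans_le (hb.2 ht))
        linarith
      · exact le_rho hS ht h
    refine induction_on_compact hS ha (by simp) ?_ ?_ ?_
    · intro t ht hP hσ
      have htb : t < b := hσ.trans_le (hb.2 (sigma_mem hS ⟨a, ha.1⟩ t))
      have := (hK t (hmem t ht (Or.inr htb))).eq_of_lt_sigma ht hσ
      have h0 : K (sigma S t) - K t = 0 := by
        rcases smul_eq_zero.1 this.symm with h | h
        · exact absurd (inv_eq_zero.1 h) (sub_pos.2 hσ).ne'
        · exact h
      rw [sub_eq_zero.1 h0]
      refine hP.trans ?_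
      gcongr
    · intro t ht hP hσ
      rcases (hb.2 ht).lt_or_eq with htb | htb
      · obtain ⟨δ, hδ, H⟩ := hK t (hmem t ht (Or.inr htb)) ε hε
        refine ⟨δ, hδ, fun s hs h1 h2 => ?_⟩
        have h3 := H s hs (by rw [abs_of_pos (by linarith)]; linarith)
        rw [hσ, smul_zero, sub_zero, norm_sub_rev, abs_sub_comm,
          abs_of_pos (by linarith : 0 < s - t)] at h3
        have e : K s - K a = (K s - K t) + (K t - K a) := by abel
        rw [e]
        refine (norm_add_le _ _).trans ?_
        linarith
      · exact ⟨1, one_pos, fun s hs h1 _ => absurd (hb.2 hs) (not_le.2 (htb ▸ h1))⟩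
    · intro t ht hlow hden
      have hc := (hK t (hmem t ht (Or.inl hden))).continuousWithinAt' ht (le_sigma hS ht)
      have hne : (𝓝[S ∩ Iio t] t).NeBot := by
        rw [← mem_closure_iff_nhdsWithin_neBot, Metric.mem_closure_iff]
        intro δ hδ
        obtain ⟨s, hs, h1, h2⟩ := hden δ hδ
        exact ⟨s, ⟨hs, h2⟩, by rw [Real.dist_eq, abs_of_pos (by linarith)]; linarith⟩
      have h1 : Tendsto (fun s => ‖K s - K a‖) (𝓝[S ∩ Iio t] t) (𝓝 ‖K t - K a‖) :=
        ((hc.mono inter_subset_left).sub continuousWithinAt_const).norm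
      have h2 : Tendsto (fun s => ε * (s - a)) (𝓝[S ∩ Iio t] t) (𝓝 (ε * (t - a))) :=
        Tendsto.mono_left (Continuous.tendsto (by fun_prop) t) nhdsWithin_le_nhds
      refine le_of_tendsto_of_tendsto h1 h2 ?_
      filter_upwards [self_mem_nhdsWithin] with s hs
      exact hlow s hs.1 hs.2
  have hba : 0 ≤ b - a := sub_nonneg.2 (ha.2 hb.1)
  refine le_of_forall_pos_le_add fun ε hε => ?_
  have := key (ε / (b - a + 1)) (by positivity) b hb.1
  refine this.trans ?_
  rw [div_mul_eq_mul_div, div_le_iff₀ (by positivity)]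
  nlinarith

/-- Frees the integral from the antiderivative picked by choice in its definition. -/
theorem deltaIntegral_eq (hS : IsCompact S) (ha : IsLeast S a) (hb : IsGreatest S b)
    {f G : ℝ → F} (hG : ∀ t ∈ kappa S, HasDeltaDerivAt S G (f t) t) :
    deltaIntegral S f a b = G b - G a := by
  have hex : ∃ G : ℝ → F, ∀ t ∈ kappa S, HasDeltaDerivAt S G (f t) t := ⟨G, hG⟩
  unfold deltaIntegral
  rw [dif_pos hex]
  have := sub_eq_zero_of_deriv_zero hS ha hb (K := fun s => hex.choose s - G s) fun t ht => by
    simpa using (hex.choose_spec t ht).sub (hG t ht)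
  rw [← sub_eq_zero, ← this]; abel

end Integral

end TimeScale

/-! ### Classification of the compact time scales with affine forward jump. -/

namespace TimeScale

open Filter Topology Set

/-- A time scale on which all points but `e` are isolated, with forward jump `t ↦ a₁ t + a₀`
on each of the sets `T^{κ^m}`, `m < N`; if `e` belongs to `T`, it is the only dense point. -/
structure Disc (T : Set ℝ) (N : ℕ) (a₁ a₀ e : ℝ) : Prop where
  pos : 0 < a₁
  isolated : ∀ t ∈ T, t ≠ e → ∃ δ > 0, ∀ s ∈ T, |s - t| < δ → s = t
  jump : ∀ m < N, ∀ t ∈ kappa^[m + 1] T, t ≠ e → sigma (kappa^[m] T) t = a₁ * t + a₀ ∧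
    t < a₁ * t + a₀ ∧ a₁ * t + a₀ ∈ kappa^[m] T ∧ a₁ * t + a₀ ≠ e
  ne_one : e ∈ T → a₁ ≠ 1
  fixed : e ∈ T → a₁ * e + a₀ = e
  neBot : e ∈ T → (𝓝[T \ {e}] e).NeBot
  mem : e ∈ T → ∀ m, e ∈ kappa^[m] T
  sigma_eq : e ∈ T → ∀ m, sigma (kappa^[m] T) e = e
  nhds_eq : e ∈ T → ∀ m, 𝓝[kappa^[m] T] e = 𝓝[T] e
  contract : e ∈ T → ∀ m, ∀ t ∈ kappa^[m] T, e + min a₁ a₁⁻¹ * (t - e) ∈ kappa^[m] T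

section

variable {T : Set ℝ} {N : ℕ} {a₁ a₀ e a b : ℝ}

/-- Stability under truncation lets inductions on the order treat f^{Δ^p} as a new function on
T^{κ^p}, at the price of p in the budget N. -/
theorem Disc.shift (h : Disc T N a₁ a₀ e) {p M : ℕ} (hp : p + M ≤ N) :
    Disc (kappa^[p] T) M a₁ a₀ e := by
  have hsub : kappa^[p] T ⊆ T := kappa_iterate_anti (Nat.zero_le p)
  have hit : ∀ m, kappa^[m] (kappa^[p] T) = kappa^[m + p] T := fun m =>
    (Function.iterate_add_apply kappa m p T).symm
  refine ⟨h.pos, fun t ht hte => ?_, fun m hm t ht hte => ?_, fun he => h.ne_one (hsub he),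
    fun he => h.fixed (hsub he), fun he => ?_, fun he m => ?_, fun he m => ?_, fun he m => ?_,
    fun he m => ?_⟩
  · obtain ⟨δ, hδ, H⟩ := h.isolated t (hsub ht) hte
    exact ⟨δ, hδ, fun s hs => H s (hsub hs)⟩
  · rw [hit] at ht ⊢
    exact h.jump (m + p) (by omega) t (by convert ht using 2; omega) hte
  · have := h.neBot (hsub he)
    rw [sdiff_eq, nhdsWithin_inter', h.nhds_eq (hsub he) p, ← nhdsWithin_inter', ← sdiff_eq]
    exact this
  · rw [hit]; exact h.mem (hsub he) _
  · rw [hit]; exact h.sigma_eq (hsub he) _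
  · rw [hit, h.nhds_eq (hsub he), h.nhds_eq (hsub he)]
  · rw [hit]; exact h.contract (hsub he) _

/-- Truncation never reaches an accumulation point: if e is the top it is left-dense and nothing is
removed; otherwise at most the top disappears, away from e. -/
theorem mem_and_nhds_kappa_iterate (hT : IsCompact T) (hb : IsGreatest T b) (he : e ∈ T)
    (hacc : (𝓝[T \ {e}] e).NeBot) (m : ℕ) :
    e ∈ kappa^[m] T ∧ 𝓝[kappa^[m] T] e = 𝓝[T] e := by
  induction m with
  | zero => exact ⟨he, rfl⟩
  | succ m ih =>
    obtain ⟨ih1, ih2⟩ := ih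
    have hg := isGreatest_kappa_iterate hT hb m
    have hc := isCompact_kappa_iterate hT hb m
    rw [Function.iterate_succ_apply']
    set S := kappa^[m] T
    set c := (rho T)^[m] b
    by_cases hec : e = c
    · have hne : (𝓝[S \ {e}] e).NeBot := by
        rw [sdiff_eq, nhdsWithin_inter', ih2, ← nhdsWithin_inter', ← sdiff_eq]
        exact hacc
      have h1 : e ≤ rho S c := by
        refine le_of_forall_pos_le_add fun δ hδ => ?_
        rw [← mem_closure_iff_nhdsWithin_neBot, Metric.mem_closure_iff] at hne
        obtain ⟨s, hs, hds⟩ := hne δ hδ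
        have h2 : s < c := (hg.2 hs.1).lt_of_ne fun h => hs.2 (h.trans hec.symm)
        have h3 := le_rho hc hs.1 h2
        rw [Real.dist_eq, abs_lt] at hds
        linarith [hds.2]
      have h2 : kappa S = S := by
        rw [kappa_eq hg]
        exact inter_eq_left.2 fun x hx => (hg.2 hx).trans (hec ▸ h1)
      rw [h2]
      exact ⟨ih1, ih2⟩
    · have hsub := diff_singleton_subset_kappa hc hg
      refine ⟨hsub ⟨ih1, hec⟩, ?_⟩
      rw [← ih2]
      refine le_antisymm (nhdsWithin_mono _ kappa_subset) ?_
      have h1 : 𝓝[S \ {c}] e = 𝓝[S] e := by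
        rw [sdiff_eq, inter_comm]
        exact nhdsWithin_inter_of_mem (mem_nhdsWithin_of_mem_nhds
          (isOpen_compl_singleton.mem_nhds hec))
      rw [← h1]
      exact nhdsWithin_mono _ hsub

theorem Disc.of_isolated (hT : IsCompact T) (ha : IsLeast T a) (hb : IsGreatest T b)
    (hcard : ((N + 1 : ℕ) : ℕ∞) ≤ T.encard) (ha₁ : 0 < a₁)
    (hH : ∀ t ∈ T, t < b → sigma T t = a₁ * t + a₀)
    (hiso : ∀ t ∈ T, t ≠ e → ∃ δ > 0, ∀ s ∈ T, |s - t| < δ → s = t)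
    (hfix : e ∈ T → a₁ * e + a₀ = e)
    (hacc : e ∈ T → (𝓝[T \ {e}] e).NeBot)
    (hend : e ∈ T → (e = a ∧ 1 < a₁) ∨ (e = b ∧ a₁ < 1)) : Disc T N a₁ a₀ e := by
  have hsub : ∀ m, kappa^[m] T ⊆ T := fun m => kappa_iterate_anti (Nat.zero_le m)
  refine ⟨ha₁, hiso, fun m hm t ht hte => ?_, fun he h1 => ?_, hfix, hacc, fun he m =>
    (mem_and_nhds_kappa_iterate hT hb he (hacc he) m).1, fun he m => ?_, fun he m =>
    (mem_and_nhds_kappa_iterate hT hb he (hacc he) m).2, fun he m t ht => ?_⟩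
  · have hg := isGreatest_kappa_iterate hT hb m
    have hc := isCompact_kappa_iterate hT hb m
    have hle := encard_le_encard_kappa_iterate hT hb m
    obtain ⟨hK1, hK2⟩ := kappa_iterate hT hb m
    rw [Function.iterate_succ_apply'] at ht
    set S := kappa^[m] T with hS
    set c := (rho T)^[m] b
    have htS : t ∈ S := kappa_subset ht
    -- An isolated top of a scale with two points is removed by κ, so t is not the top. If only one
    -- point were left, then N + 1 ≤ 1 + m, against m < N.
    have htc : t < c := by
      refine (hg.2 htS).lt_of_ne fun htc => ?_
      have h2 : 1 < S.encard := by
        by_contra! h3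
        have h4 := hcard.trans (hle.trans (add_le_add_left h3 _))
        norm_cast at h4
        omega
      obtain ⟨x, hx, hxt⟩ := exists_ne_of_one_lt_encard h2 t
      have hlt := rho_lt_of_isolated hc htS (by
        obtain ⟨δ, hδ, H⟩ := hiso t (hsub m htS) hte
        exact ⟨δ, hδ, fun s hs => H s (hsub m hs)⟩) ⟨x, hx, (htc ▸ hg.2 hx).lt_of_ne hxt⟩
      rw [kappa_eq hg, ← htc] at ht
      exact absurd ht.2 (not_le.2 hlt)
    have hcT : c ∈ T := hK2
    have hσ1 : sigma S t = sigma T t := by rw [hK1]; exact sigma_inter_Iic hT hcT htc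
    have hσ2 : sigma T t = a₁ * t + a₀ := hH t (hsub m htS) (htc.trans_le (hb.2 hcT))
    have hσS : sigma S t ∈ S := sigma_mem hc ⟨t, htS⟩ t
    rw [hσ1, hσ2] at hσS
    refine ⟨hσ1.trans hσ2, ?_, hσS, fun h => ?_⟩
    · refine lt_of_le_of_ne (hσ2 ▸ le_sigma hT (hsub m htS)) fun h => ?_
      obtain ⟨δ, hδ, H⟩ := hiso t (hsub m htS) hte
      have hne : (T ∩ Ioi t).Nonempty := ⟨c, hcT, htc⟩
      have h1 : sInf (T ∩ Ioi t) < t + δ := by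
        have : sigma T t = sInf (T ∩ Ioi t) := by unfold sigma; rw [if_pos hne]
        rw [← this, hσ2, ← h]; linarith
      obtain ⟨s, hs, hst⟩ := exists_lt_of_csInf_lt hne h1
      have h3 : t < s := hs.2
      exact h3.ne' (H s hs.1 (by rw [abs_lt]; constructor <;> linarith))
    · have heT : e ∈ T := h ▸ hsub m hσS
      have := hfix heT
      exact hte (mul_left_cancel₀ ha₁.ne' (by linarith))
  · rcases hend he with h | h <;> linarith [h.2]
  · obtain ⟨hK1, hK2⟩ := kappa_iterate hT hb m
    have hg := isGreatest_kappa_iterate hT hb m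
    have hem := (mem_and_nhds_kappa_iterate hT hb he (hacc he) m).1
    rcases (hg.2 hem).lt_or_eq with h | h
    · rw [hK1, sigma_inter_Iic hT hK2 h, hH e he (h.trans_le (hb.2 hK2)), hfix he]
    · have := sigma_of_isGreatest hg
      rwa [← h] at this
  · obtain ⟨hK1, hK2⟩ := kappa_iterate hT hb m
    have hg := isGreatest_kappa_iterate hT hb m
    have htT : t ∈ T := hsub m ht
    by_cases hte : t = e
    · rw [hte, sub_self, mul_zero, add_zero]
      exact (mem_and_nhds_kappa_iterate hT hb he (hacc he) m).1
    have hf := hfix he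
    -- The contraction towards e is the backward jump if e = a (σ expands) and the forward jump if e
    -- = b (σ contracts).
    rcases hend he with ⟨hea, h1⟩ | ⟨heb, h1⟩
    · have hmin : min a₁ a₁⁻¹ = a₁⁻¹ := min_eq_right ((inv_le_one_of_one_le₀ h1.le).trans h1.le)
      have hat : a < t := (ha.2 htT).lt_of_ne fun h => hte (by rw [hea, h])
      have hlt := rho_lt_of_isolated hT htT (hiso t htT hte) ⟨a, ha.1, hat⟩
      have hmem := rho_mem hT ⟨a, ha.1⟩ t
      have hσ := sigma_rho hT htT hlt
      rw [hH _ hmem (hlt.trans_le (hb.2 htT))] at hσ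
      have e1 : e + min a₁ a₁⁻¹ * (t - e) = rho T t := by
        rw [hmin]
        field_simp
        linarith
      rw [e1, hK1]
      exact ⟨hmem, hlt.le.trans (hg.2 ht)⟩
    · have hmin : min a₁ a₁⁻¹ = a₁ := min_eq_left (h1.le.trans (one_le_inv_iff₀.2 ⟨ha₁, h1.le⟩))
      have htb : t < b := (hb.2 htT).lt_of_ne fun h => hte (by rw [heb, h])
      have hmem : sigma T t ∈ T := sigma_mem hT ⟨a, ha.1⟩ t
      have e1 : e + min a₁ a₁⁻¹ * (t - e) = sigma T t := by
        rw [hmin, hH t htT htb]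
        linarith
      have hem := (mem_and_nhds_kappa_iterate hT hb he (hacc he) m).1
      rw [e1, hK1]
      exact ⟨hmem, (hb.2 hmem).trans (heb ▸ hg.2 hem)⟩

theorem exists_mem_Ioo_of_sigma_eq {t c δ : ℝ} (h : sigma T t = t) (hc : c ∈ T) (htc : t < c)
    (hδ : 0 < δ) : ∃ s ∈ T, t < s ∧ s < t + δ := by
  have hne : (T ∩ Ioi t).Nonempty := ⟨c, hc, htc⟩
  have h1 : sInf (T ∩ Ioi t) < t + δ := by
    have : sigma T t = sInf (T ∩ Ioi t) := by unfold sigma; rw [if_pos hne]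
    rw [← this, h]; linarith
  obtain ⟨s, hs, hst⟩ := exists_lt_of_csInf_lt hne h1
  exact ⟨s, hs.1, hs.2, hst⟩

/-- A compact time scale with affine forward jump is an interval, or has isolated points only,
with the possible exception of one of its ends. -/
theorem eq_Icc_or_exists_disc (hT : IsCompact T) (ha : IsLeast T a) (hb : IsGreatest T b)
    (hab : a < b) (hcard : ((N + 1 : ℕ) : ℕ∞) ≤ T.encard) (ha₁ : 0 < a₁)
    (hH : ∀ t ∈ T, t < b → sigma T t = a₁ * t + a₀) :
    (T = Icc a b ∧ a₁ = 1) ∨ ∃ e, Disc T N a₁ a₀ e := by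
  have hle : ∀ t ∈ T, t < b → t ≤ a₁ * t + a₀ := fun t ht htb =>
    hH t ht htb ▸ le_sigma hT ht
  -- To the right the gap is at least a₁t + a₀ - t. For s < t, σ(s) ≤ t gives a₁(t - s) ≥ a₁t + a₀ -
  -- t.
  have hiso : ∀ t ∈ T, t < a₁ * t + a₀ → ∃ δ > 0, ∀ s ∈ T, |s - t| < δ → s = t := by
    intro t ht h
    refine ⟨min (a₁ * t + a₀ - t) ((a₁ * t + a₀ - t) / a₁),
      lt_min (by linarith) (div_pos (by linarith) ha₁), fun s hs hst => ?_⟩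
    have h1 := hst.trans_le (min_le_left _ _)
    have h2 := hst.trans_le (min_le_right _ _)
    rw [lt_div_iff₀ ha₁] at h2
    rcases lt_trichotomy s t with hlt | heq | hlt
    · exfalso
      rw [abs_of_neg (by linarith)] at h2
      have h3 := sigma_le hT ht hlt
      rw [hH s hs (hlt.trans_le (hb.2 ht))] at h3
      nlinarith
    · exact heq
    · exfalso
      rw [abs_of_pos (by linarith)] at h1
      have h3 := sigma_le hT hs hlt
      rw [hH t ht (hlt.trans_le (hb.2 hs))] at h3
      linarith
  -- When all points are isolated, a - 1 serves as a dummy exceptional point: every condition on it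
  -- is void.
  have hout : a - 1 ∉ T := fun h => by linarith [ha.2 h]
  have hfinish : (∀ t ∈ T, ∃ δ > 0, ∀ s ∈ T, |s - t| < δ → s = t) →
      ∃ e, Disc T N a₁ a₀ e := fun h =>
    ⟨a - 1, Disc.of_isolated hT ha hb hcard ha₁ hH (fun t ht _ => h t ht)
      (fun h => absurd h hout) (fun h => absurd h hout) (fun h => absurd h hout)⟩
  by_cases h1 : a₁ = 1
  · subst h1
    by_cases h0 : a₀ = 0
    · left
      refine ⟨subset_antisymm (fun x hx => ⟨ha.2 hx, hb.2 hx⟩) ?_, rfl⟩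
      refine hT.isClosed.inter isClosed_Icc |>.Icc_subset_of_forall_exists_gt ha.1
        fun x hx y hxy => ?_
      obtain ⟨s, hs, h1, h2⟩ := exists_mem_Ioo_of_sigma_eq (t := x) (c := b) (δ := y - x)
        (by rw [hH x hx.1 hx.2.2, h0]; ring) hb.1 hx.2.2 (sub_pos.2 hxy)
      exact ⟨s, hs, h1, by linarith⟩
    · right
      have := hle a ha.1 hab
      have h0' : 0 < a₀ := lt_of_le_of_ne (by linarith) (Ne.symm h0)
      exact hfinish fun t ht => hiso t ht (by linarith)
  right
  -- The fixed point of the affine map, the only candidate for a dense point.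
  set p := a₀ / (1 - a₁) with hp
  have h1' : 1 - a₁ ≠ 0 := fun h => h1 (by linarith)
  have hpf : a₁ * p + a₀ = p := by rw [hp]; field_simp; ring
  have ha0 : a₀ = p - a₁ * p := by linarith
  have hlt : ∀ t ∈ T, t < b → t ≠ p → t < a₁ * t + a₀ := fun t ht htb htp => by
    refine (hle t ht htb).lt_of_ne fun h => htp ?_
    have : (1 - a₁) * (t - p) = 0 := by rw [ha0] at h; linarith
    rcases mul_eq_zero.1 this with h | h
    · exact absurd h h1'
    · linarith
  by_cases hpT : p ∈ T
  · have ht1 : ∀ t ∈ T, t < b → 0 ≤ (a₁ - 1) * (t - p) := fun t ht htb => by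
      have := hle t ht htb
      rw [ha0] at this
      linarith
    rcases (hb.2 hpT).lt_or_eq with hpb | hpb
    · have hσp : sigma T p = p := (hH p hpT hpb).trans hpf
      have ha1 : 1 < a₁ := by
        obtain ⟨s, hs, h2, h3⟩ := exists_mem_Ioo_of_sigma_eq hσp hb.1 hpb (sub_pos.2 hpb)
        have h4 := ht1 s hs (by linarith)
        by_contra! h5
        have h6 : a₁ < 1 := h5.lt_of_ne h1
        nlinarith
      refine ⟨p, Disc.of_isolated hT ha hb hcard ha₁ hH (fun t ht htp => ?_) (fun _ => hpf)
        (fun _ => ?_) (fun _ => Or.inl ⟨?_, ha1⟩)⟩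
      · rcases (hb.2 ht).lt_or_eq with htb | htb
        · exact hiso t ht (hlt t ht htb htp)
        · refine hiso t ht ?_
          rw [htb, ha0]
          nlinarith
      · rw [← mem_closure_iff_nhdsWithin_neBot, Metric.mem_closure_iff]
        intro δ hδ
        obtain ⟨s, hs, h2, h3⟩ := exists_mem_Ioo_of_sigma_eq hσp hb.1 hpb hδ
        exact ⟨s, ⟨hs, h2.ne'⟩, by rw [Real.dist_eq, abs_sub_comm, abs_of_pos] <;> linarith⟩
      · refine le_antisymm ?_ (ha.2 hpT)
        have h2 := ht1 a ha.1 hab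
        have := ha.2 hpT
        by_contra! h3
        nlinarith
    · have ha1 : a₁ < 1 := by
        have h4 := ht1 a ha.1 hab
        by_contra! h5
        have h6 : 1 < a₁ := h5.lt_of_ne' h1
        nlinarith
      refine ⟨p, Disc.of_isolated hT ha hb hcard ha₁ hH (fun t ht htp => ?_) (fun _ => hpf)
        (fun _ => ?_) (fun _ => Or.inr ⟨hpb, ha1⟩)⟩
      · exact hiso t ht (hlt t ht ((hb.2 ht).lt_of_ne (hpb ▸ htp)) htp)
      · have hρ : rho T p = p := by
          refine (rho_le hT hpT).antisymm (not_lt.1 fun h => ?_)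
          have h2 := sigma_rho hT hpT h
          rw [hH _ (rho_mem hT ⟨p, hpT⟩ p) (hpb ▸ h)] at h2
          exact h.ne (mul_left_cancel₀ ha₁.ne' (by linarith))
        rw [← mem_closure_iff_nhdsWithin_neBot, Metric.mem_closure_iff]
        intro δ hδ
        obtain ⟨s, hs, h2, h3⟩ := exists_mem_of_rho_eq hρ ⟨a, ha.1, show a < p by rwa [hpb]⟩ hδ
        exact ⟨s, ⟨hs, h3.ne⟩, by rw [Real.dist_eq, abs_of_pos] <;> linarith⟩
  · refine hfinish fun t ht => ?_
    have htp : t ≠ p := fun h => hpT (h ▸ ht)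
    rcases (hb.2 ht).lt_or_eq with htb | htb
    · exact hiso t ht (hlt t ht htb htp)
    · rcases lt_or_ge t (a₁ * t + a₀) with h2 | h2
      · exact hiso t ht h2
      -- Here t = b and the affine map does not move b forward. Then a₁ < 1 and p separates b from
      -- the rest of T, so b is isolated with radius b - p.
      · have h3 : t + (a₁ * p - p) ≥ a₁ * t := by rw [ha0] at h2; linarith
        have h4 : (1 - a₁) * (t - p) ≥ 0 := by linarith
        have h5 : ∀ s ∈ T, s < b → (1 - a₁) * (s - p) < 0 := fun s hs hsb => by
          have := hlt s hs hsb fun h => hpT (h ▸ hs)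
          rw [ha0] at this
          linarith
        have h6 := h5 a ha.1 hab
        have h7 : 0 < 1 - a₁ := by
          rcases lt_or_gt_of_ne h1' with h | h
          · exfalso; nlinarith
          · exact h
        have h8 : 0 < t - p := by
          rcases (mul_nonneg_iff_of_pos_left h7).1 h4 |>.lt_or_eq with h | h
          · exact h
          · exact absurd (by linarith) htp
        refine ⟨t - p, h8, fun s hs hst => ?_⟩
        by_contra hne
        have hsb : s < b := (hb.2 hs).lt_of_ne (htb ▸ hne)
        have h9 := h5 s hs hsb
        have h10 : s - p < 0 := by
          by_contra! h; nlinarith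
        rw [abs_lt] at hst
        linarith [hst.1]

end

end TimeScale

/-! ### Difference quotients and summation by parts along an affine orbit. -/

namespace TimeScale

open Filter Topology Set

section Affine

/-- The affine map `t ↦ a₁ t + a₀`. -/
noncomputable def aff (a₁ a₀ t : ℝ) : ℝ := a₁ * t + a₀

variable {F G : Type} [NormedAddCommGroup F] [NormedSpace ℝ F] [NormedAddCommGroup G]
  [NormedSpace ℝ G] {a₁ a₀ : ℝ}

/-- The difference quotient of `f` along the affine jump `t ↦ a₁ t + a₀`. -/
noncomputable def affDiff (a₁ a₀ : ℝ) (f : ℝ → F) (t : ℝ) : F :=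
  (aff a₁ a₀ t - t)⁻¹ • (f (aff a₁ a₀ t) - f t)

/-- The j-th quotient at t reads only the first j + 1 orbit points, so identities are needed only
along the orbit. -/
theorem affDiff_iterate_congr {f g : ℝ → F} (j : ℕ) (t : ℝ)
    (h : ∀ m ≤ j, f ((aff a₁ a₀)^[m] t) = g ((aff a₁ a₀)^[m] t)) :
    (affDiff a₁ a₀)^[j] f t = (affDiff a₁ a₀)^[j] g t := by
  induction j generalizing t with
  | zero => simpa using h 0 le_rfl
  | succ j ih =>
    rw [Function.iterate_succ_apply', Function.iterate_succ_apply', affDiff, affDiff,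
      ih t fun m hm => h m (by omega), ih (aff a₁ a₀ t) fun m hm => by
        simpa only [Function.iterate_succ_apply] using h (m + 1) (by omega)]

theorem affDiff_iterate_zero (j : ℕ) (t : ℝ) : (affDiff a₁ a₀)^[j] (fun _ => (0 : F)) t = 0 := by
  induction j generalizing t with
  | zero => rfl
  | succ j ih => rw [Function.iterate_succ_apply', affDiff, ih, ih, sub_zero, smul_zero]

theorem affDiff_iterate_add (f g : ℝ → F) (j : ℕ) (t : ℝ) :
    (affDiff a₁ a₀)^[j] (fun s => f s + g s) t =
      (affDiff a₁ a₀)^[j] f t + (affDiff a₁ a₀)^[j] g t := by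
  induction j generalizing t with
  | zero => rfl
  | succ j ih =>
    simp only [Function.iterate_succ_apply', affDiff, ih, ← smul_add]
    congr 1
    abel

theorem map_affDiff_iterate (A : F →L[ℝ] G) (f : ℝ → F) (j : ℕ) (t : ℝ) :
    A ((affDiff a₁ a₀)^[j] f t) = (affDiff a₁ a₀)^[j] (fun s => A (f s)) t := by
  induction j generalizing t with
  | zero => rfl
  | succ j ih =>
    simp only [Function.iterate_succ_apply', affDiff, map_smul, map_sub, ih]

theorem aff_aff_sub (t : ℝ) :
    aff a₁ a₀ (aff a₁ a₀ t) - aff a₁ a₀ t = a₁ * (aff a₁ a₀ t - t) := by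
  unfold aff; ring

/-- The graininess at σ(t) is a₁ times that at t, so each Δ that changes places with σ costs 1/a₁.
All powers of 1/a₁ in the final equation come from here. -/
theorem affDiff_iterate_aff (f : ℝ → F) (j : ℕ) (t : ℝ) :
    (affDiff a₁ a₀)^[j] f (aff a₁ a₀ t) =
      (1 / a₁) ^ j • (affDiff a₁ a₀)^[j] (fun s => f (aff a₁ a₀ s)) t := by
  induction j generalizing t with
  | zero => simp
  | succ j ih =>
    rw [Function.iterate_succ_apply', Function.iterate_succ_apply', affDiff, affDiff, ih, ih,
      ← smul_sub, smul_smul, smul_smul, aff_aff_sub, mul_inv]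
    congr 1
    rw [pow_succ, one_div]
    ring

theorem aff_iterate_sub (k : ℕ) (t : ℝ) :
    (aff a₁ a₀)^[k + 1] t - (aff a₁ a₀)^[k] t = a₁ ^ k * (aff a₁ a₀ t - t) := by
  induction k with
  | zero => simp
  | succ k ih =>
    rw [Function.iterate_succ_apply' _ (k + 1), Function.iterate_succ_apply' _ k, aff_aff_sub,
      ← Function.iterate_succ_apply' (aff a₁ a₀) k t, ih, pow_succ]
    ring

theorem strictMono_aff_iterate (ha₁ : 0 < a₁) {t : ℝ} (ht : t < aff a₁ a₀ t) :
    StrictMono fun k => (aff a₁ a₀)^[k] t := by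
  refine strictMono_nat_of_lt_succ fun k => sub_pos.1 ?_
  rw [aff_iterate_sub]
  have := sub_pos.2 ht
  positivity

theorem monotone_aff (ha₁ : 0 < a₁) : Monotone (aff a₁ a₀) := fun x y h => by
  unfold aff
  gcongr

/-- The product rule Δ(fg) = fΔg + (Δf)(g∘σ), telescoped along the orbit. -/
theorem sum_mul_affDiff (ha₁ : 0 < a₁) {t : ℝ} (ht : t < aff a₁ a₀ t) (f g : ℝ → ℝ) (N : ℕ) :
    ∑ k ∈ Finset.range N, ((aff a₁ a₀)^[k + 1] t - (aff a₁ a₀)^[k] t) *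
      (f ((aff a₁ a₀)^[k] t) * affDiff a₁ a₀ g ((aff a₁ a₀)^[k] t)) =
    f ((aff a₁ a₀)^[N] t) * g ((aff a₁ a₀)^[N] t) - f t * g t -
    ∑ k ∈ Finset.range N, ((aff a₁ a₀)^[k + 1] t - (aff a₁ a₀)^[k] t) *
      (affDiff a₁ a₀ f ((aff a₁ a₀)^[k] t) * g (aff a₁ a₀ ((aff a₁ a₀)^[k] t))) := by
  have h := Finset.sum_range_sub (fun k => f ((aff a₁ a₀)^[k] t) * g ((aff a₁ a₀)^[k] t)) N
  simp only [Function.iterate_zero, id] at h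
  rw [← h, eq_sub_iff_add_eq, ← Finset.sum_add_distrib]
  refine Finset.sum_congr rfl fun k _ => ?_
  have hμ : aff a₁ a₀ ((aff a₁ a₀)^[k] t) - (aff a₁ a₀)^[k] t ≠ 0 := by
    rw [← Function.iterate_succ_apply' (aff a₁ a₀) k t]
    exact (sub_pos.2 (strictMono_aff_iterate ha₁ ht (Nat.lt_succ_self k))).ne'
  simp only [affDiff, smul_eq_mul]
  rw [Function.iterate_succ_apply']
  field_simp
  ring

/-- Each summation by parts moves one Δ to f and leaves (Δ^i g)∘σ, which is rewritten as (1/a₁)^i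
Δ^i(g∘σ) so that the induction applies to g∘σ. The boundary conditions are imposed on all g∘σ^l for
this reason. -/
theorem sum_mul_affDiff_iterate (ha₁ : 0 < a₁) {t : ℝ} (ht : t < aff a₁ a₀ t) (N i : ℕ)
    (f g : ℝ → ℝ)
    (h0 : ∀ j l, j + l < i → (affDiff a₁ a₀)^[j] (fun s => g ((aff a₁ a₀)^[l] s)) t = 0)
    (hN : ∀ j l, j + l < i →
      (affDiff a₁ a₀)^[j] (fun s => g ((aff a₁ a₀)^[l] s)) ((aff a₁ a₀)^[N] t) = 0) :
    ∑ k ∈ Finset.range N, ((aff a₁ a₀)^[k + 1] t - (aff a₁ a₀)^[k] t) *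
      (f ((aff a₁ a₀)^[k] t) * (affDiff a₁ a₀)^[i] g ((aff a₁ a₀)^[k] t)) =
    (-1) ^ i * (1 / a₁) ^ (i * (i - 1) / 2) *
    ∑ k ∈ Finset.range N, ((aff a₁ a₀)^[k + 1] t - (aff a₁ a₀)^[k] t) *
      ((affDiff a₁ a₀)^[i] f ((aff a₁ a₀)^[k] t) *
        g ((aff a₁ a₀)^[i] ((aff a₁ a₀)^[k] t))) := by
  induction i generalizing f g with
  | zero => simp
  | succ i ih =>
    have e1 := sum_mul_affDiff ha₁ ht f ((affDiff a₁ a₀)^[i] g) N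
    have e2 := h0 i 0 (by omega)
    have e3 := hN i 0 (by omega)
    simp only [Function.iterate_zero, id] at e2 e3
    rw [e2, e3, mul_zero, mul_zero, sub_zero, zero_sub] at e1
    simp only [Function.iterate_succ_apply' (affDiff a₁ a₀) i g]
    rw [e1]
    have e4 := ih (affDiff a₁ a₀ f) (fun s => g (aff a₁ a₀ s))
      (fun j l hjl => by
        have := h0 j (l + 1) (by omega)
        simpa only [Function.iterate_succ_apply'] using this)
      (fun j l hjl => by
        have := hN j (l + 1) (by omega)
        simpa only [Function.iterate_succ_apply'] using this)
    simp only [affDiff_iterate_aff, smul_eq_mul]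
    have e5 : ∀ k, ((aff a₁ a₀)^[k + 1] t - (aff a₁ a₀)^[k] t) *
        (affDiff a₁ a₀ f ((aff a₁ a₀)^[k] t) * ((1 / a₁) ^ i *
          (affDiff a₁ a₀)^[i] (fun s => g (aff a₁ a₀ s)) ((aff a₁ a₀)^[k] t))) =
        (1 / a₁) ^ i * (((aff a₁ a₀)^[k + 1] t - (aff a₁ a₀)^[k] t) *
        (affDiff a₁ a₀ f ((aff a₁ a₀)^[k] t) *
          (affDiff a₁ a₀)^[i] (fun s => g (aff a₁ a₀ s)) ((aff a₁ a₀)^[k] t))) := fun k => by ring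
    simp only [e5]
    rw [← Finset.mul_sum, e4, Nat.triangle_succ, pow_add, pow_add]
    simp only [Function.iterate_succ_apply, ← Function.iterate_succ_apply' (aff a₁ a₀) i]
    ring

/-- The function that is `1` at `p` and `0` elsewhere. -/
noncomputable def spike (p t : ℝ) : ℝ := open Classical in if t = p then 1 else 0

theorem spike_of_ne {p t : ℝ} (h : t ≠ p) : spike p t = 0 := by
  unfold spike
  rw [if_neg h]

/-- After i summations by parts the spike is evaluated at σ^{r+k}(t), so only k = 0 survives. The
boundary terms read iterates of t of order below r at the lower end and above r at the upper end,
where the spike vanishes. -/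
theorem sum_mul_affDiff_spike (ha₁ : 0 < a₁) {t : ℝ} (ht : t < aff a₁ a₀ t) {r i : ℕ}
    (hi : i ≤ r) (f : ℝ → ℝ) :
    ∑ k ∈ Finset.range (r + 1), ((aff a₁ a₀)^[k + 1] t - (aff a₁ a₀)^[k] t) *
      (f ((aff a₁ a₀)^[k] t) * (affDiff a₁ a₀)^[i]
        (fun s => spike ((aff a₁ a₀)^[r] t) ((aff a₁ a₀)^[r - i] s)) ((aff a₁ a₀)^[k] t)) =
    (-1) ^ i * (1 / a₁) ^ (i * (i - 1) / 2) *
      ((aff a₁ a₀ t - t) * (affDiff a₁ a₀)^[i] f t) := by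
  have hinj := (strictMono_aff_iterate ha₁ ht).injective
  have hsp : ∀ m, m ≠ r → spike ((aff a₁ a₀)^[r] t) ((aff a₁ a₀)^[m] t) = 0 := fun m hm =>
    spike_of_ne fun h => hm (hinj h)
  have hz : ∀ j l p, (∀ m ≤ j, r - i + (l + (m + p)) ≠ r) → (affDiff a₁ a₀)^[j]
      (fun s => spike ((aff a₁ a₀)^[r] t) ((aff a₁ a₀)^[r - i] ((aff a₁ a₀)^[l] s)))
        ((aff a₁ a₀)^[p] t) = 0 := by
    intro j l p hjl
    rw [← affDiff_iterate_zero (F := ℝ) (a₁ := a₁) (a₀ := a₀) j ((aff a₁ a₀)^[p] t)]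
    refine affDiff_iterate_congr _ _ fun m hm => ?_
    simp only [← Function.iterate_add_apply]
    exact hsp _ (hjl m hm)
  rw [sum_mul_affDiff_iterate ha₁ ht (r + 1) i f
    (fun s => spike ((aff a₁ a₀)^[r] t) ((aff a₁ a₀)^[r - i] s))
    (fun j l hjl => hz j l 0 fun m hm => by omega)
    (fun j l hjl => hz j l (r + 1) fun m hm => by omega)]
  congr 1
  simp only [← Function.iterate_add_apply]
  rw [Finset.sum_eq_single 0]
  · have e : r - i + (i + 0) = r := by omega
    have e1 : spike ((aff a₁ a₀)^[r] t) ((aff a₁ a₀)^[r] t) = 1 := by simp [spike]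
    rw [e, e1]
    simp
  · intro k _ hk
    rw [hsp _ (by omega), mul_zero, mul_zero]
  · simp

end Affine

end TimeScale

/-! ### Taylor expansions along a time scale. -/

namespace TimeScale

open Filter Topology Set Asymptotics

section Taylor

variable {F G H : Type} [NormedAddCommGroup F] [NormedSpace ℝ F] [NormedAddCommGroup G]
  [NormedSpace ℝ G] [NormedAddCommGroup H] [NormedSpace ℝ H] {T : Set ℝ} {e : ℝ} {k : ℕ}

/-- `f` has a Taylor expansion of order `k` at `e` along `T`. -/
def TaylorAt (T : Set ℝ) (e : ℝ) (k : ℕ) (f : ℝ → F) : Prop :=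
  ∃ c : ℕ → F, (fun t => f t - ∑ j ∈ Finset.range (k + 1), (t - e) ^ j • c j)
    =o[𝓝[T] e] fun t => (t - e) ^ k

theorem tendsto_sub_nhdsWithin : Tendsto (fun t => t - e) (𝓝[T] e) (𝓝 0) := by
  have h : Tendsto (fun t => t - e) (𝓝[T] e) (𝓝 (e - e)) :=
    ((continuous_id.sub continuous_const).tendsto e).mono_left nhdsWithin_le_nhds
  simpa using h

theorem isBigO_pow_sub_pow {i j : ℕ} (h : i ≤ j) :
    (fun t : ℝ => (t - e) ^ j) =O[𝓝[T] e] fun t => (t - e) ^ i := by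
  have h1 : (fun x : ℝ => x ^ j) =O[𝓝 0] fun x => x ^ i := by
    obtain ⟨d, rfl⟩ := Nat.exists_eq_add_of_le h
    simp only [pow_add]
    have h2 : (fun x : ℝ => x ^ d) =O[𝓝 0] fun _ => (1 : ℝ) :=
      ((continuous_pow d).tendsto (0 : ℝ)).isBigO_one ℝ
    simpa using (isBigO_refl (fun x : ℝ => x ^ i) (𝓝 0)).mul h2
  exact h1.comp_tendsto tendsto_sub_nhdsWithin

theorem isLittleO_pow_sub_pow {i j : ℕ} (h : i < j) :
    (fun t : ℝ => (t - e) ^ j) =o[𝓝[T] e] fun t => (t - e) ^ i :=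
  (isLittleO_pow_pow h).comp_tendsto tendsto_sub_nhdsWithin

theorem isLittleO_smul_const {α : Type*} {l : Filter α} {p q : α → ℝ} (h : p =o[l] q) (c : F) :
    (fun t => p t • c) =o[l] q := by
  simpa using h.smul_isBigO (isBigO_const_const c (one_ne_zero (α := ℝ)) l)

theorem TaylorAt.congr {f g : ℝ → F} (hf : TaylorAt T e k f) (h : f =ᶠ[𝓝[T] e] g) :
    TaylorAt T e k g := by
  obtain ⟨c, hc⟩ := hf
  refine ⟨c, hc.congr' ?_ EventuallyEq.rfl⟩
  filter_upwards [h] with t ht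
  rw [ht]

theorem taylorAt_of_isLittleO {f : ℝ → F} (h : f =o[𝓝[T] e] fun t => (t - e) ^ k) :
    TaylorAt T e k f := ⟨0, by simpa using h⟩

theorem TaylorAt.add {f g : ℝ → F} (hf : TaylorAt T e k f) (hg : TaylorAt T e k g) :
    TaylorAt T e k fun t => f t + g t := by
  obtain ⟨c, hc⟩ := hf
  obtain ⟨d, hd⟩ := hg
  refine ⟨fun j => c j + d j, (hc.add hd).congr_left fun t => ?_⟩
  simp only [smul_add, Finset.sum_add_distrib]
  abel

theorem TaylorAt.map (A : F →L[ℝ] G) {f : ℝ → F} (hf : TaylorAt T e k f) :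
    TaylorAt T e k fun t => A (f t) := by
  obtain ⟨c, hc⟩ := hf
  refine ⟨fun j => A (c j), ((A.isBigO_comp _ _).trans_isLittleO hc).congr_left fun t => ?_⟩
  simp

theorem taylorAt_pow_smul (i k : ℕ) (c : F) : TaylorAt T e k fun t => (t - e) ^ i • c := by
  rcases le_or_gt i k with h | h
  · refine ⟨fun j => if j = i then c else 0, (isLittleO_zero _ _).congr_left fun t => ?_⟩
    simp [Finset.mem_range, Nat.lt_succ_of_le h]
  · refine taylorAt_of_isLittleO ?_
    exact isLittleO_smul_const (isLittleO_pow_sub_pow h) c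

theorem taylorAt_const (c : F) : TaylorAt T e k fun _ => c := by
  simpa using taylorAt_pow_smul (T := T) (e := e) 0 k c

theorem taylorAt_sum {ι : Type*} (s : Finset ι) {f : ι → ℝ → F}
    (h : ∀ i ∈ s, TaylorAt T e k (f i)) : TaylorAt T e k fun t => ∑ i ∈ s, f i t := by
  classical
  induction s using Finset.induction_on with
  | empty => simpa using taylorAt_const (T := T) (e := e) (k := k) (0 : F)
  | insert a s ha ih =>
    simp only [Finset.sum_insert ha]
    exact (h a (Finset.mem_insert_self a s)).add
      (ih fun i hi => h i (Finset.mem_insert_of_mem hi))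

theorem TaylorAt.of_le {f : ℝ → F} {j : ℕ} (hf : TaylorAt T e k f) (hj : j ≤ k) :
    TaylorAt T e j f := by
  obtain ⟨c, hc⟩ := hf
  refine ((taylorAt_of_isLittleO (hc.trans_isBigO (isBigO_pow_sub_pow hj))).add
    (taylorAt_sum (Finset.range (k + 1)) fun i _ => taylorAt_pow_smul i j (c i))).congr ?_
  exact Eventually.of_forall fun t => by simp

theorem TaylorAt.tendsto {f : ℝ → F} (hf : TaylorAt T e k f) :
    ∃ y, Tendsto f (𝓝[T] e) (𝓝 y) := by
  obtain ⟨c, hc⟩ := hf.of_le (Nat.zero_le k)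
  refine ⟨c 0, ?_⟩
  simp only [zero_add, Finset.range_one, Finset.sum_singleton, pow_zero, one_smul] at hc
  have h := ((isLittleO_one_iff ℝ).1 hc).add_const (c 0)
  simpa using h

theorem TaylorAt.continuousWithinAt {f : ℝ → F} (hf : TaylorAt T e k f) (he : e ∈ T) :
    ContinuousWithinAt f T e := by
  obtain ⟨y, hy⟩ := hf.tendsto
  have h1 : y = f e := tendsto_nhds_unique (hy.mono_left (pure_le_nhdsWithin he))
    (tendsto_pure_nhds f e)
  rwa [h1] at hy

theorem taylorAt_zero_of_continuousWithinAt {f : ℝ → F} (h : ContinuousWithinAt f T e) :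
    TaylorAt T e 0 f := by
  refine ⟨fun _ => f e, ?_⟩
  simp only [zero_add, Finset.range_one, Finset.sum_singleton, pow_zero, one_smul]
  rw [isLittleO_one_iff]
  simpa using Tendsto.sub_const h (f e)

theorem TaylorAt.isBigO_one {f : ℝ → F} (hf : TaylorAt T e k f) :
    f =O[𝓝[T] e] fun _ => (1 : ℝ) := by
  obtain ⟨y, hy⟩ := hf.tendsto
  exact hy.isBigO_one ℝ

/-- Write B(f,g) = B(P,Q) + B(f-P,g) + B(P,g-Q) with Taylor polynomials P and Q: the first term is a
polynomial, and the others are a remainder times a bounded factor. -/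
theorem TaylorAt.bilin (B : F →L[ℝ] G →L[ℝ] H) {f : ℝ → F} {g : ℝ → G}
    (hf : TaylorAt T e k f) (hg : TaylorAt T e k g) : TaylorAt T e k fun t => B (f t) (g t) := by
  have hg' := hg
  obtain ⟨c, hc⟩ := hf
  obtain ⟨d, hd⟩ := hg
  set P : ℝ → F := fun t => ∑ j ∈ Finset.range (k + 1), (t - e) ^ j • c j with hP
  set Q : ℝ → G := fun t => ∑ j ∈ Finset.range (k + 1), (t - e) ^ j • d j with hQ
  have hPT : TaylorAt T e k P := taylorAt_sum _ fun i _ => taylorAt_pow_smul i k (c i)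
  have h1 : TaylorAt T e k fun t => B (P t) (Q t) := by
    have : ∀ t, B (P t) (Q t) = ∑ i ∈ Finset.range (k + 1), ∑ j ∈ Finset.range (k + 1),
        (t - e) ^ (i + j) • B (c i) (d j) := fun t => by
      simp only [hP, hQ, map_sum, map_smul, _root_.sum_apply,
        _root_.smul_apply, Finset.smul_sum, smul_smul, pow_add]
      rw [Finset.sum_comm]
      refine Finset.sum_congr rfl fun i _ => Finset.sum_congr rfl fun j _ => ?_
      rw [mul_comm]
    simp only [this]
    exact taylorAt_sum _ fun i _ => taylorAt_sum _ fun j _ => taylorAt_pow_smul _ k _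
  have hB : ∀ {u : ℝ → F} {v : ℝ → G} {p q : ℝ → ℝ}, (u =O[𝓝[T] e] p) → (v =O[𝓝[T] e] q) →
      (fun t => B (u t) (v t)) =O[𝓝[T] e] fun t => p t * q t := fun {u v p q} hu hv => by
    refine (IsBigO.of_bound ‖B‖ (Eventually.of_forall fun t => ?_)).trans
      (hu.norm_left.mul hv.norm_left)
    rw [norm_mul, norm_norm, norm_norm, ← mul_assoc]
    exact B.le_opNorm₂ _ _
  have h2 : (fun t => B (f t - P t) (g t)) =o[𝓝[T] e] fun t => (t - e) ^ k := by
    refine (hB (isBigO_refl _ _).norm_right (isBigO_refl _ _).norm_right).trans_isLittleO ?_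
    simpa using hc.norm_left.mul_isBigO hg'.isBigO_one.norm_left
  have h3 : (fun t => B (P t) (g t - Q t)) =o[𝓝[T] e] fun t => (t - e) ^ k := by
    refine (hB (isBigO_refl _ _).norm_right (isBigO_refl _ _).norm_right).trans_isLittleO ?_
    simpa using hPT.isBigO_one.norm_left.mul_isLittleO hd.norm_left
  refine ((h1.add (taylorAt_of_isLittleO h2)).add (taylorAt_of_isLittleO h3)).congr
    (Eventually.of_forall fun t => ?_)
  simp only [map_sub, _root_.sub_apply]
  abel

theorem TaylorAt.isBigO_sub {f : ℝ → F} (hf : TaylorAt T e (k + 1) f) (he : e ∈ T) :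
    (fun t => f t - f e) =O[𝓝[T] e] fun t => t - e := by
  obtain ⟨c, hc⟩ := hf.of_le (Nat.le_add_left 1 k)
  simp only [Finset.sum_range_succ, Finset.range_zero, Finset.sum_empty, pow_zero, one_smul,
    pow_one, zero_add] at hc
  have h0 : f e = c 0 := by
    have h1 := hc.isBigO.eq_zero_imp
    have h2 := (hc.isBigO.eq_zero_imp).self_of_nhdsWithin he (sub_self e)
    simpa [sub_eq_zero] using h2
  have h1 : (fun t => (t - e) • c 1) =O[𝓝[T] e] fun t => t - e :=
    IsBigO.of_bound ‖c 1‖ (Eventually.of_forall fun t => by rw [norm_smul, mul_comm])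
  refine (hc.isBigO.add h1).congr_left fun t => ?_
  rw [h0]; abel

end Taylor

/-! ### Estimates along a contraction towards e. -/

section Contract

variable {F : Type} [NormedAddCommGroup F] {T : Set ℝ} {e : ℝ} {g : ℝ → F}

/-- Telescope along e + q^n(t - e) → e. Since m ≥ 1, the increments are dominated by a geometric
series of ratio q, and continuity at e identifies the limit. This plays the role of the mean value
theorem. -/
theorem norm_sub_le_of_contract {q ε : ℝ} {m : ℕ} (hq0 : 0 < q) (hq1 : q < 1) (hm : 1 ≤ m)
    (hT : ∀ t ∈ T, e + q * (t - e) ∈ T) (hg : ContinuousWithinAt g T e) (hε : 0 ≤ ε)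
    (hb : ∀ᶠ t in 𝓝[T] e, ‖g t - g (e + q * (t - e))‖ ≤ ε * |t - e| ^ m) :
    ∀ᶠ t in 𝓝[T] e, ‖g t - g e‖ ≤ ε / (1 - q) * |t - e| ^ m := by
  obtain ⟨δ, hδ, H⟩ := Metric.mem_nhdsWithin_iff.1 hb
  refine Metric.mem_nhdsWithin_iff.2 ⟨δ, hδ, fun t ht => ?_⟩
  have h1q : 0 < 1 - q := by linarith
  have hmem : ∀ n : ℕ, e + q ^ n * (t - e) ∈ T := by
    intro n
    induction n with
    | zero => simpa using ht.2
    | succ n ih =>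
      have := hT _ ih
      convert this using 1
      ring
  have hq : ∀ n : ℕ, q ^ n ≤ 1 := fun n => pow_le_one₀ hq0.le hq1.le
  have hball : ∀ n : ℕ, e + q ^ n * (t - e) ∈ Metric.ball e δ := fun n => by
    have h1 := ht.1
    rw [Metric.mem_ball, Real.dist_eq] at h1 ⊢
    rw [add_sub_cancel_left, abs_mul, abs_of_pos (pow_pos hq0 n)]
    exact (mul_le_of_le_one_left (abs_nonneg _) (hq n)).trans_lt h1
  have hstep : ∀ n : ℕ, ‖g t - g (e + q ^ n * (t - e))‖ ≤
      ε * |t - e| ^ m * ((1 - q ^ n) / (1 - q)) := by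
    intro n
    induction n with
    | zero => simp
    | succ n ih =>
      have h1 : ‖g (e + q ^ n * (t - e)) - g (e + q * (e + q ^ n * (t - e) - e))‖ ≤
          ε * |e + q ^ n * (t - e) - e| ^ m := H ⟨hball n, hmem n⟩
      have e1 : e + q * (e + q ^ n * (t - e) - e) = e + q ^ (n + 1) * (t - e) := by ring
      rw [e1, add_sub_cancel_left, abs_mul, abs_of_pos (pow_pos hq0 n), mul_pow] at h1
      have h2 : (q ^ n) ^ m ≤ q ^ n := pow_le_of_le_one (pow_nonneg hq0.le n) (hq n) (by omega)
      have h3 : ε * ((q ^ n) ^ m * |t - e| ^ m) ≤ ε * |t - e| ^ m * q ^ n := by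
        rw [mul_assoc, mul_comm (|t - e| ^ m)]
        gcongr
      calc _ ≤ ‖g t - g (e + q ^ n * (t - e))‖ + _ := norm_sub_le_norm_sub_add_norm_sub _ _ _
        _ ≤ ε * |t - e| ^ m * ((1 - q ^ n) / (1 - q)) + ε * |t - e| ^ m * q ^ n :=
          add_le_add ih (h1.trans h3)
        _ = _ := by field_simp; ring
  have hlim : Tendsto (fun n : ℕ => e + q ^ n * (t - e)) atTop (𝓝[T] e) := by
    refine tendsto_nhdsWithin_iff.2 ⟨?_, Eventually.of_forall hmem⟩
    have := ((tendsto_pow_atTop_nhds_zero_of_lt_one hq0.le hq1).mul_const (t - e)).const_add e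
    simpa using this
  have hl2 : Tendsto (fun n : ℕ => ‖g t - g (e + q ^ n * (t - e))‖) atTop (𝓝 ‖g t - g e‖) :=
    ((hg.tendsto.comp hlim).const_sub (g t)).norm
  refine le_of_tendsto hl2 (Eventually.of_forall fun n => (hstep n).trans ?_)
  have h5 : (1 - q ^ n) / (1 - q) ≤ 1 / (1 - q) := by
    have := pow_pos hq0 n
    gcongr
    linarith
  refine (mul_le_mul_of_nonneg_left h5 (by positivity)).trans (le_of_eq ?_)
  ring

end Contract

/-! ### Delta derivatives and Taylor expansions at the exceptional point. -/

section Disc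

variable {F : Type} [NormedAddCommGroup F] [NormedSpace ℝ F] {T : Set ℝ} {N : ℕ}
  {a₁ a₀ e : ℝ} {f g : ℝ → F} {k : ℕ}

theorem Disc.hasDeltaDerivAt (h : Disc T N a₁ a₀ e) (hN : 0 < N) {t : ℝ} (ht : t ∈ kappa T)
    (hte : t ≠ e) : HasDeltaDerivAt T f (affDiff a₁ a₀ f t) t := by
  obtain ⟨h1, h2, -⟩ := h.jump 0 hN t ht hte
  simp only [Function.iterate_zero, id] at h1
  have := hasDeltaDerivAt_of_isolated (f := f) (h.isolated t (kappa_subset ht) hte) (h1 ▸ h2)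
  rwa [h1] at this

theorem Disc.deltaDeriv_of_ne (h : Disc T N a₁ a₀ e) (hN : 0 < N) {t : ℝ} (ht : t ∈ kappa T)
    (hte : t ≠ e) : deltaDeriv T f t = affDiff a₁ a₀ f t := by
  refine deltaDeriv_eq (h.hasDeltaDerivAt hN ht hte) fun f'' hf'' => ?_
  obtain ⟨h1, h2, -⟩ := h.jump 0 hN t ht hte
  simp only [Function.iterate_zero, id] at h1
  have := hf''.eq_of_lt_sigma (kappa_subset ht) (h1 ▸ h2)
  rwa [h1] at this

theorem Disc.deltaDeriv_self (h : Disc T N a₁ a₀ e) (he : e ∈ T) {f' : F}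
    (hf : HasDeltaDerivAt T f f' e) : deltaDeriv T f e = f' := by
  refine deltaDeriv_eq hf fun f'' hf'' => ?_
  have hσ : sigma T e = e := h.sigma_eq he 0
  rw [hasDeltaDerivAt_iff_of_sigma_eq hσ] at hf hf''
  have hu : UniqueDiffWithinAt ℝ T e := by
    rw [uniqueDiffWithinAt_iff_accPt, accPt_principal_iff_nhdsWithin]
    exact h.neBot he
  exact hu.eq_deriv _ hf'' hf

theorem Disc.eventually_mem_kappa (h : Disc T N a₁ a₀ e) (he : e ∈ T) :
    ∀ᶠ t in 𝓝[T] e, t ∈ kappa T := by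
  have := h.nhds_eq he 1
  rw [← this]
  exact self_mem_nhdsWithin

theorem Disc.aff_sub (h : Disc T N a₁ a₀ e) (he : e ∈ T) (t : ℝ) :
    aff a₁ a₀ t - e = a₁ * (t - e) := by
  have := h.fixed he
  unfold aff; linarith

theorem Disc.tendsto_aff (h : Disc T N a₁ a₀ e) (hN : 0 < N) (he : e ∈ T) :
    Tendsto (aff a₁ a₀) (𝓝[T] e) (𝓝[T] e) := by
  refine tendsto_nhdsWithin_iff.2 ⟨?_, ?_⟩
  · have hc : Continuous (aff a₁ a₀) := by unfold aff; fun_prop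
    have := hc.tendsto e
    rw [show aff a₁ a₀ e = e from h.fixed he] at this
    exact this.mono_left nhdsWithin_le_nhds
  · filter_upwards [h.eventually_mem_kappa he] with t ht
    by_cases hte : t = e
    · rw [hte, show aff a₁ a₀ e = e from h.fixed he]; exact he
    · exact (h.jump 0 hN t ht hte).2.2.1

/-- In the variable t - e the jump is multiplication by a₁, so Δ maps (t-e)^{j+1} to (a₁^{j+1} -
1)/(a₁ - 1) times (t-e)^j. A remainder o((t-e)^{k+1}) is divided by (a₁ - 1)(t - e). -/
theorem Disc.taylorAt_deltaDeriv (h : Disc T N a₁ a₀ e) (hN : 0 < N) (he : e ∈ T)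
    (hf : TaylorAt T e (k + 1) f) :
    (∃ f', HasDeltaDerivAt T f f' e) ∧ TaylorAt T e k (deltaDeriv T f) := by
  obtain ⟨c, hc⟩ := hf
  have ha1 : a₁ - 1 ≠ 0 := sub_ne_zero.2 (h.ne_one he)
  set R : ℝ → F := fun t => f t - ∑ j ∈ Finset.range (k + 1 + 1), (t - e) ^ j • c j with hR
  have hfR : ∀ t, f t = c 0 + (t - e) • c 1 + ∑ j ∈ Finset.range k, (t - e) ^ (j + 2) • c (j + 2)
      + R t := fun t => by
    simp only [hR]
    rw [Finset.sum_range_succ', Finset.sum_range_succ']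
    simp only [pow_zero, one_smul, zero_add, pow_one]
    abel
  have hR0 : R e = 0 := by
    have h2 := (hc.isBigO.eq_zero_imp).self_of_nhdsWithin he (by simp)
    exact h2
  have hfe : f e = c 0 := by
    rw [hfR e, hR0]
    simp
  have hσ : sigma T e = e := h.sigma_eq he 0
  have hder : HasDeltaDerivAt T f (c 1) e := by
    rw [hasDeltaDerivAt_iff_of_sigma_eq hσ, hasDerivWithinAt_iff_isLittleO]
    have h1 : R =o[𝓝[T] e] fun t => t - e := by
      simpa using hc.trans_isBigO (isBigO_pow_sub_pow (Nat.le_add_left 1 k))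
    have h2 : (fun t => ∑ j ∈ Finset.range k, (t - e) ^ (j + 2) • c (j + 2))
        =o[𝓝[T] e] fun t => t - e := by
      refine IsLittleO.fun_sum fun j _ => ?_
      have h3 : (fun t => (t - e) ^ (j + 2)) =o[𝓝[T] e] fun t => t - e := by
        simpa using isLittleO_pow_sub_pow (T := T) (e := e) (show 1 < j + 2 by omega)
      exact isLittleO_smul_const h3 _
    refine (h2.add h1).congr_left fun t => ?_
    rw [hfe, hfR t]
    abel
  refine ⟨⟨_, hder⟩, fun j => ((a₁ ^ (j + 1) - 1) / (a₁ - 1)) • c (j + 1), ?_⟩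
  rw [isLittleO_iff]
  intro ε hε
  have hpos := h.pos
  -- The remainders at t and σ(t) together carry the weight 1 + a₁^{k+1}, and the quotient then
  -- divides by |a₁ - 1|; this constant makes the total ε.
  have hRt := (isLittleO_iff.1 hc) (show 0 < ε * |a₁ - 1| / (1 + a₁ ^ (k + 1)) by positivity)
  have hRa := (h.tendsto_aff hN he).eventually hRt
  filter_upwards [hRt, hRa, h.eventually_mem_kappa he] with t h1 h2 h3
  by_cases hte : t = e
  · subst hte
    rw [h.deltaDeriv_self he hder, Finset.sum_range_succ']
    simp [div_self ha1]
    positivity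
  · have hx : t - e ≠ 0 := sub_ne_zero.2 hte
    rw [h.deltaDeriv_of_ne hN h3 hte]
    have e1 : aff a₁ a₀ t - t = (a₁ - 1) * (t - e) := by
      have := h.aff_sub he t
      linarith
    have e2 : ∀ t, f t = R t + ∑ j ∈ Finset.range (k + 1), (t - e) ^ (j + 1) • c (j + 1) + c 0 :=
      fun t => by
        simp only [hR]
        rw [Finset.sum_range_succ' _ (k + 1)]
        simp only [pow_zero, one_smul]
        abel
    have e3 : affDiff a₁ a₀ f t - ∑ j ∈ Finset.range (k + 1), (t - e) ^ j •
        ((a₁ ^ (j + 1) - 1) / (a₁ - 1)) • c (j + 1) =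
        ((a₁ - 1) * (t - e))⁻¹ • (R (aff a₁ a₀ t) - R t) := by
      rw [affDiff, e1, e2 (aff a₁ a₀ t), e2 t, h.aff_sub he, sub_eq_iff_eq_add]
      have : R (aff a₁ a₀ t) + ∑ j ∈ Finset.range (k + 1), (a₁ * (t - e)) ^ (j + 1) • c (j + 1)
          + c 0 - (R t + ∑ j ∈ Finset.range (k + 1), (t - e) ^ (j + 1) • c (j + 1) + c 0) =
          (R (aff a₁ a₀ t) - R t) + ∑ j ∈ Finset.range (k + 1),
            ((a₁ * (t - e)) ^ (j + 1) - (t - e) ^ (j + 1)) • c (j + 1) := by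
        simp only [sub_smul, Finset.sum_sub_distrib]
        abel
      rw [this, smul_add, Finset.smul_sum]
      congr 1
      refine Finset.sum_congr rfl fun j _ => ?_
      rw [smul_smul, smul_smul]
      congr 1
      rw [mul_pow]
      field_simp
      ring
    rw [e3, norm_smul, norm_inv, norm_mul, Real.norm_eq_abs, Real.norm_eq_abs]
    have h4 : ‖R (aff a₁ a₀ t) - R t‖ ≤
        ε * |a₁ - 1| / (1 + a₁ ^ (k + 1)) * ((1 + a₁ ^ (k + 1)) * |t - e| ^ (k + 1)) := by
      refine (norm_sub_le _ _).trans ((add_le_add h2 h1).trans (le_of_eq ?_))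
      rw [h.aff_sub he, norm_pow, norm_pow, Real.norm_eq_abs, Real.norm_eq_abs, abs_mul,
        abs_of_pos hpos, mul_pow]
      ring
    have hx' : 0 < |t - e| := abs_pos.2 hx
    have ha1' : 0 < |a₁ - 1| := abs_pos.2 ha1
    rw [inv_mul_le_iff₀ (by positivity)]
    refine h4.trans (le_of_eq ?_)
    rw [norm_pow, Real.norm_eq_abs]
    field_simp
    rw [pow_succ']

theorem Disc.contract_lt_one (h : Disc T N a₁ a₀ e) (he : e ∈ T) :
    0 < min a₁ a₁⁻¹ ∧ min a₁ a₁⁻¹ < 1 := by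
  have hpos := h.pos
  refine ⟨lt_min hpos (inv_pos.2 hpos), ?_⟩
  rcases lt_or_gt_of_ne (h.ne_one he) with h1 | h1
  · exact (min_le_left _ _).trans_lt h1
  · exact (min_le_right _ _).trans_lt (inv_lt_one_of_one_lt₀ h1)

theorem Disc.tendsto_contract (h : Disc T N a₁ a₀ e) (he : e ∈ T) :
    Tendsto (fun t => e + min a₁ a₁⁻¹ * (t - e)) (𝓝[T] e) (𝓝[T] e) := by
  refine tendsto_nhdsWithin_iff.2 ⟨?_, ?_⟩
  · have hc : Continuous (fun t => e + min a₁ a₁⁻¹ * (t - e)) := by fun_prop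
    have := hc.tendsto e
    rw [sub_self, mul_zero, add_zero] at this
    exact this.mono_left nhdsWithin_le_nhds
  · filter_upwards [self_mem_nhdsWithin] with t ht
    exact h.contract he 0 t ht

/-- Integrates an expansion: divide the coefficients by the eigenvalues of Δ, which are nonzero
since 0 < a₁ ≠ 1. The difference g of f and this polynomial has increments o((t-e)^{k+1}) along σ,
and `norm_sub_le_of_contract` turns this into a bound for g(t) - g(e). -/
theorem Disc.taylorAt_succ (h : Disc T N a₁ a₀ e) (hN : 0 < N) (he : e ∈ T)
    (hcont : ContinuousWithinAt f T e) (hf : TaylorAt T e k (deltaDeriv T f)) :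
    TaylorAt T e (k + 1) f := by
  obtain ⟨c, hc⟩ := hf
  have hpos := h.pos
  have ha1 : a₁ - 1 ≠ 0 := sub_ne_zero.2 (h.ne_one he)
  have hγ : ∀ j, a₁ ^ (j + 1) - 1 ≠ 0 := fun j => by
    rw [sub_ne_zero]
    intro h1
    exact h.ne_one he ((pow_eq_one_iff_of_nonneg hpos.le (Nat.succ_ne_zero j)).1 h1)
  set P : ℝ → F := fun t => ∑ j ∈ Finset.range (k + 1), (t - e) ^ (j + 1) •
    ((a₁ - 1) / (a₁ ^ (j + 1) - 1)) • c j with hP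
  have hPT : TaylorAt T e (k + 1) P := taylorAt_sum _ fun j _ => taylorAt_pow_smul _ _ _
  set g : ℝ → F := fun t => f t - P t with hg
  have hgc : ContinuousWithinAt g T e := hcont.sub (hPT.continuousWithinAt he)
  have hPa : ∀ t, P (aff a₁ a₀ t) - P t =
      ((a₁ - 1) * (t - e)) • ∑ j ∈ Finset.range (k + 1), (t - e) ^ j • c j := fun t => by
    simp only [hP, h.aff_sub he]
    rw [← Finset.sum_sub_distrib, Finset.smul_sum]
    refine Finset.sum_congr rfl fun j _ => ?_
    rw [smul_smul, smul_smul, ← sub_smul, smul_smul]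
    congr 1
    have := hγ j
    rw [mul_pow]
    field_simp
    ring
  have hdiff : ∀ ε > 0, ∀ᶠ t in 𝓝[T] e, ‖g (aff a₁ a₀ t) - g t‖ ≤ ε * |t - e| ^ (k + 1) := by
    intro ε hε
    filter_upwards [(isLittleO_iff.1 hc) (show 0 < ε / |a₁ - 1| by positivity),
      h.eventually_mem_kappa he] with t h1 h2
    by_cases hte : t = e
    · rw [hte, show aff a₁ a₀ e = e from h.fixed he]
      simp
    · have hx : t - e ≠ 0 := sub_ne_zero.2 hte
      have e1 : aff a₁ a₀ t - t = (a₁ - 1) * (t - e) := by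
        have := h.aff_sub he t
        linarith
      have e2 : f (aff a₁ a₀ t) - f t = ((a₁ - 1) * (t - e)) • deltaDeriv T f t := by
        rw [h.deltaDeriv_of_ne hN h2 hte, affDiff, e1, smul_inv_smul₀ (mul_ne_zero ha1 hx)]
      have e3 : g (aff a₁ a₀ t) - g t = ((a₁ - 1) * (t - e)) •
          (deltaDeriv T f t - ∑ j ∈ Finset.range (k + 1), (t - e) ^ j • c j) := by
        rw [smul_sub, ← e2, ← hPa]
        simp only [hg]
        abel
      rw [e3, norm_smul, norm_mul, Real.norm_eq_abs, Real.norm_eq_abs]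
      refine (mul_le_mul_of_nonneg_left h1 (by positivity)).trans (le_of_eq ?_)
      rw [norm_pow, Real.norm_eq_abs, pow_succ]
      have ha1' : 0 < |a₁ - 1| := abs_pos.2 ha1
      field_simp
  obtain ⟨hq0, hq1⟩ := h.contract_lt_one he
  have hcontr : ∀ ε > 0, ∀ᶠ t in 𝓝[T] e,
      ‖g t - g (e + min a₁ a₁⁻¹ * (t - e))‖ ≤ ε * |t - e| ^ (k + 1) := by
    intro ε hε
    -- The contraction is σ or its inverse; in the second case the increment is read at the
    -- contracted point.
    rcases le_total a₁ a₁⁻¹ with hle | hle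
    · filter_upwards [hdiff ε hε] with t ht
      have e1 : e + min a₁ a₁⁻¹ * (t - e) = aff a₁ a₀ t := by
        have := h.aff_sub he t
        rw [min_eq_left hle]; linarith
      rw [e1, norm_sub_rev]
      exact ht
    · filter_upwards [(h.tendsto_contract he).eventually (hdiff ε hε)] with t ht
      have e1 : aff a₁ a₀ (e + min a₁ a₁⁻¹ * (t - e)) = t := by
        have := h.aff_sub he (e + min a₁ a₁⁻¹ * (t - e))
        rw [min_eq_right hle, add_sub_cancel_left, mul_inv_cancel_left₀ hpos.ne'] at this
        rw [min_eq_right hle]; linarith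
      rw [e1, add_sub_cancel_left, abs_mul, abs_of_pos hq0, mul_pow] at ht
      refine ht.trans ?_
      have : min a₁ a₁⁻¹ ^ (k + 1) ≤ 1 := pow_le_one₀ hq0.le hq1.le
      gcongr
      exact mul_le_of_le_one_left (by positivity) this
  have hgo : (fun t => g t - g e) =o[𝓝[T] e] fun t => (t - e) ^ (k + 1) := by
    rw [isLittleO_iff]
    intro ε hε
    have h1q : 0 < 1 - min a₁ a₁⁻¹ := by linarith
    have := norm_sub_le_of_contract hq0 hq1 (Nat.succ_le_succ (Nat.zero_le k)) (h.contract he 0)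
      hgc (by positivity) (hcontr (ε * (1 - min a₁ a₁⁻¹)) (by positivity))
    filter_upwards [this] with t ht
    rw [mul_div_cancel_right₀ _ h1q.ne'] at ht
    rwa [norm_pow, Real.norm_eq_abs]
  refine (((taylorAt_of_isLittleO hgo).add (taylorAt_const (g e))).add hPT).congr
    (Eventually.of_forall fun t => ?_)
  simp only [hg]
  abel

end Disc

end TimeScale

/-! ### Iterated delta derivatives and the class C^m in terms of expansions at e. -/

namespace TimeScale

open Filter Topology Set Asymptotics

section Iterates

variable {F : Type} [NormedAddCommGroup F] [NormedSpace ℝ F] {S T : Set ℝ} {N : ℕ}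
  {a₁ a₀ e : ℝ} {f g : ℝ → F} {k : ℕ}

theorem taylorAt_congr_set (h : 𝓝[S] e = 𝓝[T] e) : TaylorAt S e k f ↔ TaylorAt T e k f := by
  unfold TaylorAt
  rw [h]

theorem Disc.deltaIter_of_ne (h : Disc T N a₁ a₀ e) {j : ℕ} (hj : j ≤ N) {t : ℝ}
    (ht : t ∈ kappa^[j] T) (hte : t ≠ e) : deltaIter T f j t = (affDiff a₁ a₀)^[j] f t := by
  induction j generalizing t with
  | zero => rfl
  | succ j ih =>
    have hs : Disc (kappa^[j] T) (N - j) a₁ a₀ e := h.shift (by omega)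
    have hmem := h.jump j (by omega) t ht hte
    have ht' : t ∈ kappa (kappa^[j] T) := by
      have := ht
      rwa [Function.iterate_succ_apply'] at this
    rw [deltaIter, hs.deltaDeriv_of_ne (by omega) ht' hte, Function.iterate_succ_apply', affDiff,
      affDiff, ih (by omega) (kappa_subset ht') hte,
      ih (t := aff a₁ a₀ t) (by omega) hmem.2.2.1 hmem.2.2.2]

theorem Disc.taylorAt_deltaIter (h : Disc T N a₁ a₀ e) (he : e ∈ T) {j m : ℕ} (hj : j ≤ N)
    (hf : TaylorAt T e (m + j) f) : TaylorAt T e m (deltaIter T f j) := by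
  induction j generalizing m with
  | zero => exact hf
  | succ j ih =>
    have hs : Disc (kappa^[j] T) (N - j) a₁ a₀ e := h.shift (by omega)
    have h1 : TaylorAt T e (m + 1) (deltaIter T f j) := ih (by omega) (by convert hf using 1; omega)
    rw [← taylorAt_congr_set (h.nhds_eq he j)] at h1 ⊢
    exact (hs.taylorAt_deltaDeriv (by omega) (h.mem he j) h1).2

theorem Disc.deltaDifferentiable (h : Disc T N a₁ a₀ e) {m : ℕ} (hm : m ≤ N)
    (hf : e ∈ T → TaylorAt T e m f) : DeltaDifferentiable T m f := by
  intro j hj t ht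
  have hs : Disc (kappa^[j] T) (N - j) a₁ a₀ e := h.shift (by omega)
  rw [Function.iterate_succ_apply'] at ht
  by_cases hte : t = e
  · have he : e ∈ T := hte ▸ kappa_iterate_anti (Nat.zero_le j) (kappa_subset ht)
    have h1 : TaylorAt T e (m - j - 1 + 1) (deltaIter T f j) :=
      h.taylorAt_deltaIter he (by omega) (by convert hf he using 1; omega)
    rw [← taylorAt_congr_set (h.nhds_eq he j)] at h1
    rw [hte]
    exact (hs.taylorAt_deltaDeriv (by omega) (h.mem he j) h1).1
  · exact ⟨_, hs.hasDeltaDerivAt (by omega) ht hte⟩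

theorem Disc.continuousWithinAt_of_ne {E : Type} [NormedAddCommGroup E] {f : ℝ → E}
    (h : Disc T N a₁ a₀ e) {t : ℝ} (ht : t ∈ T) (hte : t ≠ e) :
    ContinuousWithinAt f T t := by
  obtain ⟨δ, hδ, H⟩ := h.isolated t ht hte
  rw [Metric.continuousWithinAt_iff]
  intro ε hε
  refine ⟨δ, hδ, fun {s} hs hst => ?_⟩
  rw [H s hs (by rwa [← Real.dist_eq]), dist_self]
  exact hε

/-- Isolated points impose nothing. At e, continuity of f^{Δ^m} is an expansion of order 0, which is
integrated m times by `Disc.taylorAt_succ`; the continuity required at each stage follows from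
differentiability. The converse differentiates the expansion. -/
theorem Disc.isC_iff (h : Disc T N a₁ a₀ e) {m : ℕ} (hm : m ≤ N) :
    IsC T m f ↔ (e ∈ T → TaylorAt T e m f) := by
  constructor
  · rintro ⟨hd, hc⟩ he
    have key : ∀ i ≤ m, TaylorAt T e i (deltaIter T f (m - i)) := by
      intro i
      induction i with
      | zero =>
        intro _
        rw [← taylorAt_congr_set (h.nhds_eq he m)]
        exact taylorAt_zero_of_continuousWithinAt (hc e (h.mem he m))
      | succ i ih =>
        intro hi
        have h1 := ih (by omega)
        obtain ⟨l, hl⟩ : ∃ l, m - i = l + 1 := ⟨m - i - 1, by omega⟩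
        have hl' : m - (i + 1) = l := by omega
        have hs : Disc (kappa^[l] T) (N - l) a₁ a₀ e := h.shift (by omega)
        obtain ⟨f', hf'⟩ := hd l (by omega) e (h.mem he _)
        rw [hl] at h1
        rw [← taylorAt_congr_set (h.nhds_eq he l)] at h1 ⊢
        rw [hl']
        exact hs.taylorAt_succ (by omega) (h.mem he l)
          (hf'.continuousWithinAt (h.sigma_eq he l)) h1
    simpa [deltaIter] using key m le_rfl
  · intro hf
    refine ⟨h.deltaDifferentiable hm hf, fun t ht => ?_⟩
    by_cases hte : t = e
    · rw [hte]
      have he : e ∈ T := hte ▸ kappa_iterate_anti (Nat.zero_le m) ht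
      have h1 : TaylorAt T e 0 (deltaIter T f m) :=
        h.taylorAt_deltaIter he hm (by simpa using hf he)
      rw [← taylorAt_congr_set (h.nhds_eq he m)] at h1
      exact h1.continuousWithinAt (h.mem he m)
    · exact (h.shift (p := m) (M := N - m) (by omega)).continuousWithinAt_of_ne ht hte

theorem Disc.deltaIter_congr (h : Disc T N a₁ a₀ e) (he : e ∈ T) {j : ℕ} (hj : j ≤ N)
    (hfg : f =ᶠ[𝓝[T] e] g) : deltaIter T f j =ᶠ[𝓝[T] e] deltaIter T g j := by
  induction j with
  | zero => exact hfg
  | succ j ih =>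
    have ih := ih (by omega)
    have hs : Disc (kappa^[j] T) (N - j) a₁ a₀ e := h.shift (by omega)
    have h1 := hs.eventually_mem_kappa (h.mem he j)
    have h2 := hs.tendsto_aff (by omega) (h.mem he j)
    rw [h.nhds_eq he j] at h1 h2
    filter_upwards [h1, ih, h2.eventually ih] with t ht ht1 ht2
    by_cases hte : t = e
    · subst hte
      refine deltaDeriv_congr ?_ ?_
      · rw [h.nhds_eq he j]; exact ih
      · rw [h.sigma_eq he j]; exact ht1
    · rw [deltaIter, deltaIter, hs.deltaDeriv_of_ne (by omega) ht hte,
        hs.deltaDeriv_of_ne (by omega) ht hte, affDiff, affDiff, ht1, ht2]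

theorem Disc.deltaIter_zero (h : Disc T N a₁ a₀ e) (he : e ∈ T) {j : ℕ} (hj : j ≤ N) :
    deltaIter T (fun _ => (0 : F)) j =ᶠ[𝓝[T] e] fun _ => 0 := by
  induction j with
  | zero => exact EventuallyEq.rfl
  | succ j ih =>
    have ih := ih (by omega)
    have hs : Disc (kappa^[j] T) (N - j) a₁ a₀ e := h.shift (by omega)
    have h1 := hs.eventually_mem_kappa (h.mem he j)
    have h2 := hs.tendsto_aff (by omega) (h.mem he j)
    rw [h.nhds_eq he j] at h1 h2
    filter_upwards [h1, ih, h2.eventually ih] with t ht ht1 ht2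
    by_cases hte : t = e
    · subst hte
      refine hs.deltaDeriv_self (h.mem he j) ?_
      have hσ := h.sigma_eq he j
      refine (HasDeltaDerivAt.congr (g := fun _ => (0 : F)) ?_ ?_).2 ?_
      · rw [h.nhds_eq he j]; exact ih
      · rw [hσ]; exact ht1
      · rw [hasDeltaDerivAt_iff_of_sigma_eq hσ]
        exact hasDerivWithinAt_const _ _ _
    · rw [deltaIter, hs.deltaDeriv_of_ne (by omega) ht hte, affDiff, ht1, ht2, sub_zero, smul_zero]

end Iterates

/-! ### Joint expansions in (t, u) and composition with curves. -/

section Joint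

variable {V : Type} [NormedAddCommGroup V] [NormedSpace ℝ V] {T : Set ℝ} {M : ℕ} {a₁ a₀ e : ℝ}

/-- `f` has a Taylor expansion of order `k` at `(e, u₀)` along `T × V`, the coefficients being
homogeneous maps that preserve Taylor expansions. -/
def JointTaylorAt {F : Type} [NormedAddCommGroup F] [NormedSpace ℝ F] (T : Set ℝ) (e : ℝ) (u₀ : V)
    (k : ℕ) (f : ℝ → V → F) : Prop :=
  ∃ c : ℕ → ℕ → V → F,
    (∀ j m i (w : ℝ → V), TaylorAt T e i w → TaylorAt T e i fun t => c j m (w t)) ∧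
    (∀ j m (s : ℝ) v, c j m (s • v) = s ^ m • c j m v) ∧
    (fun q : ℝ × V => f q.1 q.2 - ∑ j ∈ Finset.range (k + 1), ∑ m ∈ Finset.range (k + 1),
      (q.1 - e) ^ j • c j m (q.2 - u₀)) =o[𝓝[T] e ×ˢ 𝓝 u₀]
      fun q => (|q.1 - e| + ‖q.2 - u₀‖) ^ k

/-- For k ≥ 1, v(t) - v(e) = O(t - e), so the joint remainder becomes o((t-e)^k); for k = 0
continuity of v suffices. -/
theorem JointTaylorAt.taylorAt_comp {F : Type} [NormedAddCommGroup F] [NormedSpace ℝ F] {k : ℕ}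
    {f : ℝ → V → F} {v : ℝ → V} (he : e ∈ T) (hf : JointTaylorAt T e (v e) k f)
    (hv : TaylorAt T e k v) : TaylorAt T e k fun t => f t (v t) := by
  obtain ⟨c, hc1, -, hc3⟩ := hf
  have htend : Tendsto (fun t => (t, v t)) (𝓝[T] e) (𝓝[T] e ×ˢ 𝓝 (v e)) :=
    tendsto_id.prodMk (hv.continuousWithinAt he)
  have h1 := hc3.comp_tendsto htend
  have h2 : (fun t => (|t - e| + ‖v t - v e‖) ^ k) =O[𝓝[T] e] fun t => (t - e) ^ k := by
    rcases k with _ | k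
    · simpa using isBigO_refl (fun _ : ℝ => (1 : ℝ)) (𝓝[T] e)
    · refine IsBigO.pow ?_ _
      exact ((isBigO_refl _ _).abs_left).add (hv.isBigO_sub he).norm_left
  have h3 := taylorAt_of_isLittleO (h1.trans_isBigO h2)
  have hw : TaylorAt T e k fun t => v t - v e := by
    simpa [sub_eq_add_neg] using hv.add (taylorAt_const (-v e))
  have hbil : ∀ j m, TaylorAt T e k fun t => (t - e) ^ j • c j m (v t - v e) := fun j m => by
    have := TaylorAt.bilin (ContinuousLinearMap.lsmul ℝ ℝ) (taylorAt_pow_smul j k (1 : ℝ))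
      (hc1 j m k _ hw)
    simpa using this
  refine (h3.add (taylorAt_sum (Finset.range (k + 1)) fun j _ =>
    taylorAt_sum (Finset.range (k + 1)) fun m _ => hbil j m)).congr
      (Eventually.of_forall fun t => ?_)
  simp

/-- Integrate the expansion of the u-derivative along the segment from u₀ to u. A term homogeneous
of degree m becomes one of degree m + 1 with factor 1/(m+1), and the terms of degree 0 in u come
from the slice u = u₀. -/
theorem jointTaylorAt_of_fderiv {F : Type} [NormedAddCommGroup F] [NormedSpace ℝ F] {k : ℕ}
    {f : ℝ → V → F} {u₀ : V} (hd : ∀ t ∈ T, Differentiable ℝ (f t))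
    (h1 : JointTaylorAt T e u₀ k fun t u => fderiv ℝ (f t) u)
    (h2 : TaylorAt T e (k + 1) fun t => f t u₀) : JointTaylorAt T e u₀ (k + 1) f := by
  obtain ⟨c, hc1, hc2, hc3⟩ := h1
  obtain ⟨d, hd2⟩ := h2
  refine ⟨fun j m v => m.casesOn (d j) fun m =>
    if j ≤ k then ((m : ℝ) + 1)⁻¹ • c j m v v else 0, ?_, ?_, ?_⟩
  · intro j m i w hw
    rcases m with _ | m
    · exact taylorAt_const _
    · by_cases hj : j ≤ k
      · simp only [if_pos hj]
        exact (TaylorAt.bilin (ContinuousLinearMap.id ℝ (V →L[ℝ] F)) (hc1 j m i w hw) hw).map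
          (((m : ℝ) + 1)⁻¹ • ContinuousLinearMap.id ℝ F)
      · simp only [if_neg hj]
        exact taylorAt_const _
  · intro j m s v
    rcases m with _ | m
    · simp
    · by_cases hj : j ≤ k
      · simp only [if_pos hj]
        rw [hc2, map_smul, _root_.smul_apply, smul_smul, smul_smul, smul_smul, pow_succ]
        congr 1
        ring
      · simp only [if_neg hj, smul_zero]
  · set Q : ℝ → V → F := fun x h => ∑ j ∈ Finset.range (k + 1), ∑ m ∈ Finset.range (k + 1),
      x ^ j • ((m : ℝ) + 1)⁻¹ • c j m h h with hQ
    have hsum : ∀ (x : ℝ) (h : V), (∑ j ∈ Finset.range (k + 1 + 1), ∑ m ∈ Finset.range (k + 1 + 1),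
        x ^ j • (m.casesOn (d j) fun m =>
          if j ≤ k then ((m : ℝ) + 1)⁻¹ • c j m h h else 0 : F)) =
        Q x h + ∑ j ∈ Finset.range (k + 1 + 1), x ^ j • d j := fun x h => by
      have h0 : ∀ j, (∑ m ∈ Finset.range (k + 1 + 1), x ^ j • (m.casesOn (d j) fun m =>
          if j ≤ k then ((m : ℝ) + 1)⁻¹ • c j m h h else 0 : F)) =
          ∑ m ∈ Finset.range (k + 1), x ^ j • (if j ≤ k then ((m : ℝ) + 1)⁻¹ • c j m h h else 0)
            + x ^ j • d j := fun j => Finset.sum_range_succ' _ _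
      simp only [h0, Finset.sum_add_distrib]
      rw [Finset.sum_range_succ _ (k + 1)]
      simp only [Nat.not_succ_le_self, if_false, smul_zero, Finset.sum_const_zero, add_zero, hQ]
      congr 1
      refine Finset.sum_congr rfl fun j hj => Finset.sum_congr rfl fun m _ => ?_
      rw [if_pos (Nat.lt_succ_iff.1 (Finset.mem_range.1 hj))]
    have hpart2 : (fun q : ℝ × V => f q.1 u₀ - ∑ j ∈ Finset.range (k + 1 + 1), (q.1 - e) ^ j • d j)
        =o[𝓝[T] e ×ˢ 𝓝 u₀] fun q => (|q.1 - e| + ‖q.2 - u₀‖) ^ (k + 1) := by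
      refine (hd2.comp_tendsto (tendsto_fst (f := 𝓝[T] e) (g := 𝓝 u₀))).trans_isBigO ?_
      refine IsBigO.of_bound 1 (Eventually.of_forall fun q => ?_)
      simp only [Function.comp, one_mul, norm_pow, Real.norm_eq_abs]
      exact pow_le_pow_left₀ (abs_nonneg _)
        ((le_add_of_nonneg_right (norm_nonneg _)).trans (le_abs_self _)) _
    have hpart1 : (fun q : ℝ × V => f q.1 q.2 - f q.1 u₀ - Q (q.1 - e) (q.2 - u₀))
        =o[𝓝[T] e ×ˢ 𝓝 u₀] fun q => (|q.1 - e| + ‖q.2 - u₀‖) ^ (k + 1) := by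
      rw [isLittleO_iff]
      intro ε hε
      obtain ⟨A, hA, B, hB, hAB⟩ := mem_prod_iff.1 (isLittleO_iff.1 hc3 hε)
      obtain ⟨δ, hδ, hδB⟩ := Metric.mem_nhds_iff.1 hB
      refine mem_prod_iff.2 ⟨A ∩ T, inter_mem hA self_mem_nhdsWithin, Metric.ball u₀ δ,
        Metric.ball_mem_nhds _ hδ, ?_⟩
      rintro ⟨t, u⟩ ⟨⟨htA, htT⟩, hu⟩
      simp only at htA htT hu
      set h := u - u₀ with hh
      set x := t - e with hx
      have hnorm : ‖h‖ < δ := by rwa [Metric.mem_ball, dist_eq_norm] at hu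
      have hQ' : ∀ s : ℝ, HasDerivAt (fun s : ℝ => Q x (s • h))
          (∑ j ∈ Finset.range (k + 1), ∑ m ∈ Finset.range (k + 1), x ^ j • c j m (s • h) h) s := by
        intro s
        have e1 : (fun s : ℝ => Q x (s • h)) = fun s => ∑ j ∈ Finset.range (k + 1),
            ∑ m ∈ Finset.range (k + 1), (x ^ j * ((m : ℝ) + 1)⁻¹ * s ^ (m + 1)) • c j m h h := by
          funext s
          simp only [hQ]
          refine Finset.sum_congr rfl fun j _ => Finset.sum_congr rfl fun m _ => ?_
          rw [hc2, map_smul, _root_.smul_apply, smul_smul, smul_smul, smul_smul, pow_succ]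
          congr 1
          ring
        rw [e1]
        refine HasDerivAt.fun_sum fun j _ => HasDerivAt.fun_sum fun m _ => ?_
        have h3 := ((hasDerivAt_pow (m + 1) s).const_mul (x ^ j * ((m : ℝ) + 1)⁻¹)).smul_const
          (c j m h h)
        convert h3 using 1
        rw [hc2, _root_.smul_apply, smul_smul]
        congr 1
        have : (m : ℝ) + 1 ≠ 0 := by positivity
        push_cast
        field_simp
      have hφ : ∀ s ∈ Icc (0 : ℝ) 1, HasDerivWithinAt (fun s : ℝ => f t (u₀ + s • h) - Q x (s • h))
          (fderiv ℝ (f t) (u₀ + s • h) h - ∑ j ∈ Finset.range (k + 1),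
            ∑ m ∈ Finset.range (k + 1), x ^ j • c j m (s • h) h) (Icc 0 1) s := by
        intro s _
        have h4 : HasDerivAt (fun s : ℝ => u₀ + s • h) h s := by
          simpa using ((hasDerivAt_id s).smul_const h).const_add u₀
        exact (((hd t htT _).hasFDerivAt.comp_hasDerivAt s h4).sub (hQ' s)).hasDerivWithinAt
      have hbound : ∀ s ∈ Ico (0 : ℝ) 1, ‖fderiv ℝ (f t) (u₀ + s • h) h -
          ∑ j ∈ Finset.range (k + 1), ∑ m ∈ Finset.range (k + 1), x ^ j • c j m (s • h) h‖ ≤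
          ε * (|x| + ‖h‖) ^ (k + 1) := by
        intro s hs
        have hsh : ‖s • h‖ ≤ ‖h‖ := by
          rw [norm_smul, Real.norm_eq_abs, abs_of_nonneg hs.1]
          exact mul_le_of_le_one_left (norm_nonneg _) hs.2.le
        have hmem : (t, u₀ + s • h) ∈ A ×ˢ B := ⟨htA, hδB (by
          rw [Metric.mem_ball, dist_eq_norm, add_sub_cancel_left]
          exact hsh.trans_lt hnorm)⟩
        have h5 := hAB hmem
        simp only [mem_ofPred_eq, add_sub_cancel_left] at h5
        have e2 : fderiv ℝ (f t) (u₀ + s • h) h - ∑ j ∈ Finset.range (k + 1),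
            ∑ m ∈ Finset.range (k + 1), x ^ j • c j m (s • h) h =
            (fderiv ℝ (f t) (u₀ + s • h) - ∑ j ∈ Finset.range (k + 1),
            ∑ m ∈ Finset.range (k + 1), x ^ j • c j m (s • h)) h := by
          simp only [_root_.sub_apply, _root_.sum_apply, _root_.smul_apply]
        rw [e2]
        refine (ContinuousLinearMap.le_opNorm _ _).trans ?_
        rw [norm_pow, Real.norm_eq_abs, abs_of_nonneg (by positivity)] at h5
        have h6 : ε * (|x| + ‖s • h‖) ^ k ≤ ε * (|x| + ‖h‖) ^ k := by gcongr
        rw [pow_succ, ← mul_assoc]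
        refine mul_le_mul (h5.trans h6) (le_add_of_nonneg_left (abs_nonneg _)) (norm_nonneg _)
          (by positivity)
      -- Only the remainder is estimated, by the mean value inequality in s, so no integral is
      -- needed and F need not be complete.
      have h7 := norm_image_sub_le_of_norm_deriv_le_segment_01' hφ hbound
      have hQ0 : Q x 0 = 0 := by simp [hQ]
      simp only [one_smul, zero_smul, add_zero, hQ0, sub_zero] at h7
      have e3 : u₀ + h = u := by rw [hh]; abel
      rw [e3] at h7
      simp only [mem_ofPred_eq]
      rw [norm_pow, Real.norm_eq_abs, abs_of_nonneg (by positivity), ← hx, ← hh]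
      convert h7 using 2
      abel
    refine (hpart1.add hpart2).congr_left fun q => ?_
    rw [hsum]
    abel

/-- Both derivatives of f have one order less. The u-derivative expands by induction; so does the
delta derivative, whose slice at u₀ is integrated by `Disc.taylorAt_succ`. The index p records the
truncations made by delta derivatives. -/
theorem JointC.jointTaylorAt (h : Disc T M a₁ a₀ e) (he : e ∈ T) (k : ℕ) :
    ∀ (p : ℕ) {F : Type} [NormedAddCommGroup F] [NormedSpace ℝ F] (f : ℝ → V → F), p + k ≤ M →
      JointC k (kappa^[p] T) f → ∀ u₀ : V, JointTaylorAt T e u₀ k f := by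
  induction k with
  | zero =>
    intro p F _ _ f hp hf u₀
    refine ⟨fun j m _ => if m = 0 then f e u₀ else 0, fun j m i w _ => taylorAt_const _,
      fun j m s v => ?_, ?_⟩
    · rcases m with _ | m <;> simp
    · have h1 : ContinuousWithinAt (fun q : ℝ × V => f q.1 q.2) (kappa^[p] T ×ˢ univ) (e, u₀) :=
        hf (e, u₀) ⟨h.mem he p, mem_univ _⟩
      have h2 := h1.tendsto
      rw [nhdsWithin_prod_eq, nhdsWithin_univ, h.nhds_eq he p] at h2
      have h3 := h2.sub_const (f e u₀)
      rw [sub_self] at h3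
      simpa using h3
  | succ k ih =>
    intro p F _ _ f hp hf u₀
    obtain ⟨hc, hd, hJ1, hΔ, hJ2⟩ := hf
    have hs : Disc (kappa^[p] T) (M - p) a₁ a₀ e := h.shift (by omega)
    have hnhds := h.nhds_eq he p
    have h1 := ih p _ (by omega) hJ1 u₀
    have h2 := ih (p + 1) (fun t u => deltaDeriv (kappa^[p] T) (fun s => f s u) t) (by omega)
      (by rw [Function.iterate_succ_apply']; exact hJ2) u₀
    have h3 : TaylorAt T e k (fun t => deltaDeriv (kappa^[p] T) (fun s => f s u₀) t) :=
      h2.taylorAt_comp (v := fun _ => u₀) he (taylorAt_const u₀)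
    have h4 : ContinuousWithinAt (fun s => f s u₀) (kappa^[p] T) e := by
      have h5 : ContinuousWithinAt (fun q : ℝ × V => f q.1 q.2) (kappa^[p] T ×ˢ univ) (e, u₀) :=
        hc (e, u₀) ⟨h.mem he p, mem_univ _⟩
      exact ContinuousWithinAt.comp (f := fun s : ℝ => (s, u₀)) (s := kappa^[p] T) h5
        (by fun_prop) fun s hs => ⟨hs, mem_univ _⟩
    rw [← taylorAt_congr_set hnhds] at h3
    have h6 := hs.taylorAt_succ (by omega) (h.mem he p) h4 h3
    have h7 : JointTaylorAt (kappa^[p] T) e u₀ (k + 1) f := by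
      refine jointTaylorAt_of_fderiv hd ?_ h6
      unfold JointTaylorAt TaylorAt at h1 ⊢
      rwa [hnhds]
    unfold JointTaylorAt TaylorAt at h7 ⊢
    rwa [hnhds] at h7

end Joint

end TimeScale

/-! ### Partial gradients of the Lagrangian. -/

namespace TimeScale

open Filter Topology Set Asymptotics

section Partial

variable {n r : ℕ} {L : ℝ → (Fin (r + 1) → EuclideanSpace ℝ (Fin n)) → ℝ} {t : ℝ}
  {u : Fin (r + 1) → EuclideanSpace ℝ (Fin n)}

theorem partialU_eq (h : DifferentiableAt ℝ (L t) u) (i : Fin (r + 1)) :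
    partialU L i t u = (InnerProductSpace.toDual ℝ (EuclideanSpace ℝ (Fin n))).symm
      ((fderiv ℝ (L t) u).comp
        (ContinuousLinearMap.single ℝ (fun _ : Fin (r + 1) => EuclideanSpace ℝ (Fin n)) i)) := by
  have h1 := hasFDerivAt_update (𝕜 := ℝ) u (i := i) (u i)
  have h2 : HasFDerivAt (fun v => L t (Function.update u i v)) ((fderiv ℝ (L t) u).comp
      (ContinuousLinearMap.pi (Pi.single i (ContinuousLinearMap.id ℝ _)))) (u i) := by
    refine HasFDerivAt.comp (u i) ?_ h1
    rw [Function.update_eq_self]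
    exact h.hasFDerivAt
  unfold partialU gradient
  rw [h2.fderiv]
  congr 2
  ext v j
  by_cases hj : j = i
  · subst hj; simp
  · simp [Pi.single_eq_of_ne hj]

theorem fderiv_eq_sum_inner_partialU (h : DifferentiableAt ℝ (L t) u)
    (w : Fin (r + 1) → EuclideanSpace ℝ (Fin n)) :
    fderiv ℝ (L t) u w = ∑ i, inner ℝ (partialU L i t u) (w i) := by
  conv_lhs => rw [← Finset.univ_sum_single w, map_sum]
  refine Finset.sum_congr rfl fun i _ => ?_
  rw [partialU_eq h, InnerProductSpace.toDual_symm_apply]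
  simp

/-- The linear map that takes the derivative of `L t` to its partial gradient. -/
theorem exists_clm_partialU (i : Fin (r + 1)) :
    ∃ A : ((Fin (r + 1) → EuclideanSpace ℝ (Fin n)) →L[ℝ] ℝ) →L[ℝ] EuclideanSpace ℝ (Fin n),
      ∀ (L : ℝ → (Fin (r + 1) → EuclideanSpace ℝ (Fin n)) → ℝ) (t : ℝ)
        (u : Fin (r + 1) → EuclideanSpace ℝ (Fin n)), DifferentiableAt ℝ (L t) u →
        partialU L i t u = A (fderiv ℝ (L t) u) := by
  let D : StrongDual ℝ (EuclideanSpace ℝ (Fin n)) →L[ℝ] EuclideanSpace ℝ (Fin n) :=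
    LinearMap.mkContinuous
      { toFun := fun φ => (InnerProductSpace.toDual ℝ (EuclideanSpace ℝ (Fin n))).symm φ
        map_add' := fun φ ψ => map_add _ φ ψ
        map_smul' := fun c φ => by simp } 1 fun φ => by simp
  refine ⟨D.comp ((ContinuousLinearMap.compL ℝ (EuclideanSpace ℝ (Fin n))
    (Fin (r + 1) → EuclideanSpace ℝ (Fin n)) ℝ).flip
    (ContinuousLinearMap.single ℝ (fun _ : Fin (r + 1) => EuclideanSpace ℝ (Fin n)) i)), ?_⟩
  intro L t u h
  rw [partialU_eq h]
  rfl

end Partial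

/-! ### Existence of antiderivatives on a discrete scale. -/

section Antiderivative

variable {S : Set ℝ} {N : ℕ} {a₁ a₀ e : ℝ} {f : ℝ → ℝ}

theorem Disc.le_of_lt_aff (h : Disc S N a₁ a₀ e) (hN : 0 < N) (hS : IsCompact S) {t x : ℝ}
    (ht : t ∈ kappa S) (hte : t ≠ e) (hx : x ∈ S) (hxt : x < aff a₁ a₀ t) : x ≤ t := by
  by_contra! h1
  have h2 := (h.jump 0 hN t ht hte).1
  simp only [Function.iterate_zero, id] at h2
  have h3 := sigma_le hS hx h1
  rw [h2] at h3
  exact absurd hxt (not_lt.2 h3)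

/-- Without the exceptional point S is compact and discrete, hence finite, and the antiderivative is
the sum of graininess times f over the earlier points. -/
theorem Disc.exists_antideriv_of_notMem (h : Disc S N a₁ a₀ e) (hN : 0 < N) (hS : IsCompact S)
    (he : e ∉ S) : ∃ G : ℝ → ℝ, ∀ t ∈ kappa S, HasDeltaDerivAt S G (f t) t := by
  have hfin : S.Finite := hS.finite (isDiscrete_iff_nhdsWithin.2 fun x hx => by
    obtain ⟨δ, hδ, H⟩ := h.isolated x hx fun hxe => he (hxe ▸ hx)
    refine le_antisymm ?_ (pure_le_nhdsWithin hx)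
    rw [le_pure_iff]
    refine Metric.mem_nhdsWithin_iff.2 ⟨δ, hδ, fun s hs => H s hs.2 ?_⟩
    rw [← Real.dist_eq]
    exact hs.1)
  refine ⟨fun t => ∑ x ∈ hfin.toFinset.filter (· < t), (aff a₁ a₀ x - x) * f x, fun t ht => ?_⟩
  have hte : t ≠ e := fun hte => he (hte ▸ kappa_subset ht)
  have hlt : t < aff a₁ a₀ t := (h.jump 0 hN t ht hte).2.1
  convert h.hasDeltaDerivAt hN ht hte using 1
  have e1 : hfin.toFinset.filter (· < aff a₁ a₀ t) = insert t (hfin.toFinset.filter (· < t)) := by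
    ext x
    simp only [Finset.mem_filter, Finite.mem_toFinset, Finset.mem_insert]
    constructor
    · rintro ⟨hx, hxt⟩
      rcases (h.le_of_lt_aff hN hS ht hte hx hxt).lt_or_eq with h1 | h1
      · exact Or.inr ⟨hx, h1⟩
      · exact Or.inl h1
    · rintro (rfl | ⟨hx, hxt⟩)
      · exact ⟨kappa_subset ht, hlt⟩
      · exact ⟨hx, hxt.trans hlt⟩
  rw [affDiff, e1, Finset.sum_insert (by simp), add_sub_cancel_right, smul_eq_mul,
    inv_mul_cancel_left₀ (sub_pos.2 hlt).ne']

theorem tendsto_contract_iterate {q : ℝ} (hq0 : 0 ≤ q) (hq1 : q < 1) (hS : ∀ j : ℕ, ∀ t ∈ S,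
    e + q ^ j * (t - e) ∈ S) {t : ℝ} (ht : t ∈ S) :
    Tendsto (fun j : ℕ => e + q ^ j * (t - e)) atTop (𝓝[S] e) := by
  refine tendsto_nhdsWithin_iff.2 ⟨?_, Eventually.of_forall fun j => hS j t ht⟩
  have := ((tendsto_pow_atTop_nhds_zero_of_lt_one hq0 hq1).mul_const (t - e)).const_add e
  simpa using this

theorem tendsto_tsum_contract {q : ℝ} (hq0 : 0 ≤ q) (hq1 : q < 1) (hS : ∀ j : ℕ, ∀ t ∈ S,
    e + q ^ j * (t - e) ∈ S) (hf : ContinuousWithinAt f S e) :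
    Tendsto (fun t => ∑' j : ℕ, q ^ j * f (e + q ^ j * (t - e))) (𝓝[S] e)
      (𝓝 ((1 - q)⁻¹ * f e)) := by
  have hgeo := hasSum_geometric_of_lt_one hq0 hq1
  have h1q : 0 < 1 - q := by linarith
  rw [Metric.tendsto_nhds]
  intro ε hε
  obtain ⟨δ, hδ, H⟩ := Metric.continuousWithinAt_iff.1 hf (ε * (1 - q) / 2) (by positivity)
  refine Metric.mem_nhdsWithin_iff.2 ⟨δ, hδ, fun t ht => ?_⟩
  have hsum : Summable fun j : ℕ => q ^ j * f (e + q ^ j * (t - e)) := by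
    refine summable_of_isBigO_nat hgeo.summable ?_
    have h1 : (fun j : ℕ => f (e + q ^ j * (t - e))) =O[atTop] fun _ => (1 : ℝ) :=
      (hf.tendsto.comp (tendsto_contract_iterate hq0 hq1 hS ht.2)).isBigO_one ℝ
    simpa using (isBigO_refl (fun j : ℕ => q ^ j) atTop).mul h1
  have hsum2 : HasSum (fun j : ℕ => q ^ j * f e) ((1 - q)⁻¹ * f e) := hgeo.mul_right _
  have hb : ‖∑' j : ℕ, (q ^ j * f (e + q ^ j * (t - e)) - q ^ j * f e)‖ ≤
      (1 - q)⁻¹ * (ε * (1 - q) / 2) := by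
    refine tsum_of_norm_bounded (hgeo.mul_right _) fun j => ?_
    rw [← mul_sub, norm_mul, norm_pow, Real.norm_eq_abs, abs_of_nonneg hq0]
    refine mul_le_mul_of_nonneg_left (H (hS j t ht.2) ?_).le (by positivity)
    have h1 := ht.1
    rw [Metric.mem_ball, Real.dist_eq] at h1
    rw [Real.dist_eq, add_sub_cancel_left, abs_mul, abs_of_nonneg (pow_nonneg hq0 j)]
    exact (mul_le_of_le_one_left (abs_nonneg _) (pow_le_one₀ hq0 hq1.le)).trans_lt h1
  rw [hsum.tsum_sub hsum2.summable, hsum2.tsum_eq] at hb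
  show dist _ _ < ε
  rw [dist_eq_norm]
  refine hb.trans_lt ?_
  field_simp
  linarith

/-- `deltaIntegral` is 0 by default when no antiderivative exists, so one must be built. If e ∈ S it
is Jackson's q-integral based at e, namely (t - e) times a multiple of ∑ q^j f(e + q^j(t - e)). If σ
expands, the sum starts at ρ(t) instead of t. -/
theorem Disc.exists_antideriv (h : Disc S N a₁ a₀ e) (hN : 0 < N) (hS : IsCompact S)
    (hf : e ∈ S → ContinuousWithinAt f S e) :
    ∃ G : ℝ → ℝ, ∀ t ∈ kappa S, HasDeltaDerivAt S G (f t) t := by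
  by_cases he : e ∈ S
  swap
  · exact h.exists_antideriv_of_notMem hN hS he
  have hpos := h.pos
  obtain ⟨hq0, hq1⟩ := h.contract_lt_one he
  set q := min a₁ a₁⁻¹ with hq
  have hinv : ∀ j : ℕ, ∀ t ∈ S, e + q ^ j * (t - e) ∈ S := by
    intro j t ht
    induction j with
    | zero => simpa using ht
    | succ j ih =>
      have h1 : e + min a₁ a₁⁻¹ * (e + q ^ j * (t - e) - e) ∈ S := h.contract he 0 _ ih
      convert h1 using 1
      rw [add_sub_cancel_left, ← hq]
      ring
  set H : ℝ → ℝ := fun t => ∑' j : ℕ, q ^ j * f (e + q ^ j * (t - e)) with hH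
  have hlim : Tendsto H (𝓝[S] e) (𝓝 ((1 - q)⁻¹ * f e)) :=
    tendsto_tsum_contract hq0.le hq1 hinv (hf he)
  have hrec : ∀ t ∈ S, H t = f t + q * H (e + q * (t - e)) := by
    intro t ht
    have hsum : Summable fun j : ℕ => q ^ j * f (e + q ^ j * (t - e)) := by
      refine summable_of_isBigO_nat (hasSum_geometric_of_lt_one hq0.le hq1).summable ?_
      have h1 : (fun j : ℕ => f (e + q ^ j * (t - e))) =O[atTop] fun _ => (1 : ℝ) :=
        ((hf he).tendsto.comp (tendsto_contract_iterate hq0.le hq1 hinv ht)).isBigO_one ℝ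
      simpa using (isBigO_refl (fun j : ℕ => q ^ j) atTop).mul h1
    simp only [hH]
    rw [hsum.tsum_eq_zero_add, ← tsum_mul_left]
    congr 1
    · simp
    · refine tsum_congr fun j => ?_
      rw [add_sub_cancel_left, pow_succ]
      ring_nf
  have hder : ∀ K : ℝ → ℝ, Tendsto K (𝓝[S] e) (𝓝 (f e)) →
      HasDeltaDerivAt S (fun t => (t - e) * K t) (f e) e := by
    intro K hK
    rw [hasDeltaDerivAt_iff_of_sigma_eq (show sigma S e = e from h.sigma_eq he 0),
      hasDerivWithinAt_iff_isLittleO]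
    have h1 : (fun t => K t - f e) =o[𝓝[S] e] fun _ => (1 : ℝ) := by
      rw [isLittleO_one_iff]
      simpa using hK.sub_const (f e)
    have h2 := (isBigO_refl (fun t : ℝ => t - e) (𝓝[S] e)).mul_isLittleO h1
    refine (h2.congr_left fun t => ?_).congr_right fun t => mul_one _
    rw [sub_self, zero_mul, sub_zero, smul_eq_mul]
    ring
  -- Off e, the equation G^Δ = f for G = (t - e)K is this q-difference equation for K, which `hrec`
  -- will solve.
  have hsc : ∀ K : ℝ → ℝ, (∀ t ∈ kappa S, t ≠ e → a₁ * K (aff a₁ a₀ t) - K t = (a₁ - 1) * f t) →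
      ∀ t ∈ kappa S, t ≠ e → HasDeltaDerivAt S (fun t => (t - e) * K t) (f t) t := by
    intro K hK t ht hte
    convert h.hasDeltaDerivAt hN ht hte using 1
    have hlt : t < aff a₁ a₀ t := (h.jump 0 hN t ht hte).2.1
    have e1 := h.aff_sub he t
    have e2 : aff a₁ a₀ t - t = (a₁ - 1) * (t - e) := by linarith
    have e3 : (a₁ - 1) * (t - e) ≠ 0 := e2 ▸ (sub_pos.2 hlt).ne'
    have e4 : (a₁ * (t - e)) * K (aff a₁ a₀ t) - (t - e) * K t = ((a₁ - 1) * (t - e)) * f t := by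
      linear_combination (t - e) * hK t ht hte
    rw [affDiff, e2, e1, e4, smul_eq_mul, inv_mul_cancel_left₀ e3]
  have hne := h.ne_one he
  rcases le_total a₁ a₁⁻¹ with hle | hle
  · have hqa : q = a₁ := min_eq_left hle
    have h1 : 1 - a₁ ≠ 0 := sub_ne_zero.2 hne.symm
    refine ⟨fun t => (t - e) * ((1 - a₁) * H t), fun t ht => ?_⟩
    by_cases hte : t = e
    · subst hte
      refine hder _ ?_
      have := hlim.const_mul (1 - a₁)
      rwa [hqa, mul_inv_cancel_left₀ h1] at this
    · refine hsc _ (fun s hs hse => ?_) t ht hte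
      have e1 : e + q * (s - e) = aff a₁ a₀ s := by
        have := h.aff_sub he s
        rw [hqa]; linarith
      have := hrec s (kappa_subset hs)
      rw [e1, hqa] at this
      rw [this]; ring
  · have hqa : q = a₁⁻¹ := min_eq_right hle
    have h1 : a₁ - 1 ≠ 0 := sub_ne_zero.2 hne
    have h2 : a₁⁻¹ * a₁ = 1 := inv_mul_cancel₀ hpos.ne'
    refine ⟨fun t => (t - e) * ((a₁ - 1) * a₁⁻¹ * H (e + q * (t - e))), fun t ht => ?_⟩
    by_cases hte : t = e
    · subst hte
      refine hder (fun s => (a₁ - 1) * a₁⁻¹ * H (t + q * (s - t))) ?_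
      have := (hlim.comp (h.tendsto_contract he)).const_mul ((a₁ - 1) * a₁⁻¹)
      have e1 : (a₁ - 1) * a₁⁻¹ * ((1 - q)⁻¹ * f t) = f t := by
        have : 1 - a₁⁻¹ = (a₁ - 1) * a₁⁻¹ := by rw [sub_mul, mul_inv_cancel₀ hpos.ne']; ring
        rw [hqa, this, mul_inv_cancel_left₀ (mul_ne_zero h1 (inv_ne_zero hpos.ne'))]
      rwa [e1] at this
    · refine hsc (fun s => (a₁ - 1) * a₁⁻¹ * H (e + q * (s - e))) (fun s hs hse => ?_) t ht hte
      have e1 : e + q * (aff a₁ a₀ s - e) = s := by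
        rw [h.aff_sub he, hqa, inv_mul_cancel_left₀ hpos.ne']; ring
      have := hrec s (kappa_subset hs)
      rw [hqa] at this e1
      simp only [hqa, e1, this]
      linear_combination ((a₁ - 1) * (f s + a₁⁻¹ * H (e + a₁⁻¹ * (s - e)))) * h2

/-- A step just after p, of height graininess times c, is an antiderivative of c at the single point
p. Changing an integrand at p therefore changes the integral by that height. -/
theorem Disc.hasDeltaDerivAt_step (h : Disc S N a₁ a₀ e) (hN : 0 < N) (hS : IsCompact S) {p : ℝ}
    (hp : p ∈ S) (hpe : p ≠ e) (c : ℝ) {t : ℝ} (ht : t ∈ kappa S) :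
    HasDeltaDerivAt S (fun s => if p < s then (aff a₁ a₀ p - p) * c else 0)
      (spike p t * c) t := by
  by_cases hte : t = e
  · subst hte
    have he := kappa_subset ht
    have hσ : sigma S t = t := h.sigma_eq he 0
    rw [spike_of_ne (Ne.symm hpe), zero_mul]
    refine (HasDeltaDerivAt.congr (g := fun _ => if p < t then (aff a₁ a₀ p - p) * c else 0)
      ?_ ?_).2 ?_
    · rcases lt_or_gt_of_ne hpe with h1 | h1
      · filter_upwards [mem_nhdsWithin_of_mem_nhds (Ioi_mem_nhds h1)] with s hs
        rw [if_pos (show p < s from hs), if_pos h1]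
      · filter_upwards [mem_nhdsWithin_of_mem_nhds (Iio_mem_nhds h1)] with s hs
        rw [if_neg (not_lt.2 (le_of_lt hs)), if_neg (not_lt.2 h1.le)]
    · rw [hσ]
    · rw [hasDeltaDerivAt_iff_of_sigma_eq hσ]
      exact hasDerivWithinAt_const _ _ _
  · convert h.hasDeltaDerivAt hN ht hte using 1
    have hlt : t < aff a₁ a₀ t := (h.jump 0 hN t ht hte).2.1
    rw [affDiff, smul_eq_mul]
    rcases lt_trichotomy p t with h1 | h1 | h1
    · rw [if_pos (h1.trans hlt), if_pos h1, spike_of_ne h1.ne', sub_self, zero_mul, mul_zero]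
    · subst h1
      rw [if_pos hlt, if_neg (lt_irrefl p), sub_zero,
        inv_mul_cancel_left₀ (sub_pos.2 hlt).ne']
      simp [spike]
    · have h2 : ¬ p < aff a₁ a₀ t := fun h3 =>
        absurd h1 (not_lt.2 (h.le_of_lt_aff hN hS ht hte hp h3))
      rw [if_neg h2, if_neg (not_lt.2 h1.le), spike_of_ne h1.ne, sub_self, zero_mul, mul_zero]

theorem HasDeltaDerivAt.add {f g : ℝ → ℝ} {f' g' t : ℝ} (hf : HasDeltaDerivAt S f f' t)
    (hg : HasDeltaDerivAt S g g' t) : HasDeltaDerivAt S (fun s => f s + g s) (f' + g') t := by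
  have h0 : HasDeltaDerivAt S (fun _ => (0 : ℝ)) 0 t := fun ε hε =>
    ⟨1, one_pos, fun s _ _ => by simp; positivity⟩
  simpa using hf.sub (h0.sub hg)

theorem HasDeltaDerivAt.sum {ι : Type} (s : Finset ι) {f : ι → ℝ → ℝ} {f' : ι → ℝ} {t : ℝ}
    (hf : ∀ i ∈ s, HasDeltaDerivAt S (f i) (f' i) t) :
    HasDeltaDerivAt S (fun x => ∑ i ∈ s, f i x) (∑ i ∈ s, f' i) t := by
  classical
  induction s using Finset.induction_on with
  | empty => exact fun ε hε => ⟨1, one_pos, fun s _ _ => by simp; positivity⟩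
  | insert a s ha ih =>
    simp only [Finset.sum_insert ha]
    exact (hf a (Finset.mem_insert_self a s)).add
      (ih fun i hi => hf i (Finset.mem_insert_of_mem hi))

end Antiderivative

end TimeScale

/-! ### Jets of y and their response to a change at one point. -/

namespace TimeScale

open Filter Topology Set Asymptotics

section Jet

variable {F : Type} [NormedAddCommGroup F] [NormedSpace ℝ F] {n r : ℕ} {T : Set ℝ} {N : ℕ}
  {a₁ a₀ e : ℝ}

theorem Disc.aff_iterate_mem (h : Disc T N a₁ a₀ e) {l m : ℕ} (hN : l + m ≤ N) {t : ℝ}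
    (ht : t ∈ kappa^[l + m] T) (hte : t ≠ e) :
    (aff a₁ a₀)^[l] t ∈ kappa^[m] T ∧ (aff a₁ a₀)^[l] t ≠ e := by
  induction l generalizing t with
  | zero => rw [zero_add] at ht; exact ⟨ht, hte⟩
  | succ l ih =>
    have h1 := h.jump (l + m) (by omega) t (by convert ht using 2; omega) hte
    rw [Function.iterate_succ_apply]
    exact ih (by omega) h1.2.2.1 h1.2.2.2

theorem Disc.sigma_iterate (h : Disc T N a₁ a₀ e) {l : ℕ} (hl : l ≤ N) {t : ℝ}
    (ht : t ∈ kappa^[l] T) (hte : t ≠ e) : (sigma T)^[l] t = (aff a₁ a₀)^[l] t := by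
  induction l generalizing t with
  | zero => rfl
  | succ l ih =>
    have h1 := h.jump l (by omega) t ht hte
    have h2 : sigma T t = aff a₁ a₀ t :=
      (h.jump 0 (by omega) t (kappa_iterate_anti (by omega) ht) hte).1
    rw [Function.iterate_succ_apply, Function.iterate_succ_apply, h2]
    exact ih (by omega) h1.2.2.1 h1.2.2.2

theorem Disc.deltaIter_comp_sigma (h : Disc T N a₁ a₀ e) {i l : ℕ} (hl : i + l ≤ N) {t : ℝ}
    (ht : t ∈ kappa^[i + l] T) (hte : t ≠ e) (y : ℝ → F) :
    deltaIter T (fun s => y ((sigma T)^[l] s)) i t =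
      (affDiff a₁ a₀)^[i] (fun s => y ((aff a₁ a₀)^[l] s)) t := by
  rw [h.deltaIter_of_ne (by omega) (kappa_iterate_anti (by omega) ht) hte]
  refine affDiff_iterate_congr _ _ fun m hm => ?_
  have h1 := h.aff_iterate_mem (l := m) (m := i - m + l) (by omega)
    (by convert ht using 2; omega) hte
  rw [h.sigma_iterate (by omega) (kappa_iterate_anti (by omega) h1.1) h1.2]

theorem Disc.jet_of_ne (h : Disc T N a₁ a₀ e) (hr : r ≤ N) {t : ℝ} (ht : t ∈ kappa^[r] T)
    (hte : t ≠ e) (y : ℝ → EuclideanSpace ℝ (Fin n)) (i : Fin (r + 1)) :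
    jet T r y t i = (affDiff a₁ a₀)^[(i : ℕ)] (fun s => y ((aff a₁ a₀)^[r - (i : ℕ)] s)) t := by
  have hi := i.is_lt
  exact h.deltaIter_comp_sigma (by omega) (by convert ht using 2; omega) hte y

theorem Disc.eventually_sigma (h : Disc T N a₁ a₀ e) (hN : 0 < N) (he : e ∈ T) :
    aff a₁ a₀ =ᶠ[𝓝[T] e] sigma T := by
  filter_upwards [h.eventually_mem_kappa he] with t ht
  by_cases hte : t = e
  · rw [hte, show sigma T e = e from h.sigma_eq he 0]
    exact h.fixed he
  · exact (h.jump 0 hN t ht hte).1.symm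

theorem Disc.tendsto_sigma_iterate (h : Disc T N a₁ a₀ e) (hN : 0 < N) (he : e ∈ T) (l : ℕ) :
    Tendsto ((sigma T)^[l]) (𝓝[T] e) (𝓝[T] e) :=
  ((h.tendsto_aff hN he).congr' (h.eventually_sigma hN he)).iterate l

/-- Composition with σ multiplies the j-th coefficient by a₁^j. -/
theorem Disc.taylorAt_comp_sigma_iterate (h : Disc T N a₁ a₀ e) (hN : 0 < N) (he : e ∈ T)
    {k : ℕ} {f : ℝ → F} (hf : TaylorAt T e k f) (l : ℕ) :
    TaylorAt T e k fun t => f ((sigma T)^[l] t) := by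
  induction l with
  | zero => exact hf
  | succ l ih =>
    obtain ⟨c, hc⟩ := ih
    have h1 : TaylorAt T e k fun t => f ((sigma T)^[l] (aff a₁ a₀ t)) := by
      refine ⟨fun j => a₁ ^ j • c j, ?_⟩
      have h2 := hc.comp_tendsto (h.tendsto_aff hN he)
      simp only [Function.comp_def, h.aff_sub he, mul_pow] at h2
      refine (h2.trans_isBigO ((isBigO_refl _ _).const_mul_left _)).congr_left fun t => ?_
      simp only [smul_smul]
      congr 2
      funext j
      rw [mul_comm]
    refine h1.congr ?_
    filter_upwards [h.eventually_sigma hN he] with t ht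
    rw [Function.iterate_succ_apply, ht]

theorem Disc.taylorAt_jet (h : Disc T N a₁ a₀ e) (hr : 1 ≤ r) (hN : r ≤ N) (he : e ∈ T)
    {y : ℝ → EuclideanSpace ℝ (Fin n)} (hy : TaylorAt T e (2 * r) y) :
    TaylorAt T e r (jet T r y) := by
  have h1 : ∀ i : Fin (r + 1), TaylorAt T e r fun t => jet T r y t i := fun i => by
    have hi := i.is_lt
    refine h.taylorAt_deltaIter he (by omega) ?_
    exact (h.taylorAt_comp_sigma_iterate (by omega) he hy _).of_le (by omega)
  refine (taylorAt_sum Finset.univ fun i _ => (h1 i).map (ContinuousLinearMap.single ℝ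
    (fun _ : Fin (r + 1) => EuclideanSpace ℝ (Fin n)) i)).congr
    (Eventually.of_forall fun t => ?_)
  simpa using Finset.univ_sum_single (jet T r y t)

theorem Disc.infinite (h : Disc T N a₁ a₀ e) (he : e ∈ T) : T.Infinite := by
  intro hfin
  have h1 := h.neBot he
  rw [← mem_closure_iff_nhdsWithin_neBot] at h1
  have h2 : IsClosed (T \ {e}) := (hfin.subset sdiff_subset).isClosed
  rw [h2.closure_eq] at h1
  exact h1.2 rfl

variable {L : ℝ → (Fin (r + 1) → EuclideanSpace ℝ (Fin n)) → ℝ}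
  {y : ℝ → EuclideanSpace ℝ (Fin n)}

/-- T is infinite because it accumulates at e, so L has joint class r + 1 and its u-derivative joint
class r. The jet takes at most r derivatives of a function of order 2r and keeps order r. -/
theorem Disc.taylorAt_partialU (h : Disc T N a₁ a₀ e) (hr : 1 ≤ r) (hN : r ≤ N) (he : e ∈ T)
    (hL : IsLagrangian T L) (hy : TaylorAt T e (2 * r) y) (i : Fin (r + 1)) :
    TaylorAt T e r fun t => partialU L i t (jet T r y t) := by
  obtain ⟨A, hA⟩ := exists_clm_partialU (n := n) i
  have hJ : JointC r T (fun t u => fderiv ℝ (L t) u) := (hL.2.2.2 (h.infinite he)).2.2.1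
  have h1 := JointC.jointTaylorAt h he r 0 _ (by omega) hJ (jet T r y e)
  have h2 := h1.taylorAt_comp he (h.taylorAt_jet hr hN he hy)
  refine (h2.map A).congr ?_
  filter_upwards [self_mem_nhdsWithin] with t ht
  rw [hA L t _ (hL.2.1 t ht _)]

theorem Disc.taylorAt_lagrangian (h : Disc T N a₁ a₀ e) (hr : 1 ≤ r) (hN : r ≤ N) (he : e ∈ T)
    (hL : IsLagrangian T L) (hy : TaylorAt T e (2 * r) y) :
    TaylorAt T e 0 fun t => L t (jet T r y t) :=
  (JointC.jointTaylorAt h he 0 0 _ (by omega) hL.1 (jet T r y e)).taylorAt_comp he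
    ((h.taylorAt_jet hr hN he hy).of_le (Nat.zero_le r))

theorem Disc.affDiff_spike_self (h : Disc T N a₁ a₀ e) (he : e ∈ T) {p : ℝ} (hp : p ≠ e)
    (j l : ℕ) : (affDiff a₁ a₀)^[j] (fun s => spike p ((aff a₁ a₀)^[l] s)) e = 0 := by
  rw [← affDiff_iterate_zero (F := ℝ) (a₁ := a₁) (a₀ := a₀) j e]
  refine affDiff_iterate_congr _ _ fun m _ => ?_
  have hfix : ∀ k, (aff a₁ a₀)^[k] e = e := fun k => Function.iterate_fixed (h.fixed he) k
  rw [hfix, hfix, spike_of_ne hp.symm]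

/-- If one of the iterates of t that are read equals σ^r(t₀), injectivity of the affine map places t
itself among t₀, …, σ^r(t₀). -/
theorem affDiff_spike_eq_zero (ha₁ : 0 < a₁) {t₀ t : ℝ} {i : ℕ} (hi : i ≤ r)
    (ht : ∀ k ≤ r, t ≠ (aff a₁ a₀)^[k] t₀) :
    (affDiff a₁ a₀)^[i]
      (fun s => spike ((aff a₁ a₀)^[r] t₀) ((aff a₁ a₀)^[r - i] s)) t = 0 := by
  rw [← affDiff_iterate_zero (F := ℝ) (a₁ := a₁) (a₀ := a₀) i t]
  refine affDiff_iterate_congr _ _ fun m hm => spike_of_ne fun heq => ?_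
  have hinj : Function.Injective (aff a₁ a₀) := fun x z hxz => by
    unfold aff at hxz
    exact mul_left_cancel₀ ha₁.ne' (by linarith)
  rw [← Function.iterate_add_apply] at heq
  obtain ⟨l, hl⟩ := Nat.exists_eq_add_of_le (show r - i + m ≤ r by omega)
  conv_rhs at heq => rw [hl]
  rw [Function.iterate_add_apply (aff a₁ a₀) (r - i + m) l] at heq
  exact ht l (by omega) (hinj.iterate _ heq)

theorem Disc.eventually_spike (h : Disc T N a₁ a₀ e) (hN : 0 < N) (he : e ∈ T) {p : ℝ}
    (hp : p ≠ e) (l : ℕ) : ∀ᶠ t in 𝓝[T] e, spike p ((sigma T)^[l] t) = 0 := by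
  have h1 : ∀ᶠ t in 𝓝[T] e, t ≠ p :=
    mem_nhdsWithin_of_mem_nhds (isOpen_compl_singleton.mem_nhds hp.symm)
  filter_upwards [(h.tendsto_sigma_iterate hN he l).eventually h1] with t ht
  exact spike_of_ne ht

theorem Disc.jet_add_spike (h : Disc T N a₁ a₀ e) (hr : 1 ≤ r) (hN : r ≤ N) {p : ℝ} (hp : p ≠ e)
    (y : ℝ → EuclideanSpace ℝ (Fin n)) (v : EuclideanSpace ℝ (Fin n)) (c : ℝ) {t : ℝ}
    (ht : t ∈ kappa^[r] T) :
    jet T r (fun s => y s + (c * spike p s) • v) t = jet T r y t + c • fun i : Fin (r + 1) =>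
      (affDiff a₁ a₀)^[(i : ℕ)] (fun s => spike p ((aff a₁ a₀)^[r - (i : ℕ)] s)) t • v := by
  funext i
  have hi := i.is_lt
  simp only [Pi.add_apply, Pi.smul_apply]
  by_cases hte : t = e
  · subst hte
    have he : t ∈ T := kappa_iterate_anti (Nat.zero_le r) ht
    rw [h.affDiff_spike_self he hp, zero_smul, smul_zero, add_zero]
    refine (h.deltaIter_congr he (by omega) ?_).self_of_nhdsWithin he
    filter_upwards [h.eventually_spike (by omega) he hp (r - i)] with s hs
    rw [hs, mul_zero, zero_smul, add_zero]
  · rw [h.jet_of_ne hN ht hte, h.jet_of_ne hN ht hte, affDiff_iterate_add]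
    congr 1
    have := map_affDiff_iterate (a₁ := a₁) (a₀ := a₀)
      ((ContinuousLinearMap.id ℝ ℝ).smulRight (c • v))
      (fun s => spike p ((aff a₁ a₀)^[r - (i : ℕ)] s)) i t
    simp only [ContinuousLinearMap.smulRight_apply, ContinuousLinearMap.id_apply, smul_smul] at this
    rw [smul_smul, mul_comm c, this]
    simp only [mul_comm c]

theorem Disc.jet_zero (h : Disc T N a₁ a₀ e) (hN : r ≤ N) {t : ℝ} (ht : t ∈ kappa^[r] T) :
    jet T r (fun _ => (0 : EuclideanSpace ℝ (Fin n))) t = 0 := by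
  funext i
  have hi := i.is_lt
  by_cases hte : t = e
  · subst hte
    have he : t ∈ T := kappa_iterate_anti (Nat.zero_le r) ht
    exact (h.deltaIter_zero he (by omega)).self_of_nhdsWithin he
  · rw [h.jet_of_ne hN ht hte]
    exact affDiff_iterate_zero _ _

/-- The jet of a spike lives on r + 1 orbit points, so its norm is finite and scales with |c|; small
c stay in the neighbourhood of weak minimality. -/
theorem Disc.normR_spike_le (h : Disc T N a₁ a₀ e) (hr : 1 ≤ r) (hN : r ≤ N) {t₀ : ℝ}
    (hp : (aff a₁ a₀)^[r] t₀ ≠ e) (v : EuclideanSpace ℝ (Fin n)) :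
    ∃ C : ℝ, 0 ≤ C ∧ ∀ c : ℝ,
      normR T r (fun t => (c * spike ((aff a₁ a₀)^[r] t₀) t) • v) ≤ ENNReal.ofReal (|c| * C) := by
  set d : ℕ → ℝ → ℝ := fun i => (affDiff a₁ a₀)^[i]
    (fun s => spike ((aff a₁ a₀)^[r] t₀) ((aff a₁ a₀)^[r - i] s)) with hd
  set D : Fin (r + 1) → ℝ := fun i => ∑ k ∈ Finset.range (r + 1),
    |d i ((aff a₁ a₀)^[k] t₀)| * ‖v‖ with hD
  have hD0 : ∀ i, 0 ≤ D i := fun i => Finset.sum_nonneg fun k _ => by positivity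
  refine ⟨∑ i, D i, Finset.sum_nonneg fun i _ => hD0 i, fun c => ?_⟩
  rw [Finset.mul_sum, ENNReal.ofReal_sum_of_nonneg fun i _ => mul_nonneg (abs_nonneg c) (hD0 i)]
  refine Finset.sum_le_sum fun i _ => iSup₂_le fun t ht => ?_
  have hi := i.is_lt
  have h1 := h.jet_add_spike hr hN hp (fun _ => 0) v c ht
  rw [h.jet_zero hN ht, zero_add] at h1
  simp only [zero_add] at h1
  rw [h1, ← ofReal_norm]
  refine ENNReal.ofReal_le_ofReal ?_
  simp only [Pi.smul_apply, norm_smul, Real.norm_eq_abs]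
  refine mul_le_mul_of_nonneg_left ?_ (abs_nonneg c)
  by_cases hk : ∃ k ≤ r, t = (aff a₁ a₀)^[k] t₀
  · obtain ⟨k, hk, rfl⟩ := hk
    exact Finset.single_le_sum (f := fun k => |d i ((aff a₁ a₀)^[k] t₀)| * ‖v‖)
      (fun k _ => by positivity) (Finset.mem_range.2 (Nat.lt_succ_of_le hk))
  · push Not at hk
    rw [affDiff_spike_eq_zero h.pos (by omega) hk, abs_zero, zero_mul]
    exact hD0 i

theorem Disc.deltaIntegral_add_spikes {S : Set ℝ} {a b : ℝ} (h : Disc S N a₁ a₀ e) (hN : 0 < N)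
    (hS : IsCompact S) (ha : IsLeast S a) (hb : IsGreatest S b) {f g : ℝ → ℝ}
    (hf : e ∈ S → ContinuousWithinAt f S e) (K : ℕ) (x c : ℕ → ℝ)
    (hx : ∀ k < K, x k ∈ kappa S ∧ x k ≠ e)
    (hg : ∀ t ∈ kappa S, g t = f t + ∑ k ∈ Finset.range K, spike (x k) t * c k) :
    deltaIntegral S g a b = deltaIntegral S f a b +
      ∑ k ∈ Finset.range K, (aff a₁ a₀ (x k) - x k) * c k := by
  obtain ⟨G, hG⟩ := h.exists_antideriv hN hS hf
  have hG' : ∀ t ∈ kappa S, HasDeltaDerivAt S (fun s => G s + ∑ k ∈ Finset.range K,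
      if x k < s then (aff a₁ a₀ (x k) - x k) * c k else 0) (g t) t := by
    intro t ht
    rw [hg t ht]
    refine (hG t ht).add (HasDeltaDerivAt.sum _ fun k hk => ?_)
    have := hx k (Finset.mem_range.1 hk)
    exact h.hasDeltaDerivAt_step hN hS (kappa_subset this.1) this.2 (c k) ht
  rw [deltaIntegral_eq hS ha hb hG, deltaIntegral_eq hS ha hb hG']
  have h1 : ∑ k ∈ Finset.range K, (if x k < b then (aff a₁ a₀ (x k) - x k) * c k else 0) =
      ∑ k ∈ Finset.range K, (aff a₁ a₀ (x k) - x k) * c k := by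
    refine Finset.sum_congr rfl fun k hk => ?_
    obtain ⟨h2, h3⟩ := hx k (Finset.mem_range.1 hk)
    obtain ⟨-, h4, h5, -⟩ := h.jump 0 hN (x k) h2 h3
    rw [if_pos (h4.trans_le (hb.2 h5))]
  have h2 : ∑ k ∈ Finset.range K, (if x k < a then (aff a₁ a₀ (x k) - x k) * c k else 0) = 0 := by
    refine Finset.sum_eq_zero fun k hk => ?_
    rw [if_neg (not_lt.2 (ha.2 (kappa_subset (hx k (Finset.mem_range.1 hk)).1)))]
  rw [h1, h2]
  ring

end Jet

end TimeScale

/-! ### The Euler–Lagrange equation on a discrete scale. -/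

namespace TimeScale

open Filter Topology Set Asymptotics

section EulerLagrange

variable {n r : ℕ} {T : Set ℝ} {a₁ a₀ e a b : ℝ}
  {L : ℝ → (Fin (r + 1) → EuclideanSpace ℝ (Fin n)) → ℝ}
  {α β : Fin r → EuclideanSpace ℝ (Fin n)} {y : ℝ → EuclideanSpace ℝ (Fin n)}

theorem Disc.le_aff_iterate {N : ℕ} (h : Disc T N a₁ a₀ e) {l m : ℕ} (hl : l ≤ N) (hm : m ≤ l)
    {t : ℝ} (ht : t ∈ kappa^[l] T) (hte : t ≠ e) : t ≤ (aff a₁ a₀)^[m] t := by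
  rcases m with _ | m
  · exact le_refl t
  · have h1 := h.jump 0 (by omega) t (kappa_iterate_anti (by omega) ht) hte
    exact (strictMono_aff_iterate h.pos h1.2.1).monotone (Nat.zero_le (m + 1))

theorem Disc.deltaIter_add_spike_eq {N : ℕ} (h : Disc T N a₁ a₀ e) {j : ℕ} (hj : j ≤ N)
    (hN : 0 < N) {p t : ℝ} (hp : p ≠ e) (ht : t ∈ kappa^[j] T)
    (hne : t ≠ e → ∀ m ≤ j, (aff a₁ a₀)^[m] t ≠ p) (v : EuclideanSpace ℝ (Fin n)) (c : ℝ) :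
    deltaIter T (fun s => y s + (c * spike p s) • v) j t = deltaIter T y j t := by
  by_cases hte : t = e
  · subst hte
    have he : t ∈ T := kappa_iterate_anti (Nat.zero_le j) ht
    refine (h.deltaIter_congr he hj ?_).self_of_nhdsWithin he
    filter_upwards [h.eventually_spike hN he hp 0] with s hs
    rw [Function.iterate_zero, id] at hs
    rw [hs, mul_zero, zero_smul, add_zero]
  · rw [h.deltaIter_of_ne hj ht hte, h.deltaIter_of_ne hj ht hte]
    refine affDiff_iterate_congr _ _ fun m hm => ?_
    rw [spike_of_ne (hne hte m hm), mul_zero, zero_smul, add_zero]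

/-- Derivatives of order j < r at a read points σ^m(a) ≤ σ^m(t₀) < σ^r(t₀). Those at ρ^{r-1}(b) read
points not below ρ^{r-1}(b), which exceeds σ^r(t₀) because t₀ ∈ T^{κ^{2r}}. Near e the function does
not change. -/
theorem Disc.isAdmissible_add_spike (hr : 1 ≤ r) (hT : IsCompact T) (ha : IsLeast T a)
    (hb : IsGreatest T b) (h : Disc T (2 * r) a₁ a₀ e) (hy : IsAdmissible T a b α β y) {t₀ : ℝ}
    (ht₀ : t₀ ∈ kappa^[2 * r] T) (hte : t₀ ≠ e) (v : EuclideanSpace ℝ (Fin n)) (c : ℝ) :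
    IsAdmissible T a b α β fun s => y s + (c * spike ((aff a₁ a₀)^[r] t₀) s) • v := by
  obtain ⟨hpT, hp⟩ := h.aff_iterate_mem (l := r) (m := r) (by omega)
    (by convert ht₀ using 2; omega) hte
  have hlt : t₀ < aff a₁ a₀ t₀ :=
    (h.jump 0 (by omega) t₀ (kappa_iterate_anti (by omega) ht₀) hte).2.1
  have hmono := strictMono_aff_iterate h.pos hlt
  refine ⟨(h.isC_iff le_rfl).2 fun he => ?_, fun j => ?_⟩
  · refine ((h.isC_iff le_rfl).1 hy.1 he).congr ?_
    filter_upwards [h.eventually_spike (by omega) he hp 0] with s hs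
    rw [Function.iterate_zero, id] at hs
    rw [hs, mul_zero, zero_smul, add_zero]
  · have hj := j.is_lt
    have hg := isGreatest_kappa_iterate hT hb (r - 1)
    constructor
    · rw [← (hy.2 j).1]
      refine h.deltaIter_add_spike_eq (by omega) (by omega) hp
        (isLeast_kappa_iterate hT ha hb j).1 (fun _ m hm => ?_) v c
      refine ne_of_lt (((monotone_aff h.pos).iterate m (ha.2 ?_)).trans_lt (hmono (by omega)))
      exact kappa_iterate_anti (Nat.zero_le _) ht₀
    · rw [← (hy.2 j).2]
      refine h.deltaIter_add_spike_eq (by omega) (by omega) hp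
        (kappa_iterate_anti (by omega) hg.1) (fun hbe m hm => ?_) v c
      have h1 := h.jump (r - 1) (by omega) _ (by rwa [Nat.sub_add_cancel hr]) hp
      have h2 := h.le_aff_iterate (l := r - 1) (m := m) (by omega) (by omega) hg.1 hbe
      exact ne_of_gt ((h1.2.1.trans_le (hg.2 h1.2.2.1)).trans_le h2)

theorem Disc.action_add_spike (hr : 1 ≤ r) (hT : IsCompact T) (ha : IsLeast T a)
    (hb : IsGreatest T b) (h : Disc T (2 * r) a₁ a₀ e) (hL : IsLagrangian T L)
    (hy : IsC T (2 * r) y) {t₀ : ℝ}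
    (ht₀ : t₀ ∈ kappa^[2 * r] T) (hte : t₀ ≠ e) (v : EuclideanSpace ℝ (Fin n)) (c : ℝ) :
    action T a b L (fun s => y s + (c * spike ((aff a₁ a₀)^[r] t₀) s) • v) =
      action T a b L y + ∑ k ∈ Finset.range (r + 1),
        ((aff a₁ a₀)^[k + 1] t₀ - (aff a₁ a₀)^[k] t₀) *
        (L ((aff a₁ a₀)^[k] t₀) (jet T r y ((aff a₁ a₀)^[k] t₀) + c • fun i : Fin (r + 1) =>
          (affDiff a₁ a₀)^[(i : ℕ)] (fun s => spike ((aff a₁ a₀)^[r] t₀)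
            ((aff a₁ a₀)^[r - (i : ℕ)] s)) ((aff a₁ a₀)^[k] t₀) • v) -
          L ((aff a₁ a₀)^[k] t₀) (jet T r y ((aff a₁ a₀)^[k] t₀))) := by
  have hmem : ∀ k ≤ r, (aff a₁ a₀)^[k] t₀ ∈ kappa^[r] T ∧ (aff a₁ a₀)^[k] t₀ ≠ e := fun k hk => by
    have := h.aff_iterate_mem (l := k) (m := 2 * r - k) (by omega)
      (by convert ht₀ using 2; omega) hte
    exact ⟨kappa_iterate_anti (by omega) this.1, this.2⟩
  have hp := (hmem r le_rfl).2
  have hS : Disc (kappa^[r - 1] T) (r + 1) a₁ a₀ e := h.shift (by omega)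
  have hκ : kappa (kappa^[r - 1] T) = kappa^[r] T := by
    rw [← Function.iterate_succ_apply' kappa, Nat.succ_eq_add_one, Nat.sub_add_cancel hr]
  have hcont : e ∈ kappa^[r - 1] T →
      ContinuousWithinAt (fun t => L t (jet T r y t)) (kappa^[r - 1] T) e := fun he => by
    have heT : e ∈ T := kappa_iterate_anti (Nat.zero_le _) he
    exact ((h.taylorAt_lagrangian hr (by omega) heT hL
      ((h.isC_iff le_rfl).1 hy heT)).continuousWithinAt heT).mono
      (kappa_iterate_anti (Nat.zero_le _))
  have hinj := (strictMono_aff_iterate h.pos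
    (h.jump 0 (by omega) t₀ (kappa_iterate_anti (by omega) ht₀) hte).2.1).injective
  have key := hS.deltaIntegral_add_spikes (by omega) (isCompact_kappa_iterate hT hb (r - 1))
    (isLeast_kappa_iterate hT ha hb (r - 1)) (isGreatest_kappa_iterate hT hb (r - 1)) hcont (r + 1)
    (fun k => (aff a₁ a₀)^[k] t₀) (fun k =>
      L ((aff a₁ a₀)^[k] t₀) (jet T r y ((aff a₁ a₀)^[k] t₀) + c • fun i : Fin (r + 1) =>
          (affDiff a₁ a₀)^[(i : ℕ)] (fun s => spike ((aff a₁ a₀)^[r] t₀)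
            ((aff a₁ a₀)^[r - (i : ℕ)] s)) ((aff a₁ a₀)^[k] t₀) • v) -
          L ((aff a₁ a₀)^[k] t₀) (jet T r y ((aff a₁ a₀)^[k] t₀)))
    (g := fun t => L t (jet T r (fun s => y s + (c * spike ((aff a₁ a₀)^[r] t₀) s) • v) t))
    (fun k hk => by rw [hκ]; exact hmem k (Nat.lt_succ_iff.1 hk)) ?_
  · unfold action
    rw [key]
    simp only [Function.iterate_succ_apply']
  · intro t ht
    rw [hκ] at ht
    rw [h.jet_add_spike hr (by omega) hp y v c ht]
    by_cases hk : ∃ k ≤ r, t = (aff a₁ a₀)^[k] t₀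
    · obtain ⟨k, hk, rfl⟩ := hk
      rw [Finset.sum_eq_single k]
      · simp [spike]
      · intro l _ hl
        rw [spike_of_ne fun heq => hl (hinj heq).symm, zero_mul]
      · intro h1
        exact absurd (Finset.mem_range.2 (Nat.lt_succ_of_le hk)) h1
    · push Not at hk
      rw [Finset.sum_eq_zero fun k hk' => ?_, add_zero]
      · have h0 : (fun i : Fin (r + 1) => (affDiff a₁ a₀)^[(i : ℕ)] (fun s =>
            spike ((aff a₁ a₀)^[r] t₀) ((aff a₁ a₀)^[r - (i : ℕ)] s)) t • v) = 0 := by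
          funext i
          have hi := i.is_lt
          rw [affDiff_spike_eq_zero h.pos (by omega) hk, zero_smul]
          rfl
        rw [h0, smul_zero, add_zero]
      · rw [spike_of_ne (hk k (Nat.lt_succ_iff.1 (Finset.mem_range.1 hk'))), zero_mul]

theorem Disc.euler_lagrange_of_ne (hr : 1 ≤ r) (hT : IsCompact T) (ha : IsLeast T a)
    (hb : IsGreatest T b) (h : Disc T (2 * r) a₁ a₀ e) (hL : IsLagrangian T L)
    (hy : IsWeakLocalMin T a b L α β y) {t₀ : ℝ} (ht₀ : t₀ ∈ kappa^[2 * r] T) (hte : t₀ ≠ e) :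
    ∑ i : Fin (r + 1), ((-1 : ℝ) ^ (i : ℕ) * (1 / a₁) ^ ((i : ℕ) * ((i : ℕ) - 1) / 2)) •
      deltaIter (kappa^[r] T) (fun s => partialU L i s (jet T r y s)) (i : ℕ) t₀ = 0 := by
  obtain ⟨hadm, δ, hδ, hmin⟩ := hy
  set p := (aff a₁ a₀)^[r] t₀ with hpdef
  set x : ℕ → ℝ := fun k => (aff a₁ a₀)^[k] t₀ with hx
  have hmem : ∀ k ≤ r, x k ∈ kappa^[r] T ∧ x k ≠ e := fun k hk => by
    have := h.aff_iterate_mem (l := k) (m := 2 * r - k) (by omega)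
      (by convert ht₀ using 2; omega) hte
    exact ⟨kappa_iterate_anti (by omega) this.1, this.2⟩
  have hp : p ≠ e := (hmem r le_rfl).2
  have hlt : t₀ < aff a₁ a₀ t₀ :=
    (h.jump 0 (by omega) t₀ (kappa_iterate_anti (by omega) ht₀) hte).2.1
  have hsub : kappa^[r] T ⊆ T := kappa_iterate_anti (Nat.zero_le r)
  -- The Euler–Lagrange expression itself is used as the direction of the variation.
  set E : EuclideanSpace ℝ (Fin n) := ∑ i : Fin (r + 1),
    ((-1 : ℝ) ^ (i : ℕ) * (1 / a₁) ^ ((i : ℕ) * ((i : ℕ) - 1) / 2)) •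
      (affDiff a₁ a₀)^[(i : ℕ)] (fun s => partialU L i s (jet T r y s)) t₀ with hE
  have hsum : ∑ i : Fin (r + 1), ((-1 : ℝ) ^ (i : ℕ) *
      (1 / a₁) ^ ((i : ℕ) * ((i : ℕ) - 1) / 2)) •
      deltaIter (kappa^[r] T) (fun s => partialU L i s (jet T r y s)) (i : ℕ) t₀ = E := by
    refine Finset.sum_congr rfl fun i _ => ?_
    have hi := i.is_lt
    have hr' : Disc (kappa^[r] T) r a₁ a₀ e := h.shift (by omega)
    rw [hr'.deltaIter_of_ne (by omega) ?_ hte]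
    rw [← Function.iterate_add_apply]
    exact kappa_iterate_anti (by omega) ht₀
  rw [hsum]
  set d : Fin (r + 1) → ℝ → ℝ := fun i => (affDiff a₁ a₀)^[(i : ℕ)]
    (fun s => spike p ((aff a₁ a₀)^[r - (i : ℕ)] s)) with hd
  set w : ℕ → Fin (r + 1) → EuclideanSpace ℝ (Fin n) := fun k i => d i (x k) • E with hw
  set φ : ℝ → ℝ := fun c => ∑ k ∈ Finset.range (r + 1),
    (x (k + 1) - x k) * L (x k) (jet T r y (x k) + c • w k) with hφ
  have hlocal : IsLocalMin φ 0 := by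
    obtain ⟨C, hC0, hC⟩ := h.normR_spike_le hr (by omega) hp E
    have hball : ∀ᶠ c : ℝ in 𝓝 0, |c| * C < δ := by
      have hc : Continuous fun c : ℝ => |c| * C := by fun_prop
      have := hc.tendsto 0
      rw [abs_zero, zero_mul] at this
      exact this.eventually (gt_mem_nhds hδ)
    filter_upwards [hball] with c hc
    have h1 := hmin _ (h.isAdmissible_add_spike hr hT ha hb hadm ht₀ hte E c) (by
      have e1 : (fun t => y t + (c * spike ((aff a₁ a₀)^[r] t₀) t) • E - y t) =
          fun t => (c * spike ((aff a₁ a₀)^[r] t₀) t) • E := by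
        funext t; abel
      rw [e1]
      exact (hC c).trans_lt ((ENNReal.ofReal_lt_ofReal_iff hδ).2 hc))
    rw [h.action_add_spike hr hT ha hb hL hadm.1 ht₀ hte E c] at h1
    simp only [hφ, zero_smul, add_zero]
    simp only [mul_sub, Finset.sum_sub_distrib] at h1
    linarith
  have hderiv : HasDerivAt φ (∑ k ∈ Finset.range (r + 1), (x (k + 1) - x k) *
      fderiv ℝ (L (x k)) (jet T r y (x k)) (w k)) 0 := by
    refine HasDerivAt.fun_sum fun k hk => HasDerivAt.const_mul _ ?_
    have hk' := hmem k (Nat.lt_succ_iff.1 (Finset.mem_range.1 hk))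
    have h1 : HasDerivAt (fun c : ℝ => jet T r y (x k) + c • w k) (w k) 0 := by
      simpa using ((hasDerivAt_id (0 : ℝ)).smul_const (w k)).const_add (jet T r y (x k))
    have h2 : HasFDerivAt (L (x k)) (fderiv ℝ (L (x k)) (jet T r y (x k)))
        (jet T r y (x k) + (0 : ℝ) • w k) := by
      rw [zero_smul, add_zero]
      exact (hL.2.1 _ (hsub hk'.1) _).hasFDerivAt
    exact h2.comp_hasDerivAt (0 : ℝ) h1
  have hzero := hlocal.hasDerivAt_eq_zero hderiv
  -- Pair each L_{u_i} with E to get scalar functions and sum by parts; the first variation becomes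
  -- graininess times ⟨E, E⟩.
  have hcalc : ∑ k ∈ Finset.range (r + 1), (x (k + 1) - x k) *
      fderiv ℝ (L (x k)) (jet T r y (x k)) (w k) = (aff a₁ a₀ t₀ - t₀) * inner ℝ E E := by
    have h1 : ∀ k ∈ Finset.range (r + 1), (x (k + 1) - x k) *
        fderiv ℝ (L (x k)) (jet T r y (x k)) (w k) = ∑ i : Fin (r + 1), (x (k + 1) - x k) *
        (innerSL ℝ E (partialU L i (x k) (jet T r y (x k))) * d i (x k)) := fun k hk => by
      have hk' := hmem k (Nat.lt_succ_iff.1 (Finset.mem_range.1 hk))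
      rw [fderiv_eq_sum_inner_partialU (hL.2.1 _ (hsub hk'.1) _), Finset.mul_sum]
      refine Finset.sum_congr rfl fun i _ => ?_
      rw [innerSL_apply_apply, hw, inner_smul_right, real_inner_comm, mul_comm (d i (x k))]
    rw [Finset.sum_congr rfl h1, Finset.sum_comm]
    conv_rhs => rw [hE, inner_sum, Finset.mul_sum]
    refine Finset.sum_congr rfl fun i _ => ?_
    have hi := i.is_lt
    have h2 := sum_mul_affDiff_spike h.pos hlt (r := r) (i := i) (by omega)
      (fun s => innerSL ℝ E (partialU L i s (jet T r y s)))
    rw [h2, ← map_affDiff_iterate, inner_smul_right, innerSL_apply_apply]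
    ring
  rw [hcalc] at hzero
  rcases mul_eq_zero.1 hzero with h1 | h1
  · exact absurd h1 (sub_pos.2 hlt).ne'
  · exact inner_self_eq_zero.1 h1

theorem Disc.euler_lagrange (hr : 1 ≤ r) (hT : IsCompact T) (ha : IsLeast T a)
    (hb : IsGreatest T b) (h : Disc T (2 * r) a₁ a₀ e) (hL : IsLagrangian T L)
    (hy : IsWeakLocalMin T a b L α β y) :
    (∀ i : Fin (r + 1), DeltaDifferentiable (kappa^[r] T) (i : ℕ)
      (fun t => partialU L i t (jet T r y t))) ∧
    ∀ t ∈ kappa^[2 * r] T, ∑ i : Fin (r + 1),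
      ((-1 : ℝ) ^ (i : ℕ) * (1 / a₁) ^ ((i : ℕ) * ((i : ℕ) - 1) / 2)) •
        deltaIter (kappa^[r] T) (fun s => partialU L i s (jet T r y s)) (i : ℕ) t = 0 := by
  have hr' : Disc (kappa^[r] T) r a₁ a₀ e := h.shift (by omega)
  have hsub : kappa^[r] T ⊆ T := kappa_iterate_anti (Nat.zero_le r)
  have hTay : ∀ i : Fin (r + 1), e ∈ kappa^[r] T →
      TaylorAt (kappa^[r] T) e i (fun t => partialU L i t (jet T r y t)) := fun i he => by
    have hi := i.is_lt
    rw [taylorAt_congr_set (h.nhds_eq (hsub he) r)]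
    exact (h.taylorAt_partialU hr (by omega) (hsub he) hL
      ((h.isC_iff le_rfl).1 hy.1.1 (hsub he)) i).of_le (by omega)
  refine ⟨fun i => hr'.deltaDifferentiable (by have := i.is_lt; omega) (hTay i), fun t ht => ?_⟩
  by_cases hte : t = e
  swap
  · exact h.euler_lagrange_of_ne hr hT ha hb hL hy ht hte
  subst hte
  have htr : t ∈ kappa^[r] T := kappa_iterate_anti (by omega) ht
  -- At the exceptional point the sum is continuous, and it vanishes at the nearby points, which
  -- accumulate there.
  have hcont : ContinuousWithinAt (fun t => ∑ i : Fin (r + 1),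
      ((-1 : ℝ) ^ (i : ℕ) * (1 / a₁) ^ ((i : ℕ) * ((i : ℕ) - 1) / 2)) •
      deltaIter (kappa^[r] T) (fun s => partialU L i s (jet T r y s)) (i : ℕ) t)
      (kappa^[r] T) t := by
    refine tendsto_finsetSum _ fun i _ => Tendsto.const_smul ?_ _
    have h1 := hr'.taylorAt_deltaIter (j := i) (m := 0) htr (by have := i.is_lt; omega)
      (by rw [zero_add]; exact hTay i htr)
    exact h1.continuousWithinAt htr
  have h2 := h.neBot (hsub htr)
  have h3 : 𝓝[T \ {t}] t ≤ 𝓝[kappa^[r] T] t := by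
    rw [h.nhds_eq (hsub htr) r]
    exact nhdsWithin_mono _ sdiff_subset
  refine tendsto_nhds_unique (hcont.tendsto.mono_left h3) (tendsto_const_nhds.congr' ?_)
  have h4 : ∀ᶠ s in 𝓝[T] t, s ∈ kappa^[2 * r] T := by
    rw [← h.nhds_eq (hsub htr) (2 * r)]
    exact self_mem_nhdsWithin
  filter_upwards [nhdsWithin_mono _ sdiff_subset h4, self_mem_nhdsWithin] with s hs1 hs2
  exact (h.euler_lagrange_of_ne hr hT ha hb hL hy hs1 hs2.2).symm

end EulerLagrange

end TimeScale

/-! ### The interval case: reduction to classical calculus. -/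

namespace TimeScale

open Filter Topology Set MeasureTheory

section Interval

theorem continuousOn_comp_graph {F : Type} [TopologicalSpace F] {V : Type} [TopologicalSpace V]
    {T : Set ℝ} {f : ℝ → V → F}
    (hf : ContinuousOn (fun p : ℝ × V => f p.1 p.2) (T ×ˢ univ)) {v : ℝ → V}
    (hv : ContinuousOn v T) : ContinuousOn (fun t => f t (v t)) T :=
  ContinuousOn.comp (f := fun t => (t, v t)) hf (continuousOn_id.prodMk hv)
    fun _ ht => ⟨ht, mem_univ _⟩

variable {F : Type} [NormedAddCommGroup F] [NormedSpace ℝ F] {V : Type} [NormedAddCommGroup V]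
  [NormedSpace ℝ V] {a b : ℝ}

theorem sigma_Icc {t : ℝ} (ht : t ∈ Icc a b) : sigma (Icc a b) t = t := by
  rcases ht.2.lt_or_eq with h | h
  · have e1 : Icc a b ∩ Ioi t = Ioc t b := by
      ext x
      simp only [mem_inter_iff, mem_Icc, mem_Ioi, mem_Ioc]
      exact ⟨fun hx => ⟨hx.2, hx.1.2⟩, fun hx => ⟨⟨ht.1.trans hx.1.le, hx.2⟩, hx.1⟩⟩
    have hne : (Icc a b ∩ Ioi t).Nonempty := ⟨b, ⟨ht.1.trans h.le, le_rfl⟩, h⟩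
    unfold sigma
    rw [if_pos hne, e1, csInf_Ioc h]
  · have := sigma_of_isGreatest (isGreatest_Icc (ht.1.trans ht.2))
    rw [h]; exact this

theorem rho_Icc (hab : a < b) : rho (Icc a b) b = b := by
  have e1 : Icc a b ∩ Iio b = Ico a b := by
    ext x
    simp only [mem_inter_iff, mem_Icc, mem_Iio, mem_Ico]
    exact ⟨fun hx => ⟨hx.1.1, hx.2⟩, fun hx => ⟨⟨hx.1, hx.2.le⟩, hx.2⟩⟩
  have hne : (Icc a b ∩ Iio b).Nonempty := ⟨a, ⟨le_rfl, hab.le⟩, hab⟩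
  unfold rho
  rw [if_pos hne, e1, csSup_Ico hab]

theorem kappa_Icc (hab : a < b) (m : ℕ) : kappa^[m] (Icc a b) = Icc a b := by
  refine Function.iterate_fixed ?_ m
  rw [kappa_eq (isGreatest_Icc hab.le), rho_Icc hab]
  exact inter_eq_left.2 fun x hx => hx.2

theorem hasDeltaDerivAt_Icc {f : ℝ → F} {f' : F} {t : ℝ} (ht : t ∈ Icc a b) :
    HasDeltaDerivAt (Icc a b) f f' t ↔ HasDerivWithinAt f f' (Icc a b) t :=
  hasDeltaDerivAt_iff_of_sigma_eq (sigma_Icc ht)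

theorem deltaDeriv_Icc (hab : a < b) (f : ℝ → F) {t : ℝ} (ht : t ∈ Icc a b) :
    deltaDeriv (Icc a b) f t = derivWithin f (Icc a b) t := by
  have hu := uniqueDiffOn_Icc hab t ht
  by_cases h : DifferentiableWithinAt ℝ f (Icc a b) t
  · exact deltaDeriv_eq ((hasDeltaDerivAt_Icc ht).2 h.hasDerivWithinAt) fun f'' hf'' =>
      hu.eq_deriv _ ((hasDeltaDerivAt_Icc ht).1 hf'') h.hasDerivWithinAt
  · have h1 : ¬ ∃ f' : F, HasDeltaDerivAt (Icc a b) f f' t := fun ⟨f', hf'⟩ =>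
      h ((hasDeltaDerivAt_Icc ht).1 hf').differentiableWithinAt
    unfold deltaDeriv
    rw [dif_neg h1, derivWithin_zero_of_not_differentiableWithinAt h]

theorem deltaIter_Icc (hab : a < b) (f : ℝ → F) (m : ℕ) :
    EqOn (deltaIter (Icc a b) f m) (iteratedDerivWithin m f (Icc a b)) (Icc a b) := by
  induction m with
  | zero => intro t _; simp [deltaIter]
  | succ m ih =>
    intro t ht
    rw [deltaIter, kappa_Icc hab, deltaDeriv_Icc hab _ ht, iteratedDerivWithin_succ]
    exact derivWithin_congr ih (ih ht)

theorem deltaDifferentiable_Icc (hab : a < b) {f : ℝ → F} {m : ℕ} :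
    DeltaDifferentiable (Icc a b) m f ↔
      ∀ j < m, DifferentiableOn ℝ (iteratedDerivWithin j f (Icc a b)) (Icc a b) := by
  unfold DeltaDifferentiable
  refine forall₂_congr fun j _ => ?_
  rw [kappa_Icc hab, kappa_Icc hab]
  refine forall₂_congr fun t ht => ?_
  constructor
  · rintro ⟨f', hf'⟩
    exact (((hasDeltaDerivAt_Icc ht).1 hf').congr (fun s hs => (deltaIter_Icc hab f j hs).symm)
      (deltaIter_Icc hab f j ht).symm).differentiableWithinAt
  · intro h
    exact ⟨_, (hasDeltaDerivAt_Icc ht).2 (h.hasDerivWithinAt.congr (deltaIter_Icc hab f j)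
      (deltaIter_Icc hab f j ht))⟩

theorem isC_Icc (hab : a < b) {f : ℝ → F} {m : ℕ} :
    IsC (Icc a b) m f ↔ ContDiffOn ℝ m f (Icc a b) := by
  have hu := uniqueDiffOn_Icc hab
  rw [contDiffOn_nat_iff_continuousOn_differentiableOn_deriv hu]
  unfold IsC
  rw [deltaDifferentiable_Icc hab, kappa_Icc hab, continuousOn_congr (deltaIter_Icc hab f m)]
  constructor
  · rintro ⟨h1, h2⟩
    refine ⟨fun j hj => ?_, h1⟩
    rcases hj.lt_or_eq with h | h
    · exact (h1 j h).continuousOn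
    · rw [h]; exact h2
  · rintro ⟨h1, h2⟩
    exact ⟨h2, h1 m le_rfl⟩

/-- A chain rule from partial derivatives: differentiability in t is needed only on the slice u =
v(t). The rest is the mean value inequality in u at fixed s, made uniform by joint continuity of the
u-derivative. -/
theorem hasDerivWithinAt_comp_graph {T : Set ℝ} {f : ℝ → V → F} {v : ℝ → V} {f' : F} {v' : V}
    {t : ℝ} (ht : t ∈ T) (hd : ∀ s ∈ T, Differentiable ℝ (f s))
    (hc : ContinuousOn (fun p : ℝ × V => fderiv ℝ (f p.1) p.2) (T ×ˢ univ))
    (hf : HasDerivWithinAt (fun s => f s (v t)) f' T t) (hv : HasDerivWithinAt v v' T t) :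
    HasDerivWithinAt (fun s => f s (v s)) (f' + fderiv ℝ (f t) (v t) v') T t := by
  set M := fderiv ℝ (f t) (v t) with hM
  have hsmall : (fun s => f s (v s) - f s (v t) - M (v s - v t)) =o[𝓝[T] t]
      fun s => s - t := by
    refine Asymptotics.IsLittleO.trans_isBigO (g := fun s => v s - v t) ?_ ?_
    · rw [Asymptotics.isLittleO_iff]
      intro ε hε
      have h1 : ContinuousWithinAt (fun p : ℝ × V => fderiv ℝ (f p.1) p.2) (T ×ˢ univ) (t, v t) :=
        hc (t, v t) ⟨ht, mem_univ _⟩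
      obtain ⟨δ, hδ, H⟩ := Metric.continuousWithinAt_iff.1 h1 ε hε
      have h2 : ∀ᶠ s in 𝓝[T] t, v s ∈ Metric.ball (v t) δ :=
        hv.continuousWithinAt (Metric.ball_mem_nhds _ hδ)
      have h3 : ∀ᶠ s in 𝓝[T] t, s ∈ Metric.ball t δ :=
        mem_nhdsWithin_of_mem_nhds (Metric.ball_mem_nhds _ hδ)
      filter_upwards [h2, h3, self_mem_nhdsWithin] with s hs1 hs2 hs3
      refine Convex.norm_image_sub_le_of_norm_fderiv_le' (𝕜 := ℝ) (s := Metric.ball (v t) δ)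
        (fun u _ => hd s hs3 u) (fun u hu => ?_) (convex_ball _ _)
        (Metric.mem_ball_self hδ) hs1
      have := H (x := (s, u)) ⟨hs3, mem_univ _⟩ (by
        rw [Prod.dist_eq]
        exact max_lt hs2 hu)
      rw [dist_eq_norm] at this
      exact this.le
    · exact hv.differentiableWithinAt.isBigO_sub
  have h4 : HasDerivWithinAt (fun s => M (v s)) (M v') T t :=
    M.hasFDerivAt.comp_hasDerivWithinAt t hv
  rw [hasDerivWithinAt_iff_isLittleO] at hf h4 ⊢
  refine ((hf.add h4).add hsmall).congr_left fun s => ?_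
  rw [smul_add, map_sub]
  abel

/-- The chain rule writes the derivative through composites of functions of joint class k, to which
the induction applies. -/
theorem JointC.contDiffOn_comp (hab : a < b) (k : ℕ) : ∀ {F : Type} [NormedAddCommGroup F]
    [NormedSpace ℝ F] {f : ℝ → V → F}, JointC k (Icc a b) f → ∀ {v : ℝ → V},
    ContDiffOn ℝ k v (Icc a b) → ContDiffOn ℝ k (fun t => f t (v t)) (Icc a b) := by
  have hu := uniqueDiffOn_Icc hab
  induction k with
  | zero =>
    intro F _ _ f hf v hv
    exact contDiffOn_zero.2 (continuousOn_comp_graph hf hv.continuousOn)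
  | succ k ih =>
    intro F _ _ f hf v hv
    obtain ⟨hc, hd, hJ1, hΔ, hJ2⟩ := hf
    rw [show kappa (Icc a b) = Icc a b from kappa_Icc hab 1] at hΔ hJ2
    have hc1 : ContinuousOn (fun p : ℝ × V => fderiv ℝ (f p.1) p.2) (Icc a b ×ˢ univ) := by
      rcases k with _ | k
      · exact hJ1
      · exact hJ1.1
    have hvk : ContDiffOn ℝ k v (Icc a b) := hv.of_le (by exact_mod_cast Nat.le_succ k)
    push_cast at hv ⊢
    have hv' := (contDiffOn_succ_iff_derivWithin hu).1 hv
    have hder : ∀ t ∈ Icc a b, HasDerivWithinAt (fun s => f s (v s))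
        (deltaDeriv (Icc a b) (fun s => f s (v t)) t +
          fderiv ℝ (f t) (v t) (derivWithin v (Icc a b) t)) (Icc a b) t := by
      intro t ht
      refine hasDerivWithinAt_comp_graph ht hd hc1 ?_ (hv'.1 t ht).hasDerivWithinAt
      obtain ⟨f', hf'⟩ := hΔ (v t) t ht
      rw [hasDeltaDerivAt_Icc ht] at hf'
      rw [deltaDeriv_Icc hab _ ht]
      exact hf'.differentiableWithinAt.hasDerivWithinAt
    refine (contDiffOn_succ_iff_derivWithin hu).2 ⟨fun t ht => (hder t ht).differentiableWithinAt,
      fun h => absurd h (by simp), ?_⟩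
    refine ContDiffOn.congr (f := fun t => deltaDeriv (Icc a b) (fun s => f s (v t)) t +
          fderiv ℝ (f t) (v t) (derivWithin v (Icc a b) t)) ?_
      fun t ht => (hder t ht).derivWithin (hu t ht)
    exact (ih hJ2 hvk).add ((ih hJ1 hvk).clm_apply hv'.2.2)

theorem deltaIntegral_Icc (hab : a < b) {f : ℝ → ℝ} (hf : ContinuousOn f (Icc a b)) :
    deltaIntegral (Icc a b) f a b = ∫ t in a..b, f t := by
  have hg : Continuous (IccExtend hab.le (fun t : Icc a b => f t)) :=
    Continuous.Icc_extend' (continuousOn_iff_continuous_domRestrict.1 hf)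
  have heq : ∀ t ∈ Icc a b, IccExtend hab.le (fun t : Icc a b => f t) t = f t := fun t ht =>
    IccExtend_of_mem hab.le _ ht
  have h1 : ∀ t ∈ kappa (Icc a b), HasDeltaDerivAt (Icc a b)
      (fun x => ∫ s in a..x, IccExtend hab.le (fun t : Icc a b => f t) s) (f t) t := by
    intro t ht
    rw [show kappa (Icc a b) = Icc a b from kappa_Icc hab 1] at ht
    rw [hasDeltaDerivAt_Icc ht]
    have := (hg.integral_hasStrictDerivAt a t).hasDerivAt.hasDerivWithinAt (s := Icc a b)
    rwa [heq t ht] at this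
  rw [deltaIntegral_eq isCompact_Icc (isLeast_Icc hab.le) (isGreatest_Icc hab.le) h1,
    intervalIntegral.integral_same, sub_zero]
  refine intervalIntegral.integral_congr fun t ht => heq t ?_
  rwa [uIcc_of_le hab.le] at ht

/-- Restricting c to [-1, 1] makes (c, t) range over a compact set, where the derivative of the
integrand has a constant bound. -/
theorem hasDerivAt_integral_lagrangian (hab : a < b) {L : ℝ → V → ℝ}
    (hL : ContinuousOn (fun p : ℝ × V => L p.1 p.2) (Icc a b ×ˢ univ))
    (hd : ∀ t ∈ Icc a b, Differentiable ℝ (L t))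
    (hL' : ContinuousOn (fun p : ℝ × V => fderiv ℝ (L p.1) p.2) (Icc a b ×ˢ univ))
    {J w : ℝ → V} (hJ : ContinuousOn J (Icc a b)) (hw : ContinuousOn w (Icc a b)) :
    HasDerivAt (fun c : ℝ => ∫ t in a..b, L t (J t + c • w t))
      (∫ t in a..b, fderiv ℝ (L t) (J t) (w t)) 0 := by
  have hu : uIcc a b = Icc a b := uIcc_of_le hab.le
  have hsub : uIoc a b ⊆ Icc a b := by rw [uIoc_of_le hab.le]; exact Ioc_subset_Icc_self
  have hcJ : ∀ c : ℝ, ContinuousOn (fun t => J t + c • w t) (Icc a b) := fun c =>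
    hJ.add (hw.const_smul c)
  have hI : ∀ {g : ℝ → ℝ}, ContinuousOn g (Icc a b) → IntervalIntegrable g volume a b :=
    fun hg => ContinuousOn.intervalIntegrable (by rwa [hu])
  have hK : ContinuousOn (fun q : ℝ × ℝ => fderiv ℝ (L q.2) (J q.2 + q.1 • w q.2) (w q.2))
      (Icc (-1) 1 ×ˢ Icc a b) := by
    have h2 : ContinuousOn (fun q : ℝ × ℝ => q.2) (Icc (-1 : ℝ) 1 ×ˢ Icc a b) :=
      continuousOn_snd
    have hm : MapsTo (fun q : ℝ × ℝ => q.2) (Icc (-1 : ℝ) 1 ×ˢ Icc a b) (Icc a b) :=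
      fun q hq => hq.2
    have h3 := hw.comp h2 hm
    have h4 := (hJ.comp h2 hm).add ((continuousOn_fst (s := Icc (-1 : ℝ) 1 ×ˢ Icc a b)).smul h3)
    exact (hL'.comp (h2.prodMk h4) fun q hq => ⟨hq.2, mem_univ _⟩).clm_apply h3
  obtain ⟨C, hC⟩ := (isCompact_Icc.prod isCompact_Icc).exists_bound_of_continuousOn hK
  have key := intervalIntegral.hasDerivAt_integral_of_dominated_loc_of_deriv_le (μ := volume)
    (a := a) (b := b) (F := fun (c : ℝ) t => L t (J t + c • w t))
    (F' := fun c t => fderiv ℝ (L t) (J t + c • w t) (w t)) (x₀ := (0 : ℝ)) (s := Icc (-1) 1)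
    (bound := fun _ => C) (Icc_mem_nhds (by norm_num) (by norm_num)) ?_ ?_ ?_ ?_ ?_ ?_
  · have h5 := key.2
    simp only [zero_smul, add_zero] at h5
    exact h5
  · exact Eventually.of_forall fun c =>
      (hI (continuousOn_comp_graph hL (hcJ c))).def'.aestronglyMeasurable
  · exact hI (continuousOn_comp_graph hL (hcJ 0))
  · exact (hI ((continuousOn_comp_graph hL' (hcJ 0)).clm_apply hw)).def'.aestronglyMeasurable
  · exact Eventually.of_forall fun t ht c hc => hC (c, t) ⟨hc, hsub ht⟩
  · exact intervalIntegrable_const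
  · refine Eventually.of_forall fun t ht c _ => ?_
    have h6 : HasDerivAt (fun c : ℝ => J t + c • w t) (w t) c := by
      simpa using ((hasDerivAt_id c).smul_const (w t)).const_add (J t)
    exact (hd t (hsub ht) _).hasFDerivAt.comp_hasDerivAt c h6

theorem map_iteratedDerivWithin {G : Type} [NormedAddCommGroup G] [NormedSpace ℝ G] (hab : a < b)
    (A : F →L[ℝ] G) {f : ℝ → F} {m : ℕ} (hf : ContDiffOn ℝ m f (Icc a b)) {t : ℝ}
    (ht : t ∈ Icc a b) : iteratedDerivWithin m (fun s => A (f s)) (Icc a b) t =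
      A (iteratedDerivWithin m f (Icc a b) t) := by
  rw [iteratedDerivWithin_eq_iteratedFDerivWithin, iteratedDerivWithin_eq_iteratedFDerivWithin]
  have := A.iteratedFDerivWithin_comp_left (hf t ht) (uniqueDiffOn_Icc hab) ht le_rfl
  simp only [Function.comp_def] at this
  rw [this]
  rfl

theorem integral_mul_iteratedDerivWithin (hab : a < b) {φ : ℝ → ℝ} (i : ℕ) :
    ∀ {g : ℝ → ℝ}, ContDiffOn ℝ i φ (Icc a b) → ContDiffOn ℝ i g (Icc a b) →
    (∀ j < i, iteratedDerivWithin j φ (Icc a b) a = 0) →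
    (∀ j < i, iteratedDerivWithin j φ (Icc a b) b = 0) →
    ∫ t in a..b, g t * iteratedDerivWithin i φ (Icc a b) t =
      (-1) ^ i * ∫ t in a..b, iteratedDerivWithin i g (Icc a b) t * φ t := by
  have hu := uniqueDiffOn_Icc hab
  have hI : uIcc a b = Icc a b := uIcc_of_le hab.le
  induction i with
  | zero => intro g _ _ _ _; simp
  | succ i ih =>
    intro g hφ hg h0 h1
    have hφi : ContDiffOn ℝ i φ (Icc a b) := hφ.of_le (by exact_mod_cast Nat.le_succ i)
    have hgs := hg
    push_cast at hgs
    have hg' := (contDiffOn_succ_iff_derivWithin hu).1 hgs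
    have key := intervalIntegral.integral_mul_deriv_eq_deriv_mul_of_hasDerivWithinAt
      (a := a) (b := b) (u := g) (v := iteratedDerivWithin i φ (Icc a b))
      (u' := derivWithin g (Icc a b)) (v' := iteratedDerivWithin (i + 1) φ (Icc a b)) ?_ ?_ ?_ ?_
    · rw [key, h0 i (Nat.lt_succ_self i), h1 i (Nat.lt_succ_self i), mul_zero, mul_zero, sub_zero,
        zero_sub, ih hφi hg'.2.2 (fun j hj => h0 j (by omega)) (fun j hj => h1 j (by omega)),
        iteratedDerivWithin_succ', pow_succ]
      ring
    · rw [hI]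
      exact fun x hx => (hg'.1 x hx).hasDerivWithinAt
    · rw [hI]
      intro x hx
      rw [iteratedDerivWithin_succ]
      exact (hφ.differentiableOn_iteratedDerivWithin (by exact_mod_cast Nat.lt_succ_self i) hu
        x hx).hasDerivWithinAt
    · exact ContinuousOn.intervalIntegrable (by rw [hI]; exact hg'.2.2.continuousOn)
    · exact ContinuousOn.intervalIntegrable (by
        rw [hI]; exact hφ.continuousOn_iteratedDerivWithin le_rfl hu)

/-- The fundamental lemma gives zero almost everywhere on (a, b); continuity extends this to every
point of [a, b]. -/
theorem eqOn_zero_of_integral_mul_eq_zero (hab : a < b) {H : ℝ → ℝ} (hH : ContinuousOn H (Icc a b))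
    (h : ∀ φ : ℝ → ℝ, ContDiff ℝ (⊤ : ℕ∞) φ → HasCompactSupport φ → tsupport φ ⊆ Ioo a b →
      ∫ t in a..b, H t * φ t = 0) : ∀ t ∈ Icc a b, H t = 0 := by
  have hae := isOpen_Ioo.ae_eq_zero_of_integral_contDiff_smul_eq_zero (μ := volume) (f := H)
    (U := Ioo a b) ((hH.mono Ioo_subset_Icc_self).locallyIntegrableOn measurableSet_Ioo)
    fun φ h1 h2 h3 => by
      rw [← h φ h1 h2 h3, intervalIntegral.integral_of_le hab.le,
        ← setIntegral_eq_integral_of_forall_compl_eq_zero (s := Ioc a b)]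
      · simp only [smul_eq_mul, mul_comm]
      · intro x hx
        have : x ∉ tsupport φ := fun hx' => hx (Ioo_subset_Ioc_self (h3 hx'))
        rw [image_eq_zero_of_notMem_tsupport this, zero_smul]
  refine Measure.eqOn_Icc_of_ae_eq volume hab.ne ?_ hH continuousOn_const
  rw [← restrict_Ioo_eq_restrict_Icc]
  rw [Filter.EventuallyEq, ae_restrict_iff' measurableSet_Ioo]
  exact hae

end Interval

end TimeScale

/-! ### The Euler–Lagrange equation on an interval. -/

namespace TimeScale

open Filter Topology Set MeasureTheory

section IntervalEulerLagrange

variable {F : Type} [NormedAddCommGroup F] [NormedSpace ℝ F] {n r : ℕ} {a b : ℝ}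
  {L : ℝ → (Fin (r + 1) → EuclideanSpace ℝ (Fin n)) → ℝ}
  {α β : Fin r → EuclideanSpace ℝ (Fin n)} {y : ℝ → EuclideanSpace ℝ (Fin n)}

theorem contDiffOn_iteratedDerivWithin (hab : a < b) {k : ℕ} (i : ℕ) : ∀ {f : ℝ → F},
    ContDiffOn ℝ (k + i : ℕ) f (Icc a b) →
    ContDiffOn ℝ k (iteratedDerivWithin i f (Icc a b)) (Icc a b) := by
  induction i with
  | zero => intro f hf; rwa [iteratedDerivWithin_zero]
  | succ i ih =>
    intro f hf
    rw [iteratedDerivWithin_succ']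
    rw [← Nat.add_assoc] at hf
    push_cast at hf
    refine ih ?_
    push_cast
    exact ((contDiffOn_succ_iff_derivWithin (uniqueDiffOn_Icc hab)).1 hf).2.2

theorem iteratedDerivWithin_mul_smul (hab : a < b) {φ : ℝ → ℝ} (hφ : ContDiff ℝ (⊤ : ℕ∞) φ) (c : ℝ)
    (v : F) (j : ℕ) {t : ℝ} (ht : t ∈ Icc a b) :
    iteratedDerivWithin j (fun s => (c * φ s) • v) (Icc a b) t =
      (c * iteratedDerivWithin j φ (Icc a b) t) • v := by
  have hφj : ContDiff ℝ j φ := hφ.of_le (by exact_mod_cast le_top)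
  rw [iteratedDerivWithin_smul_const (f := fun s => c * φ s) ht (uniqueDiffOn_Icc hab)
    (contDiff_const.mul hφj).contDiffWithinAt, iteratedDerivWithin_const_mul_field]

theorem iteratedDerivWithin_add_mul_smul (hab : a < b) {φ : ℝ → ℝ}
    (hφ : ContDiff ℝ (⊤ : ℕ∞) φ) (c : ℝ) (v : F) {j : ℕ} {f : ℝ → F}
    (hf : ContDiffOn ℝ j f (Icc a b)) {t : ℝ} (ht : t ∈ Icc a b) :
    iteratedDerivWithin j (fun s => f s + (c * φ s) • v) (Icc a b) t =
      iteratedDerivWithin j f (Icc a b) t + (c * iteratedDerivWithin j φ (Icc a b) t) • v := by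
  have hφj : ContDiff ℝ j φ := hφ.of_le (by exact_mod_cast le_top)
  rw [iteratedDerivWithin_fun_add (g := fun s => (c * φ s) • v) ht (uniqueDiffOn_Icc hab) (hf t ht)
    ((contDiff_const.mul hφj).smul contDiff_const).contDiffWithinAt,
    iteratedDerivWithin_mul_smul hab hφ c v j ht]

theorem iteratedDerivWithin_of_notMem_tsupport {s : Set ℝ} {f : ℝ → F} {t : ℝ}
    (ht : t ∈ s) (hf : t ∉ tsupport f) (j : ℕ) : iteratedDerivWithin j f s t = 0 := by
  have h1 : f =ᶠ[𝓝 t] 0 := notMem_tsupport_iff_eventuallyEq.1 hf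
  have h2 : f =ᶠ[𝓝[s] t] 0 := h1.filter_mono nhdsWithin_le_nhds
  rw [h2.iteratedDerivWithin_eq (h2.self_of_nhdsWithin ht), iteratedDerivWithin_const_zero]

theorem jet_Icc (hab : a < b) (y : ℝ → EuclideanSpace ℝ (Fin n)) {t : ℝ} (ht : t ∈ Icc a b)
    (i : Fin (r + 1)) : jet (Icc a b) r y t i = iteratedDerivWithin i y (Icc a b) t := by
  unfold jet
  rw [deltaIter_Icc hab _ _ ht]
  refine iteratedDerivWithin_congr (fun s hs => ?_) ht
  show y _ = y s
  rw [Function.iterate_fixed (sigma_Icc hs)]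

theorem contDiffOn_jet_Icc (hab : a < b) (hy : ContDiffOn ℝ (2 * r : ℕ) y (Icc a b)) :
    ContDiffOn ℝ r (jet (Icc a b) r y) (Icc a b) := by
  rw [contDiffOn_pi]
  intro i
  have hi := i.is_lt
  refine ContDiffOn.congr ?_ fun t ht => jet_Icc hab y ht i
  exact contDiffOn_iteratedDerivWithin hab _ (hy.of_le (by exact_mod_cast (by omega)))

theorem IsLagrangian.contDiffOn_partialU (hab : a < b) (hL : IsLagrangian (Icc a b) L)
    (hy : ContDiffOn ℝ (2 * r : ℕ) y (Icc a b)) (i : Fin (r + 1)) :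
    ContDiffOn ℝ r (fun t => partialU L i t (jet (Icc a b) r y t)) (Icc a b) := by
  obtain ⟨A, hA⟩ := exists_clm_partialU (n := n) i
  have h1 := (hL.2.2.2 (Icc_infinite hab)).2.2.1.contDiffOn_comp hab r (contDiffOn_jet_Icc hab hy)
  exact (A.contDiff.comp_contDiffOn h1).congr fun t ht => hA L t _ (hL.2.1 t ht _)

theorem isAdmissible_Icc (hab : a < b) : IsAdmissible (Icc a b) a b α β y ↔
    ContDiffOn ℝ (2 * r : ℕ) y (Icc a b) ∧ ∀ j : Fin r,
      iteratedDerivWithin j y (Icc a b) a = α j ∧ iteratedDerivWithin j y (Icc a b) b = β j := by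
  unfold IsAdmissible
  rw [isC_Icc hab]
  refine and_congr_right fun _ => forall_congr' fun j => ?_
  rw [Function.iterate_fixed (rho_Icc hab), deltaIter_Icc hab y j (left_mem_Icc.2 hab.le),
    deltaIter_Icc hab y j (right_mem_Icc.2 hab.le)]

theorem action_Icc (hab : a < b) (hL : IsLagrangian (Icc a b) L)
    (hy : ContDiffOn ℝ (2 * r : ℕ) y (Icc a b)) :
    action (Icc a b) a b L y = ∫ t in a..b, L t (jet (Icc a b) r y t) := by
  unfold action
  rw [kappa_Icc hab, Function.iterate_fixed (rho_Icc hab), deltaIntegral_Icc hab]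
  exact continuousOn_comp_graph hL.1 (contDiffOn_jet_Icc hab hy).continuousOn

theorem exists_normR_Icc_le (hab : a < b) {φ : ℝ → ℝ} (hφ : ContDiff ℝ (⊤ : ℕ∞) φ)
    (v : EuclideanSpace ℝ (Fin n)) : ∃ C : ℝ, ∀ c : ℝ,
      normR (Icc a b) r (fun t => (c * φ t) • v) ≤ ENNReal.ofReal (|c| * C) := by
  have h1 : ∀ i : Fin (r + 1), ∃ C : ℝ, ∀ t ∈ Icc a b,
      ‖iteratedDerivWithin i φ (Icc a b) t‖ ≤ C := fun i =>
    isCompact_Icc.exists_bound_of_continuousOn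
      ((hφ.contDiffOn (s := Icc a b)).continuousOn_iteratedDerivWithin (by exact_mod_cast le_top)
        (uniqueDiffOn_Icc hab))
  choose C hC using h1
  have hC0 : ∀ i, 0 ≤ C i := fun i =>
    (norm_nonneg _).trans (hC i a (left_mem_Icc.2 hab.le))
  refine ⟨∑ i, C i * ‖v‖, fun c => ?_⟩
  rw [Finset.mul_sum, ENNReal.ofReal_sum_of_nonneg fun i _ =>
    mul_nonneg (abs_nonneg c) (mul_nonneg (hC0 i) (norm_nonneg v))]
  unfold normR
  refine Finset.sum_le_sum fun i _ => iSup₂_le fun t ht => ?_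
  rw [kappa_Icc hab] at ht
  rw [jet_Icc hab _ ht, iteratedDerivWithin_mul_smul hab hφ c v i ht, ← ofReal_norm]
  refine ENNReal.ofReal_le_ofReal ?_
  rw [norm_smul, norm_mul, Real.norm_eq_abs c, mul_assoc]
  gcongr
  exact hC i t ht

/-- The variation cφv has all its derivatives zero at both ends, hence is admissible, and its norm
is O(|c|). The action is thus locally minimal in c at 0. -/
theorem IsWeakLocalMin.integral_fderiv_eq_zero (hab : a < b) (hL : IsLagrangian (Icc a b) L)
    (hy : IsWeakLocalMin (Icc a b) a b L α β y) {φ : ℝ → ℝ} (hφ : ContDiff ℝ (⊤ : ℕ∞) φ)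
    (hφs : tsupport φ ⊆ Ioo a b) (v : EuclideanSpace ℝ (Fin n)) :
    ∫ t in a..b, fderiv ℝ (L t) (jet (Icc a b) r y t)
      (fun i : Fin (r + 1) => iteratedDerivWithin i φ (Icc a b) t • v) = 0 := by
  obtain ⟨hadm, δ, hδ, hmin⟩ := hy
  have hu := uniqueDiffOn_Icc hab
  have hyC := ((isAdmissible_Icc hab).1 hadm).1
  have hφk : ∀ k : ℕ, ContDiff ℝ k φ := fun k => hφ.of_le (by exact_mod_cast le_top)
  have hyc : ∀ c : ℝ, ContDiffOn ℝ (2 * r : ℕ) (fun s => y s + (c * φ s) • v) (Icc a b) :=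
    fun c => hyC.add ((contDiff_const.mul (hφk _)).smul contDiff_const).contDiffOn
  have hend : ∀ t ∈ Icc a b, t ∉ Ioo a b → ∀ j, iteratedDerivWithin j φ (Icc a b) t = 0 :=
    fun t ht ht' j => iteratedDerivWithin_of_notMem_tsupport ht (fun h => ht' (hφs h)) j
  set w : ℝ → Fin (r + 1) → EuclideanSpace ℝ (Fin n) :=
    fun t i => iteratedDerivWithin i φ (Icc a b) t • v with hw
  have hwc : ContinuousOn w (Icc a b) := continuousOn_pi.2 fun i =>
    ((hφ.contDiffOn (s := Icc a b)).continuousOn_iteratedDerivWithin (by exact_mod_cast le_top)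
      hu).smul continuousOn_const
  have hjet : ∀ c : ℝ, ∀ t ∈ Icc a b, jet (Icc a b) r (fun s => y s + (c * φ s) • v) t =
      jet (Icc a b) r y t + c • w t := by
    intro c t ht
    funext i
    have hi := i.is_lt
    rw [Pi.add_apply, Pi.smul_apply, jet_Icc hab _ ht, jet_Icc hab _ ht,
      iteratedDerivWithin_add_mul_smul hab hφ c v (hyC.of_le (by exact_mod_cast (by omega))) ht,
      hw, smul_smul]
  have hact : ∀ c : ℝ, action (Icc a b) a b L (fun s => y s + (c * φ s) • v) =
      ∫ t in a..b, L t (jet (Icc a b) r y t + c • w t) := by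
    intro c
    rw [action_Icc hab hL (hyc c)]
    refine intervalIntegral.integral_congr fun t ht => ?_
    rw [uIcc_of_le hab.le] at ht
    show L t _ = L t _
    rw [hjet c t ht]
  have hlocal : IsLocalMin (fun c : ℝ => ∫ t in a..b, L t (jet (Icc a b) r y t + c • w t)) 0 := by
    obtain ⟨C, hC⟩ := exists_normR_Icc_le (r := r) hab hφ v
    have hball : ∀ᶠ c : ℝ in 𝓝 0, |c| * C < δ := by
      have hc : Continuous fun c : ℝ => |c| * C := by fun_prop
      have := hc.tendsto 0
      rw [abs_zero, zero_mul] at this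
      exact this.eventually (gt_mem_nhds hδ)
    filter_upwards [hball] with c hc
    have hadmc : IsAdmissible (Icc a b) a b α β fun s => y s + (c * φ s) • v := by
      refine (isAdmissible_Icc hab).2 ⟨hyc c, fun j => ?_⟩
      have hj := j.is_lt
      have hyj : ContDiffOn ℝ (j : ℕ) y (Icc a b) := hyC.of_le (by exact_mod_cast (by omega))
      have hla := left_mem_Icc.2 hab.le
      have hrb := right_mem_Icc.2 hab.le
      rw [iteratedDerivWithin_add_mul_smul hab hφ c v hyj hla,
        iteratedDerivWithin_add_mul_smul hab hφ c v hyj hrb,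
        hend a hla (by simp), hend b hrb (by simp), mul_zero, zero_smul, add_zero, add_zero]
      exact ((isAdmissible_Icc hab).1 hadm).2 j
    have h1 := hmin _ hadmc (by
      simp only [add_sub_cancel_left]
      exact (hC c).trans_lt ((ENNReal.ofReal_lt_ofReal_iff hδ).2 hc))
    rw [hact, action_Icc hab hL hyC] at h1
    simpa only [zero_smul, add_zero] using h1
  have hL' : ContinuousOn (fun p : ℝ × (Fin (r + 1) → EuclideanSpace ℝ (Fin n)) =>
      fderiv ℝ (L p.1) p.2) (Icc a b ×ˢ univ) := hL.2.2.1
  exact hlocal.hasDerivAt_eq_zero (hasDerivAt_integral_lagrangian hab hL.1 hL.2.1 hL'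
    (contDiffOn_jet_Icc hab hyC).continuousOn hwc)

theorem euler_lagrange_Icc (hab : a < b) (hL : IsLagrangian (Icc a b) L)
    (hy : IsWeakLocalMin (Icc a b) a b L α β y) :
    (∀ i : Fin (r + 1), DeltaDifferentiable (kappa^[r] (Icc a b)) (i : ℕ)
      (fun t => partialU L i t (jet (Icc a b) r y t))) ∧
    ∀ t ∈ Icc a b, ∑ i : Fin (r + 1), (-1 : ℝ) ^ (i : ℕ) •
      deltaIter (kappa^[r] (Icc a b)) (fun s => partialU L i s (jet (Icc a b) r y s)) (i : ℕ) t
        = 0 := by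
  have hu := uniqueDiffOn_Icc hab
  have hyC := ((isAdmissible_Icc hab).1 hy.1).1
  set f : Fin (r + 1) → ℝ → EuclideanSpace ℝ (Fin n) :=
    fun i t => partialU L i t (jet (Icc a b) r y t) with hf
  have hfC : ∀ i, ContDiffOn ℝ r (f i) (Icc a b) := hL.contDiffOn_partialU hab hyC
  have hfi : ∀ i : Fin (r + 1), ContDiffOn ℝ (i : ℕ) (f i) (Icc a b) := fun i =>
    (hfC i).of_le (by have := i.is_lt; exact_mod_cast (by omega))
  rw [kappa_Icc hab]
  refine ⟨fun i => (deltaDifferentiable_Icc hab).2 fun j hj =>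
    (hfi i).differentiableOn_iteratedDerivWithin (by exact_mod_cast hj) hu, fun t ht => ?_⟩
  set E : ℝ → EuclideanSpace ℝ (Fin n) := fun s => ∑ i : Fin (r + 1), (-1 : ℝ) ^ (i : ℕ) •
    iteratedDerivWithin i (f i) (Icc a b) s with hE
  have hEt : ∑ i : Fin (r + 1), (-1 : ℝ) ^ (i : ℕ) • deltaIter (Icc a b) (f i) (i : ℕ) t = E t :=
    Finset.sum_congr rfl fun i _ => by rw [deltaIter_Icc hab _ _ ht]
  rw [hEt]
  have hEc : ContinuousOn E (Icc a b) := continuousOn_finsetSum _ fun i _ =>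
    ((hfi i).continuousOn_iteratedDerivWithin le_rfl hu).fun_const_smul _
  -- A fixed vector v reduces the system to the scalar fundamental lemma; at the end v = E(t).
  have key : ∀ v : EuclideanSpace ℝ (Fin n), ∀ s ∈ Icc a b, inner ℝ v (E s) = 0 := by
    intro v
    refine eqOn_zero_of_integral_mul_eq_zero hab (continuousOn_const.inner hEc) ?_
    intro φ hφ _ hφs
    have hφk : ∀ k : ℕ, ContDiffOn ℝ k φ (Icc a b) := fun k =>
      (hφ.of_le (by exact_mod_cast le_top)).contDiffOn
    have hend : ∀ t ∈ Icc a b, t ∉ Ioo a b → ∀ j, iteratedDerivWithin j φ (Icc a b) t = 0 :=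
      fun t ht ht' j => iteratedDerivWithin_of_notMem_tsupport ht (fun h => ht' (hφs h)) j
    have hI : ∀ {g : ℝ → ℝ}, ContinuousOn g (Icc a b) → IntervalIntegrable g volume a b :=
      fun hg => ContinuousOn.intervalIntegrable (by rwa [uIcc_of_le hab.le])
    have hgC : ∀ i : Fin (r + 1), ContDiffOn ℝ (i : ℕ) (fun s => innerSL ℝ v (f i s)) (Icc a b) :=
      fun i => (innerSL ℝ v).contDiff.comp_contDiffOn (hfi i)
    have hparts : ∀ i : Fin (r + 1), ∫ t in a..b, innerSL ℝ v (f i t) *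
        iteratedDerivWithin i φ (Icc a b) t = ∫ t in a..b, (-1 : ℝ) ^ (i : ℕ) *
          (iteratedDerivWithin i (fun s => innerSL ℝ v (f i s)) (Icc a b) t * φ t) := fun i => by
      rw [integral_mul_iteratedDerivWithin hab i (hφk i) (hgC i)
        (fun j _ => hend a (left_mem_Icc.2 hab.le) (by simp) j)
        (fun j _ => hend b (right_mem_Icc.2 hab.le) (by simp) j),
        intervalIntegral.integral_const_mul]
    have h0 := hy.integral_fderiv_eq_zero hab hL hφ hφs v
    calc ∫ t in a..b, inner ℝ v (E t) * φ t
        = ∫ t in a..b, ∑ i : Fin (r + 1), (-1 : ℝ) ^ (i : ℕ) *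
          (iteratedDerivWithin i (fun s => innerSL ℝ v (f i s)) (Icc a b) t * φ t) := by
          refine intervalIntegral.integral_congr fun s hs => ?_
          rw [uIcc_of_le hab.le] at hs
          simp only [hE, inner_sum, Finset.sum_mul]
          refine Finset.sum_congr rfl fun i _ => ?_
          rw [map_iteratedDerivWithin hab (innerSL ℝ v) (hfi i) hs, inner_smul_right,
            innerSL_apply_apply, mul_assoc]
      _ = ∑ i : Fin (r + 1), ∫ t in a..b, innerSL ℝ v (f i t) *
          iteratedDerivWithin i φ (Icc a b) t := by
          rw [intervalIntegral.integral_finsetSum]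
          · exact Finset.sum_congr rfl fun i _ => (hparts i).symm
          · intro i _
            exact hI (continuousOn_const.mul (((hgC i).continuousOn_iteratedDerivWithin le_rfl
              hu).mul hφ.continuous.continuousOn))
      _ = ∫ t in a..b, fderiv ℝ (L t) (jet (Icc a b) r y t)
          (fun i : Fin (r + 1) => iteratedDerivWithin i φ (Icc a b) t • v) := by
          rw [← intervalIntegral.integral_finsetSum]
          · refine intervalIntegral.integral_congr fun s hs => ?_
            rw [uIcc_of_le hab.le] at hs
            show _ = fderiv ℝ (L s) (jet (Icc a b) r y s) _
            rw [fderiv_eq_sum_inner_partialU (hL.2.1 s hs _)]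
            refine Finset.sum_congr rfl fun i _ => ?_
            rw [inner_smul_right, innerSL_apply_apply, real_inner_comm, mul_comm]
          · intro i _
            exact hI ((hgC i).continuousOn.mul
              ((hφk i).continuousOn_iteratedDerivWithin le_rfl hu))
      _ = 0 := h0
  exact inner_self_eq_zero.1 (key (E t) t ht)

end IntervalEulerLagrange

end TimeScale

theorem mainTheorem1 (n r : ℕ) (hr : 1 ≤ r)
    (T₀ : Set ℝ) (hT₀ : IsClosed T₀) (a b : ℝ) (ha : a ∈ T₀) (hb : b ∈ T₀) (hab : a < b)
    (T : Set ℝ) (hT : T = Set.Icc a b ∩ T₀)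
    (hcard : ((2 * r + 1 : ℕ) : ℕ∞) ≤ T.encard)
    (a₁ a₀ : ℝ) (ha₁ : 0 < a₁)
    (hH : ∀ t ∈ T, t < b → TimeScale.sigma T t = a₁ * t + a₀)
    (L : ℝ → (Fin (r + 1) → EuclideanSpace ℝ (Fin n)) → ℝ)
    (hL : TimeScale.IsLagrangian T L)
    (α β : Fin r → EuclideanSpace ℝ (Fin n))
    (y₀ : ℝ → EuclideanSpace ℝ (Fin n))
    (hy₀ : TimeScale.IsWeakLocalMin T a b L α β y₀) :
    (∀ i : Fin (r + 1),
      TimeScale.DeltaDifferentiable (TimeScale.kappa^[r] T) (i : ℕ)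
        (fun t => TimeScale.partialU L i t (TimeScale.jet T r y₀ t))) ∧
    ∀ t ∈ T, t ≤ (TimeScale.rho T)^[2 * r] b →
      ∑ i : Fin (r + 1), ((-1 : ℝ) ^ (i : ℕ) * (1 / a₁) ^ ((i : ℕ) * ((i : ℕ) - 1) / 2)) •
        TimeScale.deltaIter (TimeScale.kappa^[r] T)
          (fun s => TimeScale.partialU L i s (TimeScale.jet T r y₀ s)) (i : ℕ) t = 0 := by
  have hTc : IsCompact T := hT ▸ isCompact_Icc.inter_right hT₀
  have hTa : IsLeast T a := by
    subst hT
    exact ⟨⟨Set.left_mem_Icc.2 hab.le, ha⟩, fun x hx => hx.1.1⟩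
  have hTb : IsGreatest T b := by
    subst hT
    exact ⟨⟨Set.right_mem_Icc.2 hab.le, hb⟩, fun x hx => hx.1.2⟩
  -- The 2r + 1 points give the budget N = 2r: r truncations for the jet and r more for
  -- differentiating L_{u_i}.
  rcases TimeScale.eq_Icc_or_exists_disc hTc hTa hTb hab hcard ha₁ hH with ⟨h1, h2⟩ | ⟨e, he⟩
  · clear hT
    subst h1 h2
    have h := TimeScale.euler_lagrange_Icc hab hL hy₀
    refine ⟨h.1, fun t ht _ => ?_⟩
    simpa only [one_div_one, one_pow, mul_one] using h.2 t ht
  · have h := he.euler_lagrange hr hTc hTa hTb hL hy₀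
    refine ⟨h.1, fun t ht htb => h.2 t ?_⟩
    rw [(TimeScale.kappa_iterate hTc hTb (2 * r)).1]
    exact ⟨ht, htb⟩
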